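/- Let $\Bbbk$ be a field of characteristic $0$, let $V$ be a finite-dimensional $\mathbb Z$-graded $\Bbbk$-vector space with graded linear dual $V^*$ (functionals supported on $V_i$ have degree $-i$), and let $X=\,\uparrow\! V\oplus \downarrow\! V^*$, where $\uparrow$ raises and $\downarrow$ lowers degrees by one; thus $\downarrow\! V^*=(\uparrow\! V)^*$. Let $S(X)=\bigoplus_n S^n(X)$ be the free unital graded commutative associative algebra on $X$. For $n\ge 1$ let $\Upsilon_n\colon S^n(X)\otimes S^n(X)\to\Bbbk$ be the bilinear map with $$\Upsilon_n(\alpha,u)=-(-1)^{|\alpha||u|}\,\Upsilon_n(u,\alpha)=\alpha(u),\qquad \alpha\in S^n(\downarrow\! V^*),\ u\in S^n(\uparrow\! V),$$ and with $\Upsilon_n=0$ on all other components $S^p(\uparrow\! V)S^q(\downarrow\! V^*)\otimes S^s(\uparrow\! V)S^t(\downarrow\! V^*)$, $p+q=s+t=n$. Here $\alpha(u)=\sum_{\sigma\in\Sigma_n}\pm\,\alpha_1(u_{\sigma(1)})\cdots\alpha_n(u_{\sigma(n)})$ for $\alpha=\alpha_1\cdots\alpha_n$ and $u=u_1\cdots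 u_n$, with $\pm$ the Koszul sign of $\alpha_1\cdots\alpha_n u_1\cdots u_n\mapsto \alpha_1u_{\sigma(1)}\cdots\alpha_nu_{\sigma(n)}$. Then, for each $n \geq 1$, the formula $$[x_1\cdots x_s,\,y_1\cdots y_t]_n=\sum_{\sigma,\mu}\epsilon(\sigma)\epsilon(\mu)\; x_{\sigma(1)}\cdots x_{\sigma(s-n)}\;\Upsilon_n\big(x_{\sigma(s-n+1)}\cdots x_{\sigma(s)},\,y_{\mu(1)}\cdots y_{\mu(n)}\big)\;y_{\mu(n+1)}\cdots y_{\mu(t)}$$ for homogeneous $x_i,y_j\in X$, where $\sigma$ runs over $(s-n,n)$-shuffles, $\mu$ over $(n,t-n)$-shuffles (so that the sum is empty if $s<n$ or $t<n$) and $\epsilon$ denotes Koszul signs, gives a unique well-defined bilinear map $[-,-]_n\colon S(X)\otimes S(X)\to S(X)$, and the following holds. 1. The $\Bbbk[[h]]$-linear extension of $$[a',a'']=[a',a'']_1+[a',a'']_2\,h+[a',a'']_3\,h^2+\cdots,\qquad a',a''\in S(X),$$ to $S(X)[[h]]$, $|h|=0$, makes $S(X)$ a formal operator Lie algebra: it is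 a $\Bbbk[[h]]$-linear graded Lie bracket of degree $0$ on $S(X)[[h]]$, and $[-,-]_n$ is a differential operator of order $\le n$ in both variables. Here the differential operators of order $\le 0$ are the left multiplications $L_a$, and $\nabla$ has order $\le r$, $r \geq 1$, if the graded commutator $[\nabla,L_a]$ has order $\le r-1$ for all $a$. Moreover, for given $a',a''\in S(X)$, $[a',a'']_n=0$ for all $n$ big enough. 2. Let $B(V)=\downarrow^2 S(\uparrow\! V\oplus\uparrow\! V^*)$ and let $h$ now have degree $2$. The bracket $\{\{-,-\}\}$ on $B(V)[[h]]$ (the superbig bracket) induced from $[-,-]$ by the $h$-linear extension of the algebra isomorphism $S(\uparrow\! V\oplus\downarrow\! V^*)\cong S(\uparrow\! V\oplus\uparrow\! V^*)$, $\uparrow\! v\mapsto\uparrow\! v$, $\downarrow\!\alpha\mapsto\uparrow\!\alpha$, is a $\Bbbk[[h]]$-linear graded Lie bracket of degree $0$. It deforms the big bracket: there is a unique graded Poisson bracket on $S(X)$ whose values on $X$ are $\langle\alpha,u\rangle=-(-1)^{|u||\alpha|}\langle u,\alpha\rangle=\alpha(u)$ for $\alpha\in\downarrow\! V^*$, $u\in\uparrow\!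 V$ and $\langle\uparrow\! V,\uparrow\! V\rangle=\langle\downarrow\! V^*,\downarrow\! V^*\rangle=0$, and $\{\{-,-\}\}$ reduces modulo $h$ to the bracket (the big bracket) which it induces on $B(V)$ by the above isomorphism. 3. For $n\ge0$ the formula for $[-,-]_n$, with $\Upsilon_n$ replaced by the bilinear map on $S^n(X) \otimes S^n(X)$ that sends $(\alpha,u)$ to $\alpha(u)$ for $\alpha\in S^n(\downarrow\! V^*)$, $u\in S^n(\uparrow\! V)$ and that vanishes on all the other components, gives a unique well-defined bilinear map $\star_n$, with $\star_0$ the product of $S(X)$. The $\Bbbk[[h]]$-linear extension $\star$ of $\sum_{n\ge0}\star_n h^n$ is an associative product on $S(X)[[h]]$, $|h|=0$, and $h\,[f,g]=f\star g-(-1)^{|f||g|}g\star f$ for all homogeneous $f,g\in S(X)[[h]]$. -/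

import Mathlib

universe u v

/-! ### Free graded commutative algebras -/

section FreeGradedComm

variable {k : Type u} [Field k] {X : Type v} [AddCommGroup X] [Module k X]

/-- The relations `x y = (-1)^{|x||y|} y x`, for homogeneous generators `x`, `y`. -/
inductive GSymRel (gr : ℤ → Submodule k X) : TensorAlgebra k X → TensorAlgebra k X → Prop
  | comm {i j : ℤ} {x y : X} (hx : x ∈ gr i) (hy : y ∈ gr j) :
      GSymRel gr (TensorAlgebra.ι k x * TensorAlgebra.ι k y)
        ((i * j).negOnePow • (TensorAlgebra.ι k y * TensorAlgebra.ι k x))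

/-- `S(X)`: the free unital graded commutative associative algebra generated by the vector space
`X` graded by the subspaces `gr d`. -/
def GSym (gr : ℤ → Submodule k X) : Type (max u v) := RingQuot (GSymRel gr)

noncomputable instance (gr : ℤ → Submodule k X) : Ring (GSym gr) :=
  inferInstanceAs (Ring (RingQuot (GSymRel gr)))

noncomputable instance (gr : ℤ → Submodule k X) : Algebra k (GSym gr) :=
  inferInstanceAs (Algebra k (RingQuot (GSymRel gr)))

namespace GSym

/-- The inclusion of the generators, `X → S(X)`. -/
noncomputable def gen (gr : ℤ → Submodule k X) : X →ₗ[k] GSym gr :=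
  (RingQuot.mkAlgHom k (GSymRel gr)).toLinearMap ∘ₗ TensorAlgebra.ι k

/-- The product `x₁ x₂ ⋯ xₙ` in `S(X)` of generators. -/
noncomputable def word (gr : ℤ → Submodule k X) {n : ℕ} (x : Fin n → X) : GSym gr :=
  (List.ofFn fun i => gen gr (x i)).prod

/-- The degree `d` component of `S(X)`: it is spanned by the products of homogeneous generators
of total degree `d`. -/
noncomputable def deg (gr : ℤ → Submodule k X) (d : ℤ) : Submodule k (GSym gr) :=
  Submodule.span k {a | ∃ (n : ℕ) (x : Fin n → X) (e : Fin n → ℤ),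
    (∀ i, x i ∈ gr (e i)) ∧ ∑ i, e i = d ∧ a = word gr x}

theorem gen_mul_gen (gr : ℤ → Submodule k X) {i j : ℤ} {x y : X} (hx : x ∈ gr i)
    (hy : y ∈ gr j) :
    gen gr x * gen gr y = (i * j).negOnePow • (gen gr y * gen gr x) := by
  have h := RingQuot.mkAlgHom_rel k (GSymRel.comm (gr := gr) hx hy)
  rw [map_mul, Units.smul_def, map_zsmul, map_mul] at h
  exact h

/-- The universal property of `S(X)`. -/
noncomputable def lift (gr : ℤ → Submodule k X) {A : Type*} [Ring A] [Algebra k A]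
    (f : X →ₗ[k] A)
    (hf : ∀ (i j : ℤ) (x y : X), x ∈ gr i → y ∈ gr j →
      f x * f y = (i * j).negOnePow • (f y * f x)) : GSym gr →ₐ[k] A :=
  RingQuot.liftAlgHom k ⟨TensorAlgebra.lift k f, by
    rintro _ _ ⟨hx, hy⟩
    rw [map_mul, Units.smul_def, map_zsmul, map_mul, TensorAlgebra.lift_ι_apply,
      TensorAlgebra.lift_ι_apply, ← Units.smul_def]
    exact hf _ _ _ _ hx hy⟩

theorem lift_gen (gr : ℤ → Submodule k X) {A : Type*} [Ring A] [Algebra k A]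
    (f : X →ₗ[k] A)
    (hf : ∀ (i j : ℤ) (x y : X), x ∈ gr i → y ∈ gr j →
      f x * f y = (i * j).negOnePow • (f y * f x)) (x : X) :
    lift gr f hf (gen gr x) = f x := by
  have h := RingQuot.liftAlgHom_mkAlgHom_apply (S := k) (s := GSymRel gr)
    (TensorAlgebra.lift k f) (by
      rintro _ _ ⟨hx, hy⟩
      rw [map_mul, Units.smul_def, map_zsmul, map_mul, TensorAlgebra.lift_ι_apply,
        TensorAlgebra.lift_ι_apply, ← Units.smul_def]
      exact hf _ _ _ _ hx hy) (TensorAlgebra.ι k x)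
  rw [TensorAlgebra.lift_ι_apply] at h
  exact h

theorem hom_ext (gr : ℤ → Submodule k X) {A : Type*} [Ring A] [Algebra k A]
    {F G : GSym gr →ₐ[k] A} (h : ∀ x, F (gen gr x) = G (gen gr x)) : F = G := by
  apply RingQuot.ringQuot_ext' (S := k)
  apply TensorAlgebra.hom_ext
  ext x
  exact h x

end GSym

end FreeGradedComm

/-! ### Differential operators and formal operator Lie algebras -/

section OperatorLie

variable {k : Type u} [Field k] {A : Type v} [Ring A] [Algebra k A]

/-- The components `𝒜 d`, of degree `d`, make `A` a graded commutative associative algebra. -/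
structure IsGradedCommAlgebra (𝒜 : ℤ → Submodule k A) : Prop where
  internal : DirectSum.IsInternal 𝒜
  one_mem : (1 : A) ∈ 𝒜 0
  mul_mem : ∀ (i j : ℤ) (a b : A), a ∈ 𝒜 i → b ∈ 𝒜 j → a * b ∈ 𝒜 (i + j)
  comm : ∀ (i j : ℤ) (a b : A), a ∈ 𝒜 i → b ∈ 𝒜 j → a * b = (i * j).negOnePow • (b * a)

/-- `IsDiffOp 𝒜 r d D`: the homogeneous linear map `D`, of degree `d`, is a differential operator
of order `≤ r`. For `r = 0` this says that `D` is a left multiplication `L_a`; for `r + 1` that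
each graded commutator `[D, L_a] = D L_a - (-1)^{|D||a|} L_a D` is a differential operator of
order `≤ r`. -/
def IsDiffOp (𝒜 : ℤ → Submodule k A) : ℕ → ℤ → (A →ₗ[k] A) → Prop
  | 0, d, D => ∃ a ∈ 𝒜 d, D = LinearMap.mulLeft k a
  | r + 1, d, D => (∀ (e : ℤ) (x : A), x ∈ 𝒜 e → D x ∈ 𝒜 (d + e)) ∧
      ∀ (e : ℤ) (a : A), a ∈ 𝒜 e →
        IsDiffOp 𝒜 r (d + e) (D ∘ₗ LinearMap.mulLeft k a -
          (d * e).negOnePow • (LinearMap.mulLeft k a ∘ₗ D))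

/-- The bilinear map `c`, of degree `0`, is a differential operator of order `≤ r` in both
variables. In the first variable the fixed argument `b` is moved to the left of the variable, so
the operator in question is `x ↦ (-1)^{|x||b|} c(x, b)`. -/
def IsBiDiffOp (𝒜 : ℤ → Submodule k A) (r : ℕ) (c : A →ₗ[k] A →ₗ[k] A) : Prop :=
  ∀ (j : ℤ) (b : A), b ∈ 𝒜 j →
    IsDiffOp 𝒜 r j (c b) ∧
    ∃ D : A →ₗ[k] A,
      (∀ (i : ℤ) (x : A), x ∈ 𝒜 i → D x = (i * j).negOnePow • c x b) ∧ IsDiffOp 𝒜 r j D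

/-- The homogeneous elements of degree `d` of the `s`-fold desuspension of `A[[h]]`, where `h` has
degree `w`: the coefficient at `h^m` has degree `d + s - w m` in `A`. -/
def homogSeries (𝒜 : ℤ → Submodule k A) (w s d : ℤ) : Set (PowerSeries A) :=
  {f | ∀ m : ℕ, PowerSeries.coeff m f ∈ 𝒜 (d + s - w * m)}

/-- `B` is a `k[[h]]`-linear graded Lie bracket, of degree `0`, on the `s`-fold desuspension of
`A[[h]]`, where `h` has degree `w`. (Only used with `w` and `s` even.) -/
structure IsFormalLieBracket (𝒜 : ℤ → Submodule k A) (w s : ℤ)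
    (B : PowerSeries A → PowerSeries A → PowerSeries A) : Prop where
  add_left : ∀ f f' g, B (f + f') g = B f g + B f' g
  add_right : ∀ f g g', B f (g + g') = B f g + B f g'
  smul_left : ∀ (p : PowerSeries k) (f g : PowerSeries A),
    B (PowerSeries.map (algebraMap k A) p * f) g = PowerSeries.map (algebraMap k A) p * B f g
  smul_right : ∀ (p : PowerSeries k) (f g : PowerSeries A),
    B f (PowerSeries.map (algebraMap k A) p * g) = PowerSeries.map (algebraMap k A) p * B f g
  degree : ∀ (i j : ℤ) (f g : PowerSeries A), f ∈ homogSeries 𝒜 w s i →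
    g ∈ homogSeries 𝒜 w s j → B f g ∈ homogSeries 𝒜 w s (i + j)
  antisymm : ∀ (i j : ℤ) (f g : PowerSeries A), f ∈ homogSeries 𝒜 w s i →
    g ∈ homogSeries 𝒜 w s j → B f g = -((i * j).negOnePow • B g f)
  jacobi : ∀ (i j l : ℤ) (a b c : PowerSeries A), a ∈ homogSeries 𝒜 w s i →
    b ∈ homogSeries 𝒜 w s j → c ∈ homogSeries 𝒜 w s l →
    (i * l).negOnePow • B a (B b c) + (j * i).negOnePow • B b (B c a) +
      (l * j).negOnePow • B c (B a b) = 0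

/-- `A`, with the bracket `B` on `A[[h]]`, where `h` has degree `0`, is a formal operator Lie
algebra: `B` is a `k[[h]]`-linear Lie bracket whose restriction to `A` is
`[a, b] = ∑_{n ≥ 1} [a, b]_n h^{n-1}` with `[-,-]_n` a differential operator of order `≤ n` in
both variables. Here `c m` is `[-,-]_{m+1}`. -/
structure IsFormalOperatorLieAlgebra (𝒜 : ℤ → Submodule k A)
    (B : PowerSeries A → PowerSeries A → PowerSeries A) : Prop where
  algebra : IsGradedCommAlgebra 𝒜
  lie : IsFormalLieBracket 𝒜 0 0 B
  decomposition : ∃ c : ℕ → A →ₗ[k] A →ₗ[k] A,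
    (∀ a b : A, B (PowerSeries.C a) (PowerSeries.C b) = PowerSeries.mk fun m => c m a b) ∧
    ∀ m, IsBiDiffOp 𝒜 (m + 1) (c m)

/-- The `h`-linear and `h`-adically continuous extension to `A[[h]]` of the operation
`(a, b) ↦ ∑_m c_m(a, b) h^m`. -/
noncomputable def hExtend (c : ℕ → A →ₗ[k] A →ₗ[k] A) (f g : PowerSeries A) : PowerSeries A :=
  PowerSeries.mk fun N => ∑ p ∈ Finset.HasAntidiagonal.antidiagonal N, ∑ q ∈ Finset.HasAntidiagonal.antidiagonal p.2,
    c p.1 (PowerSeries.coeff q.1 f) (PowerSeries.coeff q.2 g)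

/-- The bracket obtained from the bracket `B` on `A[[h]]` via the `h`-linear extension of the
isomorphism `Φ : A ≅ A'`. -/
noncomputable def transportBracket {A' : Type*} [Ring A'] [Algebra k A'] (Φ : A ≃ₐ[k] A')
    (B : PowerSeries A → PowerSeries A → PowerSeries A) (f g : PowerSeries A') : PowerSeries A' :=
  PowerSeries.map (Φ : A →+* A')
    (B (PowerSeries.map (Φ.symm : A' →+* A) f) (PowerSeries.map (Φ.symm : A' →+* A) g))

end OperatorLie

/-! ### Koszul signs and shuffles -/

section Shuffles

/-- The Koszul sign `ε(σ)`, for graded symbols `x i` of degree `e i`, given by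
`x₁ ⋯ xₙ = ε(σ) x_{σ(1)} ⋯ x_{σ(n)}`. -/
def koszul {n : ℕ} (e : Fin n → ℤ) (σ : Equiv.Perm (Fin n)) : ℤˣ :=
  ∏ p : Fin n × Fin n,
    if p.1 < p.2 ∧ σ p.2 < σ p.1 then (e (σ p.1) * e (σ p.2)).negOnePow else 1

/-- The `(p, q)`-shuffles: permutations increasing on the first `p` and on the last `q` places. -/
def shuffles (p q : ℕ) : Finset (Equiv.Perm (Fin (p + q))) := by
  classical
  exact {σ | StrictMono (fun i : Fin p => σ (Fin.castAdd q i)) ∧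
    StrictMono (fun i : Fin q => σ (Fin.natAdd p i))}

end Shuffles

/-! ### The space `X = ↑V ⊕ ↓V*` and the pairings -/

section Superbig

variable {k : Type u} [Field k] {V : Type v} [AddCommGroup V] [Module k V]

/-- The degree `d` component of the dual `V*` of the graded vector space `V`: it consists of the
functionals that vanish on all components of `V` except that of degree `-d`. -/
def dualGr (𝒱 : ℤ → Submodule k V) (d : ℤ) : Submodule k (Module.Dual k V) where
  carrier := {φ | ∀ i, i ≠ -d → ∀ x ∈ 𝒱 i, φ x = 0}
  add_mem' := by
    intro a b ha hb i hi x hx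
    rw [LinearMap.add_apply, ha i hi x hx, hb i hi x hx, add_zero]
  zero_mem' := by
    intro i _ x _
    rfl
  smul_mem' := by
    intro c a ha i hi x hx
    rw [LinearMap.smul_apply, ha i hi x hx, smul_zero]

/-- The grading of `X = ↑V ⊕ ↓V*`. The underlying vector space is `V × V*`, with the degree of
the elements of `V` raised by one and that of the elements of `V*` lowered by one. -/
def grX (𝒱 : ℤ → Submodule k V) (d : ℤ) : Submodule k (V × Module.Dual k V) :=
  (𝒱 (d - 1)).prod (dualGr 𝒱 (d + 1))

/-- The grading of `↑V ⊕ ↑V*`, with the underlying vector space `V × V*`. -/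
def grY (𝒱 : ℤ → Submodule k V) (d : ℤ) : Submodule k (V × Module.Dual k V) :=
  (𝒱 (d - 1)).prod (dualGr 𝒱 (d - 1))

/-- The pairing `α(u)` between `α = α₁ ⋯ αₙ` in `Sⁿ(↓V*) ≅ Sⁿ(↑V)*` and `u = u₁ ⋯ uₙ` in
`Sⁿ(↑V)`, i.e. `∑_σ ± α₁(u_{σ(1)}) ⋯ αₙ(u_{σ(n)})` where `±` is the Koszul sign of
`α₁ ⋯ αₙ u₁ ⋯ uₙ ↦ α₁ u_{σ(1)} ⋯ αₙ u_{σ(n)}`. Here `αᵢ` is the component in `↓V*` of the element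
`x i` of `X`, of degree `c i`, and `uᵢ` is the component in `↑V` of `y i`, of degree `e i`. -/
def evalPairing (n : ℕ) (x : Fin n → V × Module.Dual k V) (c : Fin n → ℤ)
    (y : Fin n → V × Module.Dual k V) (e : Fin n → ℤ) : k :=
  ∑ σ : Equiv.Perm (Fin n),
    (koszul e σ *
      ∏ p : Fin n × Fin n, if p.1 < p.2 then (e (σ p.1) * c p.2).negOnePow else 1) •
    ∏ i, (x i).2 (y (σ i)).1

/-- The value `Υ(x₁ ⋯ xₙ, y₁ ⋯ yₙ)` of the pairing `Υ^{nn}_n : Sⁿ(X) ⊗ Sⁿ(X) → k` on products of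
homogeneous elements of `X`, of degrees `c i` and `e i`. Its only nonzero components are
`Υ(α, u) = α(u)` and `Υ(u, α) = -(-1)^{|α||u|} α(u)`, for `α` in `Sⁿ(↓V*)` and `u` in `Sⁿ(↑V)`. -/
def upsilon (n : ℕ) (x : Fin n → V × Module.Dual k V) (c : Fin n → ℤ)
    (y : Fin n → V × Module.Dual k V) (e : Fin n → ℤ) : k :=
  evalPairing n x c y e -
    ((∑ i, c i) * (∑ i, e i)).negOnePow • evalPairing n y e x c

/-- The operation `op` on `S(X)` is the extension of the order `n` pairing `K` between `Sⁿ(X)`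
and `Sⁿ(X)` by the shuffle formula
`op(x₁ ⋯ xₛ, y₁ ⋯ yₜ) = ∑_{σ, μ} ε(σ) ε(μ) x_{σ(1)} ⋯ x_{σ(s-n)} ·
  K(x_{σ(s-n+1)} ⋯ x_{σ(s)}, y_{μ(1)} ⋯ y_{μ(n)}) · y_{μ(n+1)} ⋯ y_{μ(t)}`,
where `σ` runs over the `(s-n, n)`-shuffles and `μ` over the `(n, t-n)`-shuffles; the sum is empty
if `s < n` or `t < n`. -/
structure IsShuffleExtension (𝒱 : ℤ → Submodule k V) (n : ℕ)
    (K : (Fin n → V × Module.Dual k V) → (Fin n → ℤ) →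
      (Fin n → V × Module.Dual k V) → (Fin n → ℤ) → k)
    (op : GSym (grX 𝒱) →ₗ[k] GSym (grX 𝒱) →ₗ[k] GSym (grX 𝒱)) : Prop where
  formula : ∀ (a b : ℕ) (x : Fin (a + n) → V × Module.Dual k V) (c : Fin (a + n) → ℤ)
    (y : Fin (n + b) → V × Module.Dual k V) (e : Fin (n + b) → ℤ),
    (∀ i, x i ∈ grX 𝒱 (c i)) → (∀ i, y i ∈ grX 𝒱 (e i)) →
    op (GSym.word (grX 𝒱) x) (GSym.word (grX 𝒱) y) =
      ∑ σ ∈ shuffles a n, ∑ μ ∈ shuffles n b,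
        (koszul c σ * koszul e μ) •
          (GSym.word (grX 𝒱) (fun i : Fin a => x (σ (Fin.castAdd n i))) *
            algebraMap k (GSym (grX 𝒱))
              (K (fun i => x (σ (Fin.natAdd a i))) (fun i => c (σ (Fin.natAdd a i)))
                (fun i => y (μ (Fin.castAdd b i))) (fun i => e (μ (Fin.castAdd b i)))) *
            GSym.word (grX 𝒱) (fun i : Fin b => y (μ (Fin.natAdd n i))))
  short_left : ∀ (s t : ℕ) (x : Fin s → V × Module.Dual k V) (y : Fin t → V × Module.Dual k V),
    s < n → op (GSym.word (grX 𝒱) x) (GSym.word (grX 𝒱) y) = 0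
  short_right : ∀ (s t : ℕ) (x : Fin s → V × Module.Dual k V) (y : Fin t → V × Module.Dual k V),
    t < n → op (GSym.word (grX 𝒱) x) (GSym.word (grX 𝒱) y) = 0

/-- `P` is the graded Poisson bracket on `S(X)` that extends the canonical pairing
`⟨α, u⟩ = -(-1)^{|α||u|} ⟨u, α⟩ = α(u)` on `X`, with `⟨↑V, ↑V⟩ = ⟨↓V*, ↓V*⟩ = 0`. -/
structure IsCanonicalPoisson (𝒱 : ℤ → Submodule k V)
    (P : GSym (grX 𝒱) →ₗ[k] GSym (grX 𝒱) →ₗ[k] GSym (grX 𝒱)) : Prop where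
  on_gen : ∀ (i j : ℤ) (x y : V × Module.Dual k V), x ∈ grX 𝒱 i → y ∈ grX 𝒱 j →
    P (GSym.gen (grX 𝒱) x) (GSym.gen (grX 𝒱) y) =
      algebraMap k _ (x.2 y.1 - (i * j).negOnePow • y.2 x.1)
  degree : ∀ (i j : ℤ) (a b : GSym (grX 𝒱)), a ∈ GSym.deg (grX 𝒱) i →
    b ∈ GSym.deg (grX 𝒱) j → P a b ∈ GSym.deg (grX 𝒱) (i + j)
  leibniz_right : ∀ (i j : ℤ) (a b c : GSym (grX 𝒱)), a ∈ GSym.deg (grX 𝒱) i →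
    b ∈ GSym.deg (grX 𝒱) j → P a (b * c) = P a b * c + (i * j).negOnePow • (b * P a c)
  leibniz_left : ∀ (j l : ℤ) (a b c : GSym (grX 𝒱)), b ∈ GSym.deg (grX 𝒱) j →
    c ∈ GSym.deg (grX 𝒱) l → P (a * b) c = a * P b c + (j * l).negOnePow • (P a c * b)
  antisymm : ∀ (i j : ℤ) (a b : GSym (grX 𝒱)), a ∈ GSym.deg (grX 𝒱) i →
    b ∈ GSym.deg (grX 𝒱) j → P a b = -((i * j).negOnePow • P b a)
  jacobi : ∀ (i j l : ℤ) (a b c : GSym (grX 𝒱)), a ∈ GSym.deg (grX 𝒱) i →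
    b ∈ GSym.deg (grX 𝒱) j → c ∈ GSym.deg (grX 𝒱) l →
    (i * l).negOnePow • P a (P b c) + (j * i).negOnePow • P b (P c a) +
      (l * j).negOnePow • P c (P a b) = 0

theorem negOnePow_eq_of_even_sub {m n : ℤ} (h : Even (m - n)) : m.negOnePow = n.negOnePow := by
  rw [← sub_add_cancel m n, Int.negOnePow_add, Int.negOnePow_even _ h, one_mul]

theorem mem_grX_iff (𝒱 : ℤ → Submodule k V) (d : ℤ) (x : V × Module.Dual k V) :
    x ∈ grX 𝒱 d ↔ x.1 ∈ 𝒱 (d - 1) ∧ x.2 ∈ dualGr 𝒱 (d + 1) := Iff.rfl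

theorem mem_grY_iff (𝒱 : ℤ → Submodule k V) (d : ℤ) (x : V × Module.Dual k V) :
    x ∈ grY 𝒱 d ↔ x.1 ∈ 𝒱 (d - 1) ∧ x.2 ∈ dualGr 𝒱 (d - 1) := Iff.rfl

/-- Graded commutativity of `x` and `y` may be checked on their components in `V` and `V*`. -/
theorem gen_comm_aux {gr gr' : ℤ → Submodule k (V × Module.Dual k V)} (s s' : ℤ)
    (hs : Even s) (hs' : Even s')
    (h₁ : ∀ i x, x ∈ gr i → (x.1, (0 : Module.Dual k V)) ∈ gr' (i + s))
    (h₂ : ∀ i x, x ∈ gr i → ((0 : V), x.2) ∈ gr' (i + s'))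
    (i j : ℤ) (x y : V × Module.Dual k V) (hx : x ∈ gr i) (hy : y ∈ gr j) :
    GSym.gen gr' x * GSym.gen gr' y =
      (i * j).negOnePow • (GSym.gen gr' y * GSym.gen gr' x) := by
  have dec : ∀ z : V × Module.Dual k V,
      GSym.gen gr' z = GSym.gen gr' (z.1, 0) + GSym.gen gr' (0, z.2) := by
    intro z
    rw [← map_add, Prod.mk_add_mk, add_zero, zero_add]
  have key : ∀ (p q : ℤ), Even p → Even q →
      ((i + p) * (j + q)).negOnePow = (i * j).negOnePow := by
    intro p q hp hq
    apply negOnePow_eq_of_even_sub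
    have : (i + p) * (j + q) - i * j = i * q + p * (j + q) := by ring
    rw [this]
    exact (hq.mul_left i).add (hp.mul_right _)
  have e11 := GSym.gen_mul_gen gr' (h₁ i x hx) (h₁ j y hy)
  have e12 := GSym.gen_mul_gen gr' (h₁ i x hx) (h₂ j y hy)
  have e21 := GSym.gen_mul_gen gr' (h₂ i x hx) (h₁ j y hy)
  have e22 := GSym.gen_mul_gen gr' (h₂ i x hx) (h₂ j y hy)
  rw [key _ _ hs hs] at e11
  rw [key _ _ hs hs'] at e12
  rw [key _ _ hs' hs] at e21
  rw [key _ _ hs' hs'] at e22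
  rw [dec x, dec y]
  simp only [mul_add, add_mul, smul_add, e11, e12, e21, e22]
  abel

theorem gen_comm_XY (𝒱 : ℤ → Submodule k V) (i j : ℤ) (x y : V × Module.Dual k V)
    (hx : x ∈ grX 𝒱 i) (hy : y ∈ grX 𝒱 j) :
    GSym.gen (grY 𝒱) x * GSym.gen (grY 𝒱) y =
      (i * j).negOnePow • (GSym.gen (grY 𝒱) y * GSym.gen (grY 𝒱) x) := by
  refine gen_comm_aux (gr := grX 𝒱) 0 2 (by decide) (by decide) ?_ ?_ i j x y hx hy
  · intro d z hz
    rw [mem_grX_iff] at hz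
    rw [mem_grY_iff, add_zero]
    exact ⟨hz.1, Submodule.zero_mem _⟩
  · intro d z hz
    rw [mem_grX_iff] at hz
    rw [mem_grY_iff, show d + 2 - 1 = d + 1 by ring]
    exact ⟨Submodule.zero_mem _, hz.2⟩

theorem gen_comm_YX (𝒱 : ℤ → Submodule k V) (i j : ℤ) (x y : V × Module.Dual k V)
    (hx : x ∈ grY 𝒱 i) (hy : y ∈ grY 𝒱 j) :
    GSym.gen (grX 𝒱) x * GSym.gen (grX 𝒱) y =
      (i * j).negOnePow • (GSym.gen (grX 𝒱) y * GSym.gen (grX 𝒱) x) := by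
  refine gen_comm_aux (gr := grY 𝒱) 0 (-2) (by decide) (by decide) ?_ ?_ i j x y hx hy
  · intro d z hz
    rw [mem_grY_iff] at hz
    rw [mem_grX_iff, add_zero]
    exact ⟨hz.1, Submodule.zero_mem _⟩
  · intro d z hz
    rw [mem_grY_iff] at hz
    rw [mem_grX_iff, show d + -2 + 1 = d - 1 by ring]
    exact ⟨Submodule.zero_mem _, hz.2⟩

/-- The algebra isomorphism `S(↑V ⊕ ↓V*) ≅ S(↑V ⊕ ↑V*)` that sends `↑v ↦ ↑v` and `↓φ ↦ ↑φ`. As a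
map to `B(V) = ↓² S(↑V ⊕ ↑V*)` it only shifts degrees, by even numbers. -/
noncomputable def regrade (𝒱 : ℤ → Submodule k V) : GSym (grX 𝒱) ≃ₐ[k] GSym (grY 𝒱) :=
  AlgEquiv.ofAlgHom
    (GSym.lift (grX 𝒱) (GSym.gen (grY 𝒱)) (gen_comm_XY 𝒱))
    (GSym.lift (grY 𝒱) (GSym.gen (grX 𝒱)) (gen_comm_YX 𝒱))
    (by
      apply GSym.hom_ext
      intro x
      rw [AlgHom.comp_apply, GSym.lift_gen, GSym.lift_gen, AlgHom.id_apply])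
    (by
      apply GSym.hom_ext
      intro x
      rw [AlgHom.comp_apply, GSym.lift_gen, GSym.lift_gen, AlgHom.id_apply])

end Superbig

/-! Up to a factor `h`, the bracket is the graded commutator of a star product of Moyal type, and
the claims are read off from that product. Let B be the non-symmetric form on X with B(α, u) = α(u)
and zero on the other components. The product f ⋆ g is multiplication after exp(hB), where B
contracts letters of f with letters of g; its n-th component sums over all ways to contract n
letters of f with n letters of g.

The components come from a recursion on the left factor, not from the shuffle sum: for a generator
x, (x f) ⋆ g = x (f ⋆ g) + h (-1)^{|x||f|} f ⋆ ∂_x g, where ∂_x is the twisted derivation extending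
B(x, -). This is well defined because the operators attached to generators satisfy the relations of
S(X) (`starOp_comm`), so its universal property applies. Contractions are derivations of the star
product (`contract_star`), which gives associativity by induction (`starH_assoc`).

The form (-1)^{|x||y|} B(y, x) has the graded opposite star product (`star_op`), and `bracket` is
the difference of the two. Since `star 0` is the graded commutative product, h [f, g] is the graded
commutator; multiplication by `h` is injective, so antisymmetry and Jacobi follow from associativity
(`isFormalLieBracket`). By the recursion, f ⋆_n - is built from left multiplications and at most n
derivations, hence has order ≤ n (`isDiffOp_star`), and it vanishes once n exceeds the number of
letters of f.

The shuffle formula arises by unwinding the recursion along the left word (`star_word`) and then the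
Leibniz rule along the right word (`contractWord_word`); both match the recursion of shuffles
according to the block that receives the first letter. Words span S(X), so the formula determines
the operations.

For the superbig bracket, the construction sees degrees only through their parity. Replacing ↓V* by
↑V* shifts degrees by 2 and turns B into a form of degree 2, so the general theorem applies again
with `h` of degree 2, and `map_bracket` identifies the two brackets. Modulo `h` only the first
bracket survives; it satisfies the Leibniz rules and has the prescribed values on X, which determine
it. -/

/-! ### Signs -/

section Sign

variable (k : Type u) [Field k]

/-- The sign `(-1)^{ij}` as an element of the ground field. -/
def koszulSign (i j : ℤ) : k := (((i * j).negOnePow : ℤˣ) : ℤ)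

variable {k}

theorem negOnePow_smul_eq {M : Type*} [AddCommGroup M] [Module k M] (i j : ℤ) (a : M) :
    (i * j).negOnePow • a = koszulSign k i j • a := by
  rw [koszulSign, Units.smul_def, Int.cast_smul_eq_zsmul]

theorem negOnePow_smul_eq_of_ring {A : Type*} [Ring A] [Algebra k A] (i j : ℤ) (a : A) :
    (i * j).negOnePow • a = koszulSign k i j • a := by
  rw [koszulSign, Units.smul_def, Int.cast_smul_eq_zsmul]

theorem koszulSign_add_left (i i' j : ℤ) :
    koszulSign k (i + i') j = koszulSign k i j * koszulSign k i' j := by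
  simp [koszulSign, add_mul, Int.negOnePow_add]

theorem koszulSign_comm (i j : ℤ) : koszulSign k i j = koszulSign k j i := by
  rw [koszulSign, mul_comm, koszulSign]

theorem koszulSign_add_right (i j j' : ℤ) :
    koszulSign k i (j + j') = koszulSign k i j * koszulSign k i j' := by
  rw [koszulSign_comm, koszulSign_add_left, koszulSign_comm j, koszulSign_comm j']

@[simp]
theorem koszulSign_mul_self (i j : ℤ) : koszulSign k i j * koszulSign k i j = 1 := by
  rw [koszulSign, ← Int.cast_mul, ← Units.val_mul, Int.units_mul_self]
  simp

@[simp]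
theorem koszulSign_zero_left (j : ℤ) : koszulSign k 0 j = 1 := by simp [koszulSign]

@[simp]
theorem koszulSign_zero_right (j : ℤ) : koszulSign k j 0 = 1 := by simp [koszulSign]

theorem koszulSign_of_even_left {i : ℤ} (h : Even i) (j : ℤ) : koszulSign k i j = 1 := by
  simp [koszulSign, Int.negOnePow_even _ (h.mul_right j)]

theorem koszulSign_congr_left {i i' : ℤ} (h : Even (i - i')) (j : ℤ) :
    koszulSign k i j = koszulSign k i' j := by
  rw [← sub_add_cancel i i', koszulSign_add_left, koszulSign_of_even_left h, one_mul]

theorem koszulSign_congr_right {j j' : ℤ} (h : Even (j - j')) (i : ℤ) :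
    koszulSign k i j = koszulSign k i j' := by
  rw [koszulSign_comm, koszulSign_congr_left h, koszulSign_comm]

end Sign

/-! ### Linear maps on a graded vector space -/

section Graded

variable {k : Type u} [Field k] {X : Type v} [AddCommGroup X] [Module k X]
variable {gr : ℤ → Submodule k X}

/-- The linear map on an internal direct sum with given restrictions to the summands. -/
noncomputable def gradedLift (hgr : DirectSum.IsInternal gr) {M : Type*} [AddCommMonoid M]
    [Module k M] (φ : ∀ i, gr i →ₗ[k] M) : X →ₗ[k] M :=
  DirectSum.toModule k ℤ M φ ∘ₗ (LinearEquiv.ofBijective (DirectSum.coeLinearMap gr)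
    (show Function.Bijective (DirectSum.coeLinearMap gr) from hgr)).symm.toLinearMap

theorem gradedLift_apply (hgr : DirectSum.IsInternal gr) {M : Type*} [AddCommMonoid M]
    [Module k M] (φ : ∀ i, gr i →ₗ[k] M) {i : ℤ} {x : X} (hx : x ∈ gr i) :
    gradedLift hgr φ x = φ i ⟨x, hx⟩ := by
  have h : (LinearEquiv.ofBijective (DirectSum.coeLinearMap gr)
      (show Function.Bijective (DirectSum.coeLinearMap gr) from hgr)).symm x = DirectSum.lof k ℤ
          (fun i => gr i) i ⟨x, hx⟩ := by
    rw [LinearEquiv.symm_apply_eq, LinearEquiv.ofBijective_apply, DirectSum.coeLinearMap_lof]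
  rw [gradedLift, LinearMap.comp_apply, LinearEquiv.coe_coe, h, DirectSum.toModule_lof]

/-- An element of `gr d` that also lies in the sum of the other components is fixed and killed by `π
d`, hence zero. -/
theorem isInternal_of_projections (π : ℤ → X →ₗ[k] X) (h : ∀ d, ∀ x ∈ gr d, π d x = x)
    (h₀ : ∀ d e, e ≠ d → ∀ x ∈ gr e, π d x = 0) (htop : ⨆ d, gr d = ⊤) :
    DirectSum.IsInternal gr := by
  rw [DirectSum.isInternal_submodule_iff_iSupIndep_and_iSup_eq_top]
  refine ⟨fun d => ?_, htop⟩
  rw [Submodule.disjoint_def]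
  intro x hx hx'
  rw [← h d x hx]
  have : ⨆ e, ⨆ (_ : e ≠ d), gr e ≤ LinearMap.ker (π d) :=
    iSup_le fun e => iSup_le fun he x hx => h₀ d e he x hx
  exact this hx'

theorem graded_induction (hgr : DirectSum.IsInternal gr) {P : X → Prop}
    (mem : ∀ i, ∀ x ∈ gr i, P x) (add : ∀ x y, P x → P y → P (x + y)) (x : X) : P x := by
  have hx : x ∈ ⨆ i, gr i := by
    rw [hgr.submodule_iSup_eq_top]
    trivial
  exact Submodule.iSup_induction gr (motive := P) hx mem (mem 0 0 (Submodule.zero_mem _)) add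

/-- The automorphism `x ↦ (-1)^{i|x|} x`. -/
noncomputable def twist (hgr : DirectSum.IsInternal gr) (i : ℤ) : X →ₗ[k] X :=
  gradedLift hgr fun d => koszulSign k i d • (gr d).subtype

theorem twist_apply (hgr : DirectSum.IsInternal gr) (i : ℤ) {d : ℤ} {x : X} (hx : x ∈ gr d) :
    twist hgr i x = koszulSign k i d • x :=
  gradedLift_apply hgr _ hx

end Graded

/-! ### Induction principles for S(X) -/

namespace GSym

variable {k : Type u} [Field k] {X : Type v} [AddCommGroup X] [Module k X]
variable {gr : ℤ → Submodule k X}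

theorem gen_mul_gen' {i j : ℤ} {x y : X} (hx : x ∈ gr i) (hy : y ∈ gr j) :
    gen gr x * gen gr y = koszulSign k i j • (gen gr y * gen gr x) := by
  rw [gen_mul_gen gr hx hy, negOnePow_smul_eq (k := k)]

/-- A subalgebra that contains the generators is everything. -/
theorem eq_top_of_gen_mem (A : Subalgebra k (GSym gr)) (h : ∀ x, gen gr x ∈ A) : A = ⊤ := by
  -- The generators factor through `A`, so the universal property gives a map to `A`; followed by
  -- the inclusion it fixes the generators, hence is the identity.
  let F : GSym gr →ₐ[k] A := lift gr ((gen gr).codRestrict (Subalgebra.toSubmodule A) h) (by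
    intro i j x y hx hy
    apply Subtype.ext
    rw [negOnePow_smul_eq (k := k)]
    exact gen_mul_gen' hx hy)
  have hF : A.val.comp F = AlgHom.id k (GSym gr) := by
    apply hom_ext
    intro x
    rw [AlgHom.comp_apply, lift_gen]
    rfl
  rw [eq_top_iff]
  intro a _
  have := congrArg (fun G : GSym gr →ₐ[k] GSym gr => G a) hF
  simp only [AlgHom.comp_apply, AlgHom.id_apply] at this
  rw [← this]
  exact (F a).2

/-- A subspace that contains `1` and is stable under multiplication by a set of generators
spanning `X` is everything. -/
theorem eq_top_of_gen_mul_mem (T : Set X) (hT : Submodule.span k T = ⊤)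
    (p : Submodule k (GSym gr)) (one : (1 : GSym gr) ∈ p)
    (gen_mul : ∀ x ∈ T, ∀ f ∈ p, gen gr x * f ∈ p) : p = ⊤ := by
  -- The elements whose left multiplication preserves `p` form a subalgebra; once it is everything,
  -- acting on `1` gives the claim.
  let A : Subalgebra k (GSym gr) :=
    { carrier := {a | ∀ f ∈ p, a * f ∈ p}
      mul_mem' := fun ha hb f hf => by
        rw [mul_assoc]
        exact ha _ (hb _ hf)
      add_mem' := fun ha hb f hf => by
        rw [add_mul]
        exact p.add_mem (ha _ hf) (hb _ hf)
      algebraMap_mem' := fun c f hf => by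
        rw [← Algebra.smul_def]
        exact p.smul_mem c hf }
  have hA : A = ⊤ := by
    apply eq_top_of_gen_mem
    intro x
    have hx : x ∈ Submodule.span k T := by rw [hT]; trivial
    induction hx using Submodule.span_induction with
    | mem x hx => exact fun f hf => gen_mul x hx f hf
    | zero => rw [map_zero]; exact A.zero_mem
    | add x y _ _ hx hy => rw [map_add]; exact A.add_mem hx hy
    | smul c x _ hx => rw [map_smul]; exact A.smul_mem hx c
  rw [eq_top_iff]
  intro a _
  have : a ∈ A := by rw [hA]; trivial
  simpa using this 1 one

theorem span_homogeneous (hgr : DirectSum.IsInternal gr) :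
    Submodule.span k {x | ∃ i, x ∈ gr i} = ⊤ := by
  rw [eq_top_iff, ← hgr.submodule_iSup_eq_top]
  exact iSup_le fun i x hx => Submodule.subset_span ⟨i, hx⟩

theorem linearMap_ext (hgr : DirectSum.IsInternal gr) {M : Type*} [AddCommGroup M] [Module k M]
    {F G : GSym gr →ₗ[k] M} (one : F 1 = G 1)
    (gen_mul : ∀ i, ∀ x ∈ gr i, ∀ f, F f = G f → F (gen gr x * f) = G (gen gr x * f)) :
    F = G := by
  have h := eq_top_of_gen_mul_mem _ (span_homogeneous hgr) (LinearMap.eqLocus F G) one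
    (fun x ⟨i, hx⟩ f hf => gen_mul i x hx f hf)
  ext f
  have : f ∈ LinearMap.eqLocus F G := by rw [h]; trivial
  exact this

/-- Induction on elements of `S(X)`, from right to left along products of homogeneous
generators. -/
theorem induction (hgr : DirectSum.IsInternal gr) {P : GSym gr → Prop}
    (algebraMap : ∀ c : k, P (algebraMap k _ c)) (add : ∀ f g, P f → P g → P (f + g))
    (gen_mul : ∀ i, ∀ x ∈ gr i, ∀ f, P f → P (gen gr x * f)) (f : GSym gr) : P f := by
  -- Quantifying over scalar multiples yields a subspace although `P` is only assumed additive.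
  let p : Submodule k (GSym gr) :=
    { carrier := {f | ∀ c : k, P (c • f)}
      add_mem' := fun hf hg c => by
        rw [smul_add]
        exact add _ _ (hf c) (hg c)
      zero_mem' := fun c => by
        rw [smul_zero]
        simpa using algebraMap 0
      smul_mem' := fun c f hf c' => by
        rw [smul_smul]
        exact hf _ }
  have h := eq_top_of_gen_mul_mem _ (span_homogeneous hgr) p
    (fun c => by rw [← Algebra.algebraMap_eq_smul_one]; exact algebraMap c)
    (fun x ⟨i, hx⟩ f hf c => by
      rw [← mul_smul_comm]
      exact gen_mul i x hx _ (hf c))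
  have : f ∈ p := by rw [h]; trivial
  simpa using this 1

/-! ### The grading -/

theorem word_zero (x : Fin 0 → X) : word gr x = 1 := by simp [word]

theorem word_succ {n : ℕ} (x : Fin (n + 1) → X) :
    word gr x = gen gr (x 0) * word gr (fun i => x i.succ) := by
  simp [word, List.ofFn_succ]

theorem one_mem_deg : (1 : GSym gr) ∈ deg gr 0 :=
  Submodule.subset_span ⟨0, Fin.elim0, Fin.elim0, fun i => i.elim0, by simp, by simp [word_zero]⟩

theorem word_mem_deg {n : ℕ} {x : Fin n → X} {e : Fin n → ℤ} (h : ∀ i, x i ∈ gr (e i)) :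
    word gr x ∈ deg gr (∑ i, e i) :=
  Submodule.subset_span ⟨n, x, e, h, rfl, rfl⟩

theorem gen_mul_mem_deg {i d : ℤ} {x : X} (hx : x ∈ gr i) {f : GSym gr} (hf : f ∈ deg gr d) :
    gen gr x * f ∈ deg gr (i + d) := by
  induction hf using Submodule.span_induction with
  | mem f hf =>
    obtain ⟨n, y, e, hy, rfl, rfl⟩ := hf
    refine Submodule.subset_span ⟨n + 1, Fin.cons x y, Fin.cons i e, ?_, ?_, ?_⟩
    · intro j
      refine Fin.cases ?_ (fun j => ?_) j
      · simpa using hx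
      · simpa using hy j
    · simp [Fin.sum_univ_succ]
    · simp [word_succ]
  | zero => rw [mul_zero]; exact Submodule.zero_mem _
  | add f g _ _ hf hg => rw [mul_add]; exact Submodule.add_mem _ hf hg
  | smul c f _ hf => rw [mul_smul_comm]; exact Submodule.smul_mem _ _ hf

theorem gen_mem_deg {i : ℤ} {x : X} (hx : x ∈ gr i) : gen gr x ∈ deg gr i := by
  have := gen_mul_mem_deg hx (one_mem_deg (gr := gr))
  rwa [mul_one, add_zero] at this

/-- Induction on the length of homogeneous words. Many sign rules below take `p d` to be the
equalizer of two linear maps, with a sign depending on `d`. -/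
theorem deg_le {p : ℤ → Submodule k (GSym gr)} (one : 1 ∈ p 0)
    (gen_mul : ∀ i d, ∀ x ∈ gr i, ∀ f ∈ deg gr d, f ∈ p d → gen gr x * f ∈ p (i + d)) (d : ℤ) :
    deg gr d ≤ p d := by
  rw [deg, Submodule.span_le]
  rintro _ ⟨n, x, e, hx, rfl, rfl⟩
  induction n with
  | zero => simpa [word_zero] using one
  | succ n ih =>
    rw [word_succ, Fin.sum_univ_succ]
    exact gen_mul _ _ _ (hx 0) _ (word_mem_deg fun i => hx i.succ) (ih _ _ fun i => hx i.succ)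

theorem deg_induction {P : ℤ → GSym gr → Prop} (zero : ∀ d, P d 0)
    (add : ∀ d f g, P d f → P d g → P d (f + g)) (smul : ∀ d (c : k) f, P d f → P d (c • f))
    (one : P 0 1)
    (gen_mul : ∀ i d, ∀ x ∈ gr i, ∀ f ∈ deg gr d, P d f → P (i + d) (gen gr x * f)) {d : ℤ}
    {f : GSym gr} (hf : f ∈ deg gr d) : P d f :=
  deg_le (p := fun d =>
    { carrier := {f | P d f}
      add_mem' := fun hf hg => add _ _ _ hf hg
      zero_mem' := zero d
      smul_mem' := fun c f hf => smul d c f hf }) one gen_mul d hf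

theorem mul_mem_deg {i j : ℤ} {f g : GSym gr} (hf : f ∈ deg gr i) (hg : g ∈ deg gr j) :
    f * g ∈ deg gr (i + j) := by
  refine deg_le (p := fun i => (deg gr (i + j)).comap (LinearMap.mulRight k g)) ?_ ?_ i hf
  · simpa using hg
  · intro i d x hx f _ hf
    simp only [Submodule.mem_comap, LinearMap.mulRight_apply] at hf ⊢
    rw [mul_assoc, add_assoc]
    exact gen_mul_mem_deg hx hf

theorem gen_mul_comm {i j : ℤ} {x : X} (hx : x ∈ gr i) {f : GSym gr} (hf : f ∈ deg gr j) :
    gen gr x * f = koszulSign k i j • (f * gen gr x) := by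
  refine deg_le (p := fun j => LinearMap.eqLocus (LinearMap.mulLeft k (gen gr x))
    (koszulSign k i j • LinearMap.mulRight k (gen gr x))) ?_ ?_ j hf
  · simp
  · intro l d y hy f _ hf
    simp only [LinearMap.mem_eqLocus, LinearMap.smul_apply, LinearMap.mulLeft_apply,
      LinearMap.mulRight_apply] at hf ⊢
    rw [← mul_assoc, gen_mul_gen' hx hy, smul_mul_assoc, mul_assoc, hf, mul_smul_comm, smul_smul,
      koszulSign_add_right, mul_assoc]

theorem mul_comm' {i j : ℤ} {f g : GSym gr} (hf : f ∈ deg gr i) (hg : g ∈ deg gr j) :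
    f * g = koszulSign k i j • (g * f) := by
  refine deg_le (p := fun i => LinearMap.eqLocus (LinearMap.mulRight k g)
    (koszulSign k i j • LinearMap.mulLeft k g)) ?_ ?_ i hf
  · simp
  · intro l d y hy f _ hf
    simp only [LinearMap.mem_eqLocus, LinearMap.smul_apply, LinearMap.mulLeft_apply,
      LinearMap.mulRight_apply] at hf ⊢
    rw [mul_assoc, hf, mul_smul_comm, ← mul_assoc, gen_mul_comm hy hg, smul_mul_assoc, smul_smul,
      koszulSign_add_left, mul_comm (koszulSign k d j), mul_assoc]

/-- The algebra map `f ↦ f T^{|f|}` to the Laurent polynomials. -/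
noncomputable def toLaurent (hgr : DirectSum.IsInternal gr) :
    GSym gr →ₐ[k] AddMonoidAlgebra (GSym gr) ℤ :=
  lift gr (gradedLift hgr fun d =>
      AddMonoidAlgebra.lsingle d ∘ₗ gen gr ∘ₗ (gr d).subtype) (by
    intro i j x y hx hy
    rw [negOnePow_smul_eq (k := k), gradedLift_apply hgr _ hx, gradedLift_apply hgr _ hy]
    simp only [LinearMap.comp_apply, Submodule.subtype_apply, AddMonoidAlgebra.lsingle_apply]
    rw [AddMonoidAlgebra.single_mul_single, AddMonoidAlgebra.single_mul_single,
      gen_mul_gen' hx hy, add_comm j i, AddMonoidAlgebra.smul_single])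

theorem toLaurent_apply (hgr : DirectSum.IsInternal gr) {d : ℤ} {f : GSym gr}
    (hf : f ∈ deg gr d) : toLaurent hgr f = AddMonoidAlgebra.single d f := by
  refine deg_le (p := fun d => LinearMap.eqLocus (toLaurent hgr).toLinearMap
      (AddMonoidAlgebra.lsingle d)) ?_ ?_ d hf
  · simp only [LinearMap.mem_eqLocus, AlgHom.toLinearMap_apply, map_one,
      AddMonoidAlgebra.lsingle_apply]
    rfl
  · intro i d x hx f _ hf
    simp only [LinearMap.mem_eqLocus, AlgHom.toLinearMap_apply,
      AddMonoidAlgebra.lsingle_apply] at hf ⊢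
    rw [map_mul, hf, toLaurent, lift_gen, gradedLift_apply hgr _ hx]
    exact AddMonoidAlgebra.single_mul_single ..

theorem iSup_deg (hgr : DirectSum.IsInternal gr) : ⨆ d, deg gr d = ⊤ := by
  refine eq_top_of_gen_mul_mem _ (span_homogeneous hgr) _
    (Submodule.mem_iSup_of_mem 0 one_mem_deg) ?_
  rintro x ⟨i, hx⟩ f hf
  refine Submodule.iSup_induction (deg gr) (motive := fun f => gen gr x * f ∈ ⨆ d, deg gr d) hf
    (fun d f hf => Submodule.mem_iSup_of_mem (i + d) (gen_mul_mem_deg hx hf)) ?_ ?_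
  · rw [mul_zero]; exact Submodule.zero_mem _
  · intro f g hf hg
    rw [mul_add]; exact Submodule.add_mem _ hf hg

/-- The exponent in `toLaurent` records the degree, so its coefficient maps separate the components.
-/
theorem isInternal_deg (hgr : DirectSum.IsInternal gr) : DirectSum.IsInternal (deg gr) := by
  refine isInternal_of_projections (fun d => Finsupp.lapply d ∘ₗ
    (AddMonoidAlgebra.coeffLinearEquiv k).toLinearMap ∘ₗ (toLaurent hgr).toLinearMap) ?_ ?_
    (iSup_deg hgr)
  · intro d f hf
    simp [toLaurent_apply hgr hf, -LaurentPolynomial.single_eq_C_mul_T]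
  · intro d e hne f hf
    simp [toLaurent_apply hgr hf, hne, -LaurentPolynomial.single_eq_C_mul_T]

theorem isGradedCommAlgebra (hgr : DirectSum.IsInternal gr) : IsGradedCommAlgebra (deg gr) where
  internal := isInternal_deg hgr
  one_mem := one_mem_deg
  mul_mem _ _ _ _ := mul_mem_deg
  comm i j a b ha hb := by rw [negOnePow_smul_eq (k := k)]; exact mul_comm' ha hb

/-! ### The parity automorphisms -/

/-- The automorphism `f ↦ (-1)^{i|f|} f`. -/
noncomputable def par (hgr : DirectSum.IsInternal gr) (i : ℤ) : GSym gr →ₐ[k] GSym gr :=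
  lift gr (gen gr ∘ₗ twist hgr i) (by
    intro j l x y hx hy
    rw [negOnePow_smul_eq (k := k), LinearMap.comp_apply, LinearMap.comp_apply,
      twist_apply hgr i hx, twist_apply hgr i hy, map_smul, map_smul, smul_mul_smul_comm,
      smul_mul_smul_comm, gen_mul_gen' hx hy, smul_comm, mul_comm (koszulSign k i j)])

theorem par_gen (hgr : DirectSum.IsInternal gr) (i : ℤ) {j : ℤ} {x : X} (hx : x ∈ gr j) :
    par hgr i (gen gr x) = koszulSign k i j • gen gr x := by
  rw [par, lift_gen, LinearMap.comp_apply, twist_apply hgr i hx, map_smul]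

theorem par_apply (hgr : DirectSum.IsInternal gr) (i : ℤ) {d : ℤ} {f : GSym gr}
    (hf : f ∈ deg gr d) : par hgr i f = koszulSign k i d • f := by
  refine deg_le (p := fun d => LinearMap.eqLocus (par hgr i).toLinearMap
    (koszulSign k i d • LinearMap.id)) ?_ ?_ d hf
  · simp
  · intro j d x hx f _ hf
    simp only [LinearMap.mem_eqLocus, AlgHom.toLinearMap_apply, LinearMap.smul_apply,
      LinearMap.id_apply] at hf ⊢
    rw [map_mul, hf, par_gen hgr i hx, smul_mul_smul_comm, koszulSign_add_right]

theorem par_par_comm (hgr : DirectSum.IsInternal gr) (i j : ℤ) (f : GSym gr) :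
    par hgr i (par hgr j f) = par hgr j (par hgr i f) := by
  have : (par hgr i).comp (par hgr j) = (par hgr j).comp (par hgr i) := by
    apply hom_ext
    intro x
    induction x using graded_induction hgr with
    | mem d x hx => simp [par_gen hgr _ hx, smul_smul, mul_comm]
    | add x y hx hy => rw [map_add, map_add, map_add, hx, hy]
  exact DFunLike.congr_fun this f

theorem par_self (hgr : DirectSum.IsInternal gr) (i : ℤ) (f : GSym gr) :
    par hgr i (par hgr i f) = f := by
  have : (par hgr i).comp (par hgr i) = AlgHom.id k _ := by
    apply hom_ext
    intro x
    induction x using graded_induction hgr with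
    | mem d x hx => simp [par_gen hgr _ hx, smul_smul]
    | add x y hx hy => rw [map_add, map_add, map_add, hx, hy]
  exact DFunLike.congr_fun this f

theorem par_congr (hgr : DirectSum.IsInternal gr) {i j : ℤ} (h : Even (i - j)) :
    par hgr i = par hgr j := by
  apply hom_ext
  intro x
  induction x using graded_induction hgr with
  | mem d x hx => rw [par_gen hgr _ hx, par_gen hgr _ hx, koszulSign_congr_left h]
  | add x y hx hy => rw [map_add, map_add, map_add, hx, hy]

theorem par_par (hgr : DirectSum.IsInternal gr) (i j : ℤ) (f : GSym gr) :
    par hgr i (par hgr j f) = par hgr (i + j) f := by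
  have : (par hgr i).comp (par hgr j) = par hgr (i + j) := by
    apply hom_ext
    intro x
    induction x using graded_induction hgr with
    | mem d x hx =>
      simp [par_gen hgr _ hx, smul_smul, koszulSign_add_left, mul_comm]
    | add x y hx hy => rw [map_add, map_add, map_add, hx, hy]
  exact DFunLike.congr_fun this f

/-- Induction on elements of `S(X)` where the hypothesis covers the images under the parity
automorphisms. -/
theorem induction_par (hgr : DirectSum.IsInternal gr) {P : GSym gr → Prop}
    (algebraMap : ∀ c : k, P (algebraMap k _ c)) (add : ∀ f g, P f → P g → P (f + g))
    (gen_mul : ∀ i, ∀ x ∈ gr i, ∀ f, (∀ j, P (par hgr j f)) → P (gen gr x * f))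
    (f : GSym gr) : P f := by
  have h : ∀ j, P (par hgr j f) := by
    induction f using induction hgr with
    | algebraMap c => exact fun j => by rw [AlgHom.commutes]; exact algebraMap c
    | add f g hf hg => exact fun j => by rw [map_add]; exact add _ _ (hf j) (hg j)
    | gen_mul i x hx f hf =>
      intro j
      rw [map_mul, par_gen hgr j hx, ← map_smul]
      exact gen_mul i _ (Submodule.smul_mem _ _ hx) _ fun l => by rw [par_par]; exact hf _
  -- `par (0 + 0)` is rewritten as the square of `par 0`, which `par_self` cancels, leaving the
  -- statement for `f` itself. The same device recurs below.
  have := h (0 + 0)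
  rwa [← par_par, par_self] at this

end GSym

/-- A bilinear form on the graded space `X` which vanishes on `gr i × gr j` unless `i + j = s`,
for an even integer `s`. -/
structure GradedForm {k : Type u} [Field k] {X : Type v} [AddCommGroup X] [Module k X]
    (gr : ℤ → Submodule k X) (s : ℤ) where
  form : X →ₗ[k] X →ₗ[k] k
  even : Even s
  vanish : ∀ {i j : ℤ} {x y : X}, x ∈ gr i → y ∈ gr j → i + j ≠ s → form x y = 0

namespace GSym

variable {k : Type u} [Field k] {X : Type v} [AddCommGroup X] [Module k X]
variable {gr : ℤ → Submodule k X}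

/-! ### Twisted derivations -/

/-- The operators through which the generators act on pairs `(f, D f)`, for the twisted derivation
`D` of degree `i` that extends the functional `φ`. -/
noncomputable def derOp (hgr : DirectSum.IsInternal gr) (i : ℤ) (φ : X →ₗ[k] k) :
    X →ₗ[k] Module.End k (GSym gr × GSym gr) where
  toFun y := LinearMap.prod (LinearMap.mulLeft k (gen gr y) ∘ₗ LinearMap.fst k _ _)
    (φ y • LinearMap.fst k _ _ +
      LinearMap.mulLeft k (par hgr i (gen gr y)) ∘ₗ LinearMap.snd k _ _)
  map_add' y z := by
    ext f <;> simp [add_mul, add_smul]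
  map_smul' c y := by
    ext f <;> simp [smul_smul]

theorem derOp_apply (hgr : DirectSum.IsInternal gr) (i : ℤ) (φ : X →ₗ[k] k) (y : X)
    (p : GSym gr × GSym gr) : derOp hgr i φ y p =
      (gen gr y * p.1, φ y • p.1 + par hgr i (gen gr y) * p.2) := rfl

/-- The twisted derivation `D` of `S(X)` with `D (f g) = D f g + (-1)^{i|f|} f D g` that extends
the functional `φ`. -/
noncomputable def der (hgr : DirectSum.IsInternal gr) (i : ℤ) (φ : X →ₗ[k] k)
    (hφ : ∀ j, ∀ y ∈ gr j, φ y ≠ 0 → Even (i - j)) : GSym gr →ₗ[k] GSym gr :=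
  -- Starting from `(1, 0)`, the action of `f` produces the pair `(f, D f)`. What follows checks the
  -- relations of S(X) on arbitrary pairs.
  LinearMap.snd k _ _ ∘ₗ LinearMap.applyₗ (1, 0) ∘ₗ (lift gr (derOp hgr i φ) (by
    intro j l x y hx hy
    rw [negOnePow_smul_eq (k := k)]
    -- Where `φ x ≠ 0` the degree of `x` is congruent to `i` modulo 2, so the sign of `par hgr i` on
    -- `y` is the commutation sign of `x` and `y`.
    have h1 : φ x • par hgr i (gen gr y) = (koszulSign k j l * φ x) • gen gr y := by
      by_cases h : φ x = 0
      · simp [h]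
      · rw [par_gen hgr i hy, smul_smul, mul_comm, koszulSign_congr_left (hφ _ _ hx h)]
    have h2 : φ y • par hgr i (gen gr x) = (koszulSign k j l * φ y) • gen gr x := by
      by_cases h : φ y = 0
      · simp [h]
      · rw [par_gen hgr i hx, smul_smul, mul_comm, koszulSign_congr_left (hφ _ _ hy h),
          koszulSign_comm]
    refine LinearMap.ext fun p => ?_
    simp only [Module.End.mul_apply, derOp_apply, LinearMap.smul_apply, Prod.smul_mk]
    refine Prod.ext ?_ ?_
    · dsimp only
      rw [← mul_assoc, gen_mul_gen' hx hy, smul_mul_assoc, mul_assoc]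
    · dsimp only
      have h3 : par hgr i (gen gr x) * (par hgr i (gen gr y) * p.2) =
          koszulSign k j l • (par hgr i (gen gr y) * (par hgr i (gen gr x) * p.2)) := by
        rw [← mul_assoc, ← map_mul, gen_mul_gen' hx hy, map_smul, map_mul, smul_mul_assoc,
          mul_assoc]
      have h1' := congrArg (· * p.1) h1
      have h2' := congrArg (· * p.1) h2
      simp only [smul_mul_assoc] at h1' h2'
      rw [mul_add, mul_add, h3, mul_smul_comm, mul_smul_comm, h2', smul_add, smul_add, h1']
      linear_combination (norm := module) (-φ x * koszulSign_mul_self (k := k) j l) • (gen gr y *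
          p.1))).toLinearMap

section Der

variable (hgr : DirectSum.IsInternal gr) {i : ℤ} {φ : X →ₗ[k] k}
  (hφ : ∀ j, ∀ y ∈ gr j, φ y ≠ 0 → Even (i - j))

theorem der_one : der hgr i φ hφ 1 = 0 := by
  simp [der]

theorem der_gen_mul (y : X) (f : GSym gr) :
    der hgr i φ hφ (gen gr y * f) = φ y • f + par hgr i (gen gr y) * der hgr i φ hφ f := by
  have hfst : ∀ h, ∀ f : GSym gr, (lift gr (derOp hgr i φ) h f (1, 0)).1 = f := by
    intro h f
    refine DFunLike.congr_fun (f := LinearMap.fst k _ _ ∘ₗ LinearMap.applyₗ (1, 0) ∘ₗ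
      (lift gr (derOp hgr i φ) h).toLinearMap) (g := LinearMap.id) (linearMap_ext hgr ?_ ?_) f
    · simp
    · intro j y hy f hf
      simp only [LinearMap.comp_apply, AlgHom.toLinearMap_apply, LinearMap.applyₗ_apply_apply,
        LinearMap.fst_apply, LinearMap.id_apply] at hf ⊢
      rw [map_mul, Module.End.mul_apply, lift_gen, derOp_apply, hf]
  simp only [der, LinearMap.comp_apply, AlgHom.toLinearMap_apply, LinearMap.applyₗ_apply_apply,
    LinearMap.snd_apply]
  rw [map_mul, Module.End.mul_apply, lift_gen, derOp_apply, hfst]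

theorem der_algebraMap (c : k) : der hgr i φ hφ (algebraMap k _ c) = 0 := by
  rw [Algebra.algebraMap_eq_smul_one, map_smul, der_one, smul_zero]

theorem der_mul (f g : GSym gr) :
    der hgr i φ hφ (f * g) = der hgr i φ hφ f * g + par hgr i f * der hgr i φ hφ g := by
  induction f using induction hgr with
  | algebraMap c => simp [der_algebraMap, ← Algebra.smul_def]
  | add f f' hf hf' => rw [add_mul, map_add, hf, hf', map_add, map_add, add_mul, add_mul]; abel
  | gen_mul j x hx f hf =>
    rw [mul_assoc, der_gen_mul, hf, der_gen_mul, map_mul, add_mul, mul_add, smul_mul_assoc,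
      mul_assoc, mul_assoc, add_assoc]

theorem der_par (j : ℤ) (f : GSym gr) :
    der hgr i φ hφ (par hgr j f) = koszulSign k i j • par hgr j (der hgr i φ hφ f) := by
  induction f using induction hgr with
  | algebraMap c => simp [der_algebraMap]
  | add f f' hf hf' => simp only [map_add, hf, hf', smul_add]
  | gen_mul l x hx f hf =>
    rw [map_mul, par_gen hgr j hx, smul_mul_assoc, map_smul, der_gen_mul, hf, der_gen_mul, map_add,
      map_smul, map_mul, par_gen hgr i hx, map_smul, par_gen hgr j hx]
    by_cases h : φ x = 0
    · simp only [h, zero_smul, zero_add, mul_smul_comm, smul_mul_assoc]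
      module
    · rw [koszulSign_comm j l, ← koszulSign_congr_left (hφ l x hx h) j]
      simp only [smul_add, mul_smul_comm, smul_mul_assoc]
      module

/-- Each derivation removes its own letter; the two orders differ by a sign, which the parities of
the removed letters make equal to (-1)^{ij}. -/
theorem der_der {j : ℤ} {ψ : X →ₗ[k] k} (hψ : ∀ l, ∀ y ∈ gr l, ψ y ≠ 0 → Even (j - l))
    (f : GSym gr) : der hgr i φ hφ (der hgr j ψ hψ f) =
      koszulSign k i j • der hgr j ψ hψ (der hgr i φ hφ f) := by
  induction f using induction hgr with
  | algebraMap c => simp [der_algebraMap]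
  | add f f' hf hf' => simp only [map_add, hf, hf', smul_add]
  | gen_mul l x hx f hf =>
    have h1 : ψ x = 0 ∨ koszulSign k j l = koszulSign k j j ∧
        koszulSign k i l = koszulSign k i j := by
      by_cases h : ψ x = 0
      · exact Or.inl h
      · have := hψ l x hx h
        rw [← even_neg, neg_sub] at this
        exact Or.inr ⟨koszulSign_congr_right this _, koszulSign_congr_right this _⟩
    have h2 : φ x = 0 ∨ koszulSign k j l = koszulSign k i j := by
      by_cases h : φ x = 0
      · exact Or.inl h
      · have := hφ l x hx h
        rw [← even_neg, neg_sub] at this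
        exact Or.inr ((koszulSign_congr_right this _).trans (koszulSign_comm _ _))
    simp only [der_gen_mul, par_gen hgr _ hx, map_add, map_smul, smul_mul_assoc, hf, mul_smul_comm]
    obtain h1 | ⟨-, h1⟩ := h1 <;> obtain h2 | h2 := h2 <;> rw [h1, h2]
    · module
    · module
    · linear_combination (norm := module)
        (-ψ x * koszulSign_mul_self (k := k) i j) • der hgr i φ hφ f
    · linear_combination (norm := module)
        (-ψ x * koszulSign_mul_self (k := k) i j) • der hgr i φ hφ f

theorem der_mem_deg {s d : ℤ} (hs : ∀ j, ∀ y ∈ gr j, i + j ≠ s → φ y = 0) {f : GSym gr}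
    (hf : f ∈ deg gr d) : der hgr i φ hφ f ∈ deg gr (i + d - s) := by
  refine (deg_le (p := fun d => deg gr d ⊓ (deg gr (i + d - s)).comap (der hgr i φ hφ))
    ⟨one_mem_deg, ?_⟩ ?_ d hf).2
  · rw [SetLike.mem_coe, Submodule.mem_comap, der_one]
    exact Submodule.zero_mem _
  · rintro j d x hx f - ⟨hf, hf'⟩
    refine ⟨gen_mul_mem_deg hx hf, ?_⟩
    rw [SetLike.mem_coe, Submodule.mem_comap] at hf' ⊢
    rw [der_gen_mul, par_gen hgr i hx, smul_mul_assoc]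
    refine Submodule.add_mem _ ?_ (Submodule.smul_mem _ _ ?_)
    · by_cases h : i + j = s
      · rw [← add_assoc, h, add_sub_cancel_left]
        exact Submodule.smul_mem _ _ hf
      · rw [hs j x hx h, zero_smul]
        exact Submodule.zero_mem _
    · have := gen_mul_mem_deg hx hf'
      rwa [show j + (i + d - s) = i + (j + d) - s by ring] at this

end Der

end GSym

/-! ### The star product of a graded form, built from contractions -/

namespace GradedForm

open GSym

variable {k : Type u} [Field k] {X : Type v} [AddCommGroup X] [Module k X]
variable {gr : ℤ → Submodule k X} {s : ℤ}

theorem even_add (B : GradedForm gr s) {i j : ℤ} {x y : X} (hx : x ∈ gr i) (hy : y ∈ gr j)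
    (h : B.form x y ≠ 0) : Even (i + j) := by
  by_contra h'
  exact h (B.vanish hx hy fun e => h' (e ▸ B.even))

/-- Letters that pair nontrivially have the same parity, as `s` is even. This is the hypothesis of
`der` and the source of most sign cancellations. -/
theorem even_sub (B : GradedForm gr s) {i : ℤ} (x : gr i) (j : ℤ) (y : X) (hy : y ∈ gr j)
    (h : B.form x y ≠ 0) : Even (i - j) := by
  have := B.even_add x.2 hy h
  rw [Int.even_add] at this
  rwa [Int.even_sub]

variable (B : GradedForm gr s) (hgr : DirectSum.IsInternal gr)

/-- The contraction `∂_x = B(x, -)` as a twisted derivation of `S(X)`. -/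
noncomputable def contract (i : ℤ) : gr i →ₗ[k] GSym gr →ₗ[k] GSym gr where
  toFun x := der hgr i (B.form x) (B.even_sub x)
  map_add' x y := by
    refine linearMap_ext hgr ?_ fun j z hz f hf => ?_
    · simp [der_one]
    · rw [LinearMap.add_apply] at hf ⊢
      rw [der_gen_mul, hf, der_gen_mul, der_gen_mul, Submodule.coe_add, map_add,
        LinearMap.add_apply, add_smul, mul_add]
      abel
  map_smul' c x := by
    refine linearMap_ext hgr ?_ fun j z hz f hf => ?_
    · simp [der_one]
    · rw [RingHom.id_apply, LinearMap.smul_apply] at hf ⊢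
      rw [der_gen_mul, hf, der_gen_mul, Submodule.coe_smul, map_smul,
        LinearMap.smul_apply, smul_add, mul_smul_comm, smul_assoc]

theorem contract_apply {i : ℤ} (x : gr i) :
    B.contract hgr i x = der hgr i (B.form x) (B.even_sub x) := rfl

/-- Shift of the index of a sequence by one. -/
def shift (M : Type*) [AddCommGroup M] [Module k M] : (ℕ → M) →ₗ[k] (ℕ → M) where
  toFun T n := n.casesOn 0 T
  map_add' S T := by
    ext n
    cases n <;> simp
  map_smul' c T := by
    ext n
    cases n <;> simp

/-- The operators on sequences of endomorphisms of `S(X)` which define the products `star n`. -/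
noncomputable def starOp (i : ℤ) : gr i →ₗ[k] Module.End k (ℕ → (GSym gr →ₗ[k] GSym gr)) :=
  -- `T n` stands for `star n f`. The recursion needs `star n (par hgr i f)`, but `f` itself is not
  -- available here; conjugating the operator by `par hgr i` has this effect, as `par_star` later
  -- confirms. The shift counts the new contraction.
  LinearMap.mk₂ k (fun x T n => LinearMap.mulLeft k (gen gr x.1) ∘ₗ T n + shift (k := k) _
      (fun m => (par hgr i).toLinearMap ∘ₗ T m ∘ₗ (par hgr i).toLinearMap ∘ₗ B.contract hgr i x) n)
    (by
      intro x y T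
      ext n f
      cases n <;> simp [shift, add_mul]
      abel)
    (by
      intro c x T
      ext n f
      cases n <;> simp [shift])
    (by
      intro x S T
      ext n f
      cases n <;> simp [shift, mul_add]
      abel)
    (by
      intro c x T
      ext n f
      cases n <;> simp [shift])

theorem starOp_zero {i : ℤ} (x : gr i) (T : ℕ → (GSym gr →ₗ[k] GSym gr)) (f : GSym gr) :
    B.starOp hgr i x T 0 f = gen gr x * T 0 f := by
  simp [starOp, shift]

theorem starOp_succ {i : ℤ} (x : gr i) (T : ℕ → (GSym gr →ₗ[k] GSym gr)) (n : ℕ) (f : GSym gr) :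
    B.starOp hgr i x T (n + 1) f = gen gr x * T (n + 1) f +
      par hgr i (T n (par hgr i (B.contract hgr i x f))) := by
  simp [starOp, shift]

/-- This makes the star product well defined. Each of the two letters is multiplied or contracted:
multiplications and contractions commute up to the sign of `x` and `y`, and the two mixed terms are
exchanged. -/
theorem starOp_comm {i j : ℤ} (x : gr i) (y : gr j) (T : ℕ → (GSym gr →ₗ[k] GSym gr)) :
    B.starOp hgr i x (B.starOp hgr j y T) =
      koszulSign k i j • B.starOp hgr j y (B.starOp hgr i x T) := by
  have hc : ∀ f, gen gr x.1 * (gen gr y.1 * f) =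
      koszulSign k i j • (gen gr y.1 * (gen gr x.1 * f)) := by
    intro f
    rw [← mul_assoc, gen_mul_gen' x.2 y.2, smul_mul_assoc, mul_assoc]
  funext n
  ext f
  rw [Pi.smul_apply, LinearMap.smul_apply]
  -- At most `n` contractions occur in the component `n`, so the doubly contracted term is present
  -- only from index 2 on.
  match n with
  | 0 => simp only [starOp_zero, hc]
  | 1 =>
    simp only [starOp_zero, starOp_succ, hc, mul_add, map_mul, par_gen hgr _ x.2,
      par_gen hgr _ y.2, koszulSign_comm j i, smul_mul_assoc, smul_add]
    linear_combination (norm := module) (-koszulSign_mul_self (k := k) i j) •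
      (gen gr x.1 * par hgr j (T 0 (par hgr j (B.contract hgr j y f))))
  | n + 2 =>
    simp only [starOp_succ, hc, mul_add, map_add, map_mul, par_gen hgr _ x.2,
      par_gen hgr _ y.2, koszulSign_comm j i, smul_mul_assoc, smul_add, contract_apply, der_par,
      map_smul, par_par_comm hgr j i, der_der hgr (B.even_sub y) (B.even_sub x)]
    linear_combination (norm := module) (-koszulSign_mul_self (k := k) i j) •
      (gen gr x.1 * par hgr j (T (n + 1) (par hgr j (der hgr j (B.form y) (B.even_sub y) f))))

/-- The operators `starOp` for all elements of `X`. -/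
noncomputable def starGen : X →ₗ[k] Module.End k (ℕ → (GSym gr →ₗ[k] GSym gr)) :=
  gradedLift hgr (B.starOp hgr)

theorem starGen_apply {i : ℤ} {x : X} (hx : x ∈ gr i) :
    B.starGen hgr x = B.starOp hgr i ⟨x, hx⟩ :=
  gradedLift_apply hgr _ hx

theorem starGen_comm (i j : ℤ) (x y : X) (hx : x ∈ gr i) (hy : y ∈ gr j) :
    B.starGen hgr x * B.starGen hgr y =
      (i * j).negOnePow • (B.starGen hgr y * B.starGen hgr x) := by
  rw [starGen_apply B hgr hx, starGen_apply B hgr hy]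
  exact (LinearMap.ext fun T => B.starOp_comm hgr ⟨x, hx⟩ ⟨y, hy⟩ T).trans
    (negOnePow_smul_eq_of_ring (k := k) i j _).symm

/-- The action of `S(X)` defined by the operators `starOp`. -/
noncomputable def starRep : GSym gr →ₐ[k] Module.End k (ℕ → (GSym gr →ₗ[k] GSym gr)) :=
  lift gr (A := Module.End k (ℕ → (GSym gr →ₗ[k] GSym gr))) (B.starGen hgr) (B.starGen_comm hgr)

/-- The products `star n` on `S(X)` for which
`star n (x f) g = x star n f g + (-1)^{|x||f|} star (n - 1) f (∂_x g)`. -/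
noncomputable def star (n : ℕ) : GSym gr →ₗ[k] GSym gr →ₗ[k] GSym gr :=
  -- The initial sequence `(id, 0, 0, …)` is the star multiplication by `1`, which has no letter to
  -- contract.
  LinearMap.proj n ∘ₗ
    LinearMap.applyₗ (Pi.single 0 LinearMap.id : ℕ → (GSym gr →ₗ[k] GSym gr)) ∘ₗ
    (B.starRep hgr).toLinearMap

theorem star_gen_mul_eq (n : ℕ) {i : ℤ} {x : X} (hx : x ∈ gr i) (f : GSym gr) :
    B.star hgr n (gen gr x * f) =
      B.starOp hgr i ⟨x, hx⟩ (fun n => B.star hgr n f) n := by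
  simp only [star, LinearMap.comp_apply, AlgHom.toLinearMap_apply, LinearMap.proj_apply,
    LinearMap.applyₗ_apply_apply, map_mul, Module.End.mul_apply]
  rw [starRep, lift_gen, starGen_apply B hgr hx]

theorem star_zero_one (g : GSym gr) : B.star hgr 0 1 g = g := by
  simp [star]

theorem star_succ_one (n : ℕ) (g : GSym gr) : B.star hgr (n + 1) 1 g = 0 := by
  simp [star]

theorem star_zero_gen_mul {i : ℤ} {x : X} (hx : x ∈ gr i) (f g : GSym gr) :
    B.star hgr 0 (gen gr x * f) g = gen gr x * B.star hgr 0 f g := by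
  rw [star_gen_mul_eq B hgr 0 hx, starOp_zero]

theorem star_zero (f g : GSym gr) : B.star hgr 0 f g = f * g := by
  induction f using induction hgr with
  | algebraMap c => rw [Algebra.algebraMap_eq_smul_one, map_smul, LinearMap.smul_apply,
      star_zero_one, smul_mul_assoc, one_mul]
  | add f f' hf hf' => rw [map_add, LinearMap.add_apply, hf, hf', add_mul]
  | gen_mul i x hx f hf => rw [star_zero_gen_mul B hgr hx, hf, mul_assoc]

theorem star_zero_algebraMap (c : k) (g : GSym gr) :
    B.star hgr 0 (algebraMap k _ c) g = c • g := by
  rw [star_zero, Algebra.smul_def]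

theorem star_succ_algebraMap (n : ℕ) (c : k) (g : GSym gr) :
    B.star hgr (n + 1) (algebraMap k _ c) g = 0 := by
  rw [Algebra.algebraMap_eq_smul_one, map_smul, LinearMap.smul_apply, star_succ_one, smul_zero]

theorem contract_par {i : ℤ} (x : gr i) (j : ℤ) (f : GSym gr) : B.contract hgr i x (par hgr j f) =
    koszulSign k i j • par hgr j (B.contract hgr i x f) :=
  der_par hgr (B.even_sub x) j f

theorem contract_gen_mul {i j : ℤ} (x : gr i) {y : X} (hy : y ∈ gr j) (f : GSym gr) :
    B.contract hgr i x (gen gr y * f) =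
      B.form x y • f + koszulSign k i j • (gen gr y * B.contract hgr i x f) := by
  rw [contract_apply, der_gen_mul, par_gen hgr i hy, smul_mul_assoc]

theorem contract_mul {i : ℤ} (x : gr i) (f g : GSym gr) :
    B.contract hgr i x (f * g) = B.contract hgr i x f * g + par hgr i f * B.contract hgr i x g :=
  der_mul hgr (B.even_sub x) f g

theorem contract_algebraMap {i : ℤ} (x : gr i) (c : k) :
    B.contract hgr i x (algebraMap k _ c) = 0 :=
  der_algebraMap hgr (B.even_sub x) c

theorem contract_one {i : ℤ} (x : gr i) : B.contract hgr i x 1 = 0 :=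
  der_one hgr (B.even_sub x)

theorem contract_contract {i j : ℤ} (x : gr i) (y : gr j) (f : GSym gr) :
    B.contract hgr i x (B.contract hgr j y f) =
      koszulSign k i j • B.contract hgr j y (B.contract hgr i x f) :=
  der_der hgr (B.even_sub x) (B.even_sub y) f

theorem contract_mem_deg {i d : ℤ} (x : gr i) {f : GSym gr} (hf : f ∈ deg gr d) :
    B.contract hgr i x f ∈ deg gr (i + d - s) :=
  der_mem_deg hgr (B.even_sub x) (fun _ _ hy h => B.vanish x.2 hy h) hf

/-- A contraction removes two letters of equal parity, so all the products preserve parity. -/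
theorem par_star (n : ℕ) (j : ℤ) (f g : GSym gr) :
    par hgr j (B.star hgr n f g) = B.star hgr n (par hgr j f) (par hgr j g) := by
  induction f using induction hgr generalizing n g with
  | algebraMap c =>
    cases n <;> simp [star_zero_algebraMap, star_succ_algebraMap]
  | add f f' hf hf' => simp only [map_add, LinearMap.add_apply, hf, hf']
  | gen_mul i x hx f hf =>
    cases n with
    | zero => simp only [star_zero, map_mul]
    | succ n =>
      rw [star_gen_mul_eq B hgr _ hx, starOp_succ, map_mul, par_gen hgr j hx, smul_mul_assoc,
        map_smul, LinearMap.smul_apply, star_gen_mul_eq B hgr _ hx, starOp_succ, contract_par,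
        map_add, map_mul, hf, par_par_comm hgr j i, hf, par_par_comm hgr j i, par_gen hgr j hx,
        koszulSign_comm i j]
      simp only [map_smul, smul_add, smul_smul, koszulSign_mul_self, one_smul, smul_mul_assoc]

theorem star_succ_gen_mul (n : ℕ) {i : ℤ} {x : X} (hx : x ∈ gr i) (f g : GSym gr) :
    B.star hgr (n + 1) (gen gr x * f) g = gen gr x * B.star hgr (n + 1) f g +
      B.star hgr n (par hgr i f) (B.contract hgr i ⟨x, hx⟩ g) := by
  rw [star_gen_mul_eq B hgr _ hx, starOp_succ, par_star, par_self]

/-- The contractions are derivations of all products `star n`. -/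
theorem contract_star (n : ℕ) {i : ℤ} (x : gr i) (f g : GSym gr) :
    B.contract hgr i x (B.star hgr n f g) = B.star hgr n (B.contract hgr i x f) g +
      B.star hgr n (par hgr i f) (B.contract hgr i x g) := by
  induction f using induction_par hgr generalizing n g with
  | algebraMap c =>
    cases n <;> simp [star_zero_algebraMap, star_succ_algebraMap, contract_algebraMap]
  | add f f' hf hf' => simp only [map_add, LinearMap.add_apply, hf, hf']; abel
  | gen_mul j y hy f hf =>
    cases n with
    | zero => simp only [star_zero, contract_mul]
    | succ n =>
      have hf₀ := hf (0 + 0)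
      rw [← par_par, par_self] at hf₀
      -- On each side `x` hits the letter `y` once, with coefficient `B.form x y`. The rest is the
      -- induction hypothesis together with the graded commutation of the contractions by `x` and
      -- `y`.
      simp only [star_succ_gen_mul B hgr n hy, map_add, contract_gen_mul B hgr x hy, hf, hf₀,
          map_mul,
        par_gen hgr _ hy, smul_mul_assoc, map_smul, LinearMap.add_apply, LinearMap.smul_apply,
        contract_par, par_par_comm hgr j i, B.contract_contract hgr x ⟨y, hy⟩, mul_add, smul_add]
      abel

/-- Each of the `n` contractions removes two letters of total degree `s`. -/
theorem star_mem_deg (n : ℕ) {i j : ℤ} {f g : GSym gr} (hf : f ∈ deg gr i) (hg : g ∈ deg gr j) :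
    B.star hgr n f g ∈ deg gr (i + j - n * s) := by
  refine (deg_le (p := fun i => deg gr i ⊓ ⨅ n : ℕ, ⨅ j, ⨅ g : deg gr j,
    (deg gr (i + j - n * s)).comap (LinearMap.applyₗ g.1 ∘ₗ B.star hgr n)) ?_ ?_ i hf).2 |>
    fun h => by
      simp only [Submodule.mem_iInf, SetLike.mem_coe] at h
      exact h n j ⟨g, hg⟩
  · refine ⟨one_mem_deg, ?_⟩
    simp only [Submodule.mem_iInf, SetLike.mem_coe, Submodule.mem_comap, LinearMap.comp_apply,
      LinearMap.applyₗ_apply_apply]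
    rintro (_ | n) j ⟨g, hg⟩
    · simpa [star_zero_one] using hg
    · rw [star_succ_one]
      exact Submodule.zero_mem _
  · rintro i d x hx f - ⟨hf, hf'⟩
    refine ⟨gen_mul_mem_deg hx hf, ?_⟩
    simp only [Submodule.mem_iInf, SetLike.mem_coe, Submodule.mem_comap, LinearMap.comp_apply,
      LinearMap.applyₗ_apply_apply] at hf' ⊢
    rintro (_ | n) j ⟨g, hg⟩
    · have := gen_mul_mem_deg hx (hf' 0 j ⟨g, hg⟩)
      rw [star_zero_gen_mul B hgr hx]
      convert this using 2
      ring
    · rw [star_succ_gen_mul B hgr n hx]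
      refine Submodule.add_mem _ ?_ ?_
      · have := gen_mul_mem_deg hx (hf' (n + 1) j ⟨g, hg⟩)
        convert this using 2
        ring
      · have := hf' n _ ⟨_, B.contract_mem_deg hgr ⟨x, hx⟩ hg⟩
        rw [par_apply hgr i hf, map_smul, LinearMap.smul_apply]
        refine Submodule.smul_mem _ _ ?_
        convert this using 2
        push_cast
        ring

/-- No more letters can be contracted than occur in `f`, so each generator raises the bound by one.
-/
theorem exists_star_eq_zero (f : GSym gr) : ∃ N, ∀ n, N ≤ n → ∀ g, B.star hgr n f g = 0 := by
  induction f using induction hgr with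
  | algebraMap c =>
    refine ⟨1, fun n hn g => ?_⟩
    obtain ⟨n, rfl⟩ := Nat.exists_eq_add_of_le' hn
    exact star_succ_algebraMap ..
  | add f f' hf hf' =>
    obtain ⟨N, hN⟩ := hf
    obtain ⟨N', hN'⟩ := hf'
    refine ⟨max N N', fun n hn g => ?_⟩
    rw [map_add, LinearMap.add_apply, hN n (le_of_max_le_left hn), hN' n (le_of_max_le_right hn),
      add_zero]
  | gen_mul i x hx f hf =>
    obtain ⟨N, hN⟩ := hf
    refine ⟨N + 1, fun n hn g => ?_⟩
    obtain ⟨n, rfl⟩ := Nat.exists_eq_add_of_le' (le_of_add_le_right hn)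
    rw [star_succ_gen_mul B hgr n hx, hN _ (by omega), ← par_self hgr i (B.contract _ _ _ _),
      ← par_star, hN _ (by omega), map_zero, mul_zero, add_zero]

/-! ### The opposite form -/

/-- The form `(x, y) ↦ (-1)^{|x||y|} B(y, x)`. -/
noncomputable def op : GradedForm gr s where
  -- The sign used is (-1)^{|x|}: if B(y, x) ≠ 0 then x and y have equal parity, so |x||y| ≡ |x|
  -- modulo 2.
  form := B.form.flip ∘ₗ twist hgr 1
  even := B.even
  vanish := by
    intro i j x y hx hy h
    rw [LinearMap.comp_apply, twist_apply hgr 1 hx, map_smul, LinearMap.smul_apply,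
      LinearMap.flip_apply, B.vanish hy hx (by rwa [add_comm]), smul_zero]

theorem op_form {i j : ℤ} {x y : X} (hx : x ∈ gr i) (hy : y ∈ gr j) :
    (B.op hgr).form x y = koszulSign k i j * B.form y x := by
  by_cases h : B.form y x = 0
  · simp [op, twist_apply hgr 1 hx, h]
  · have hij := B.even_add hy hx h
    have : koszulSign k 1 i = koszulSign k i j := by
      rw [koszulSign, koszulSign, one_mul]
      congr 2
      apply negOnePow_eq_of_even_sub
      rw [Int.even_add] at hij
      rw [Int.even_sub, Int.even_mul]
      tauto
    simp [op, twist_apply hgr 1 hx, this]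

theorem star_mul_gen_zero (f g : GSym gr) {i : ℤ} {x : X} (hx : x ∈ gr i) :
    B.star hgr 0 g (gen gr x * f) = gen gr x * B.star hgr 0 (par hgr i g) f := by
  rw [star_zero, star_zero]
  induction g using induction hgr with
  | algebraMap c => simp [Algebra.algebraMap_eq_smul_one]
  | add g g' hg hg' => rw [add_mul, hg, hg', map_add, add_mul, mul_add]
  | gen_mul j y hy g hg =>
    rw [mul_assoc, hg, ← mul_assoc, gen_mul_gen' hy hx, map_mul, par_gen hgr i hy, mul_assoc,
      smul_mul_assoc, mul_assoc, smul_mul_assoc, mul_smul_comm, koszulSign_comm]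

/-- The recursion seen from the right factor: `x` moves out to the left past `g`, or is contracted
with a letter of `g`. That letter is the left argument of `B`, whence the opposite form. -/
theorem star_succ_gen_right (n : ℕ) (f g : GSym gr) {i : ℤ} {x : X} (hx : x ∈ gr i) :
    B.star hgr (n + 1) g (gen gr x * f) = gen gr x * B.star hgr (n + 1) (par hgr i g) f +
      B.star hgr n ((B.op hgr).contract hgr i ⟨x, hx⟩ (par hgr i g)) f := by
  induction g using induction_par hgr generalizing n f with
  | algebraMap c =>
    simp [star_succ_algebraMap, contract_algebraMap]
  | add g g' hg hg' => 
    simp only [map_add, LinearMap.add_apply, hg, hg', mul_add]; abel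
  | gen_mul j y hy g hg =>
    have hg₀ := hg (0 + 0)
    rw [← par_par, par_self] at hg₀
    have h1 : gen gr y * (gen gr x * B.star hgr (n + 1) (par hgr i g) f) = koszulSign k i j •
        (gen gr x * (gen gr y * B.star hgr (n + 1) (par hgr i g) f)) := by
      rw [← mul_assoc, gen_mul_gen' hy hx, koszulSign_comm, smul_mul_assoc, mul_assoc]
    have h2 : koszulSign k i j * (koszulSign k i j * B.form y x) = B.form y x := by
      rw [← mul_assoc, koszulSign_mul_self, one_mul]
    have h5 : par hgr j ((B.op hgr).contract hgr i ⟨x, hx⟩ (par hgr i g)) = koszulSign k i j •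
        (B.op hgr).contract hgr i ⟨x, hx⟩ (par hgr i (par hgr j g)) := by
      rw [par_par_comm hgr i j g, contract_par _ hgr _ j (par hgr i g), smul_smul,
          koszulSign_mul_self, one_smul]
    have h3 : B.form y x • par hgr j g = B.form y x • par hgr i g := by
      by_cases h : B.form y x = 0
      · rw [h, zero_smul, zero_smul]
      · rw [par_congr hgr (B.even_sub ⟨y, hy⟩ i x hx h)]
    cases n with
    | zero =>
      simp only [star_succ_gen_mul B hgr _ hy, star_zero_gen_mul B hgr hy,
        star_mul_gen_zero B hgr _ _ hx, hg₀, map_add, map_mul,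
        par_gen hgr _ hy, contract_gen_mul _ hgr _ hx, contract_gen_mul _ hgr _ hy, op_form B hgr
            hx hy, smul_mul_assoc, map_smul, LinearMap.add_apply, LinearMap.smul_apply,
        par_par_comm hgr j i, mul_add, smul_add, mul_smul_comm, h1,
        smul_smul, koszulSign_comm j i, koszulSign_mul_self, one_smul]
      have h4 := congrArg (fun g => B.star hgr 0 g f) h3
      simp only [map_smul, LinearMap.smul_apply] at h4
      rw [h4, h2]
      abel
    | succ n =>
      simp only [star_succ_gen_mul B hgr _ hy, hg, hg₀, map_add, map_mul,
        par_gen hgr _ hy, contract_gen_mul _ hgr _ hx, contract_gen_mul _ hgr _ hy, op_form B hgr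
            hx hy, smul_mul_assoc, map_smul, LinearMap.add_apply, LinearMap.smul_apply,
        par_par_comm hgr j i, mul_add, smul_add, mul_smul_comm, h1,
        smul_smul, koszulSign_comm j i, koszulSign_mul_self, one_smul]
      have h4 := congrArg (fun g => B.star hgr (n + 1) g f) h3
      simp only [map_smul, LinearMap.smul_apply] at h4
      rw [h4, h2, h5, map_smul, LinearMap.smul_apply]
      abel

theorem star_succ_right_one (n : ℕ) (g : GSym gr) : B.star hgr (n + 1) g 1 = 0 := by
  induction g using induction_par hgr generalizing n with
  | algebraMap c => rw [star_succ_algebraMap]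
  | add f g hf hg => rw [map_add, LinearMap.add_apply, hf, hg, add_zero]
  | gen_mul i x hx f hf =>
    have hf₀ := hf (0 + 0)
    rw [← par_par, par_self] at hf₀
    rw [star_succ_gen_mul B hgr n hx, hf₀, contract_one, map_zero, mul_zero, add_zero]

/-- The products of the opposite form are the graded opposites of the products `star n`. -/
theorem star_op (n : ℕ) {i j : ℤ} {f g : GSym gr} (hf : f ∈ deg gr i) (hg : g ∈ deg gr j) :
    (B.op hgr).star hgr n f g = koszulSign k i j • B.star hgr n g f := by
  refine deg_induction (P := fun i f => ∀ n j g, g ∈ deg gr j →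
    (B.op hgr).star hgr n f g = koszulSign k i j • B.star hgr n g f) ?_ ?_ ?_ ?_ ?_ hf n j g hg
  · simp
  · intro d f f' hf hf' n j g hg
    rw [map_add, map_add, LinearMap.add_apply, hf n j g hg, hf' n j g hg, smul_add]
  · intro d c f hf n j g hg
    rw [map_smul, map_smul, LinearMap.smul_apply, hf n j g hg, smul_comm]
  · intro n j g hg
    rw [koszulSign_zero_left, one_smul]
    cases n with
    | zero => rw [star_zero, star_zero, one_mul, mul_one]
    | succ n => rw [star_succ_one, star_succ_right_one]
  -- The left recursion for the opposite form is matched term by term with the right recursion for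
  -- `B`.
  · intro i d x hx f hfd hf n j g hg
    cases n with
    | zero =>
      rw [star_zero_gen_mul _ hgr hx, star_mul_gen_zero B hgr _ _ hx, hf 0 j g hg,
        par_apply hgr i hg, map_smul, LinearMap.smul_apply, mul_smul_comm, mul_smul_comm,
        smul_smul, koszulSign_add_left, mul_right_comm, koszulSign_mul_self, one_mul]
    | succ n =>
      have h := (B.op hgr).contract_mem_deg hgr ⟨x, hx⟩ hg
      have h1 : koszulSign k d (i + j - s) = koszulSign k d i * koszulSign k d j := by
        rw [← koszulSign_add_right]
        exact koszulSign_congr_right (by simpa using B.even) d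
      rw [star_succ_gen_mul _ hgr n hx, star_succ_gen_right B hgr n _ _ hx, hf _ _ g hg,
        par_apply hgr i hg, par_apply hgr i hfd, map_smul, map_smul, map_smul, map_smul,
        LinearMap.smul_apply, LinearMap.smul_apply, LinearMap.smul_apply, hf n _ _ h, h1,
        mul_smul_comm, mul_smul_comm, ← smul_add, smul_smul, smul_smul, koszulSign_add_left,
        mul_right_comm, koszulSign_mul_self, one_mul, ← mul_assoc, koszulSign_comm i d,
        koszulSign_mul_self, one_mul, smul_add]

end GradedForm

/-! ### Extension of operations to power series in `h` -/

section HExtend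

variable {k : Type u} [Field k] {A : Type v} [Ring A] [Algebra k A]

open PowerSeries in
/-- Additive maps between power series that commute with multiplication by the variable are
determined by their values on constants. -/
theorem powerSeries_addHom_ext {R S : Type*} [Ring R] [Ring S] {Φ Ψ : PowerSeries R → PowerSeries S}
    (hΦ : ∀ f g, Φ (f + g) = Φ f + Φ g) (hΨ : ∀ f g, Ψ (f + g) = Ψ f + Ψ g)
    (hΦX : ∀ f, Φ (X * f) = X * Φ f) (hΨX : ∀ f, Ψ (X * f) = X * Ψ f)
    (hC : ∀ a, Φ (C a) = Ψ (C a)) (f : PowerSeries R) : Φ f = Ψ f := by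
  -- Peeling off the constant term reduces coefficient `n + 1` of the value to coefficient `n` of
  -- the value at the tail, so no continuity is needed.
  have hdec : ∀ f : PowerSeries R, f = X * mk (fun n => coeff (n + 1) f) + C (coeff 0 f) := by
    intro f
    ext n
    cases n with
    | zero => simp
    | succ n => simp [coeff_succ_X_mul]
  ext n
  induction n generalizing f with
  | zero => rw [hdec f, hΦ, hΨ, hΦX, hΨX, hC]; simp
  | succ n ih =>
    rw [hdec f, hΦ, hΨ, hΦX, hΨX, hC, map_add, map_add, coeff_succ_X_mul, coeff_succ_X_mul, ih]

theorem coeff_hExtend (c : ℕ → A →ₗ[k] A →ₗ[k] A) (f g : PowerSeries A) (N : ℕ) :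
    PowerSeries.coeff N (hExtend c f g) = ∑ p ∈ Finset.HasAntidiagonal.antidiagonal N,
      ∑ q ∈ Finset.HasAntidiagonal.antidiagonal p.2,
        c p.1 (PowerSeries.coeff q.1 f) (PowerSeries.coeff q.2 g) :=
  PowerSeries.coeff_mk ..

theorem coeff_succ_hExtend (c : ℕ → A →ₗ[k] A →ₗ[k] A) (f g : PowerSeries A) (N : ℕ) :
    PowerSeries.coeff (N + 1) (hExtend c f g) =
      (∑ q ∈ Finset.HasAntidiagonal.antidiagonal (N + 1),
        c 0 (PowerSeries.coeff q.1 f) (PowerSeries.coeff q.2 g)) +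
      PowerSeries.coeff N (hExtend (fun n => c (n + 1)) f g) := by
  rw [coeff_hExtend, coeff_hExtend, Finset.Nat.sum_antidiagonal_succ]

theorem hExtend_add_left (c : ℕ → A →ₗ[k] A →ₗ[k] A) (f f' g : PowerSeries A) :
    hExtend c (f + f') g = hExtend c f g + hExtend c f' g := by
  ext N
  simp only [coeff_hExtend, map_add, LinearMap.add_apply, Finset.sum_add_distrib]

theorem hExtend_add_right (c : ℕ → A →ₗ[k] A →ₗ[k] A) (f g g' : PowerSeries A) :
    hExtend c f (g + g') = hExtend c f g + hExtend c f g' := by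
  ext N
  simp only [coeff_hExtend, map_add, Finset.sum_add_distrib]

theorem hExtend_X_mul_left (c : ℕ → A →ₗ[k] A →ₗ[k] A) (f g : PowerSeries A) :
    hExtend c (PowerSeries.X * f) g = PowerSeries.X * hExtend c f g := by
  ext N
  cases N with
  | zero => simp [coeff_hExtend]
  | succ N =>
    rw [PowerSeries.coeff_succ_X_mul, coeff_hExtend, Finset.Nat.sum_antidiagonal_succ']
    simp [coeff_hExtend, Finset.Nat.sum_antidiagonal_succ, PowerSeries.coeff_succ_X_mul]

theorem hExtend_X_mul_right (c : ℕ → A →ₗ[k] A →ₗ[k] A) (f g : PowerSeries A) :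
    hExtend c f (PowerSeries.X * g) = PowerSeries.X * hExtend c f g := by
  ext N
  cases N with
  | zero => simp [coeff_hExtend]
  | succ N =>
    rw [PowerSeries.coeff_succ_X_mul, coeff_hExtend, Finset.Nat.sum_antidiagonal_succ']
    simp [coeff_hExtend, Finset.Nat.sum_antidiagonal_succ', PowerSeries.coeff_succ_X_mul]

theorem hExtend_smul_left (c : ℕ → A →ₗ[k] A →ₗ[k] A) (t : k) (f g : PowerSeries A) :
    hExtend c (t • f) g = t • hExtend c f g := by
  ext N
  simp [coeff_hExtend, Finset.smul_sum]

theorem hExtend_smul_right (c : ℕ → A →ₗ[k] A →ₗ[k] A) (t : k) (f g : PowerSeries A) :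
    hExtend c f (t • g) = t • hExtend c f g := by
  ext N
  simp [coeff_hExtend, Finset.smul_sum]

theorem hExtend_sub_left (c : ℕ → A →ₗ[k] A →ₗ[k] A) (f f' g : PowerSeries A) :
    hExtend c (f - f') g = hExtend c f g - hExtend c f' g := by
  ext N
  simp only [coeff_hExtend, map_sub, LinearMap.sub_apply, Finset.sum_sub_distrib]

theorem hExtend_sub_right (c : ℕ → A →ₗ[k] A →ₗ[k] A) (f g g' : PowerSeries A) :
    hExtend c f (g - g') = hExtend c f g - hExtend c f g' := by
  ext N
  simp only [coeff_hExtend, map_sub, Finset.sum_sub_distrib]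

theorem hExtend_C_C (c : ℕ → A →ₗ[k] A →ₗ[k] A) (a b : A) :
    hExtend c (PowerSeries.C a) (PowerSeries.C b) = PowerSeries.mk fun m => c m a b := by
  ext N
  rw [coeff_hExtend, PowerSeries.coeff_mk, Finset.sum_eq_single (N, 0)]
  · simp
  · rintro ⟨p, q⟩ h hne
    rw [Finset.HasAntidiagonal.mem_antidiagonal] at h
    refine Finset.sum_eq_zero ?_
    rintro ⟨a, b⟩ h'
    rw [Finset.HasAntidiagonal.mem_antidiagonal] at h'
    simp only [ne_eq, Prod.mk.injEq] at h h' hne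
    rcases Nat.eq_zero_or_pos a with rfl | ha
    · rw [PowerSeries.coeff_C, PowerSeries.coeff_C, if_neg (show b ≠ 0 by omega), map_zero]
    · rw [PowerSeries.coeff_C, if_neg ha.ne', map_zero, LinearMap.zero_apply]
  · intro h
    simp at h

/-- Two `h`-bilinear expressions agree if they agree on constants. -/
theorem powerSeries_biadditive_ext {Φ Ψ : PowerSeries A → PowerSeries A → PowerSeries A}
    (hΦ : ∀ f f' g, Φ (f + f') g = Φ f g + Φ f' g) (hΨ : ∀ f f' g, Ψ (f + f') g = Ψ f g + Ψ f' g)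
    (hΦ' : ∀ f g g', Φ f (g + g') = Φ f g + Φ f g') (hΨ' : ∀ f g g', Ψ f (g + g') = Ψ f g + Ψ f g')
    (hΦX : ∀ f g, Φ (PowerSeries.X * f) g = PowerSeries.X * Φ f g)
    (hΨX : ∀ f g, Ψ (PowerSeries.X * f) g = PowerSeries.X * Ψ f g)
    (hΦX' : ∀ f g, Φ f (PowerSeries.X * g) = PowerSeries.X * Φ f g)
    (hΨX' : ∀ f g, Ψ f (PowerSeries.X * g) = PowerSeries.X * Ψ f g)
    (hC : ∀ a b, Φ (PowerSeries.C a) (PowerSeries.C b) = Ψ (PowerSeries.C a) (PowerSeries.C b))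
    (f g : PowerSeries A) : Φ f g = Ψ f g :=
  powerSeries_addHom_ext (Φ := fun f => Φ f g) (Ψ := fun f => Ψ f g) (fun _ _ => hΦ _ _ _)
    (fun _ _ => hΨ _ _ _) (fun _ => hΦX _ _) (fun _ => hΨX _ _)
    (fun a => powerSeries_addHom_ext (Φ := Φ (PowerSeries.C a)) (Ψ := Ψ (PowerSeries.C a))
      (hΦ' _) (hΨ' _) (hΦX' _) (hΨX' _) (hC a) g) f

theorem X_mul_left_comm (f g : PowerSeries A) :
    PowerSeries.X * (f * g) = f * (PowerSeries.X * g) := by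
  rw [← mul_assoc, ← PowerSeries.commute_X f |>.eq, mul_assoc]

theorem map_algebraMap_C_mul (t : k) (f : PowerSeries A) :
    PowerSeries.map (algebraMap k A) (PowerSeries.C t) * f = t • f := by
  ext n
  rw [PowerSeries.map_C, PowerSeries.coeff_C_mul, PowerSeries.coeff_smul, Algebra.smul_def]

theorem hExtend_map_mul_left (c : ℕ → A →ₗ[k] A →ₗ[k] A) (p : PowerSeries k)
    (f g : PowerSeries A) : hExtend c (PowerSeries.map (algebraMap k A) p * f) g =
      PowerSeries.map (algebraMap k A) p * hExtend c f g := by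
  refine powerSeries_addHom_ext
    (Φ := fun p => hExtend c (PowerSeries.map (algebraMap k A) p * f) g)
    (Ψ := fun p => PowerSeries.map (algebraMap k A) p * hExtend c f g) ?_ ?_ ?_ ?_ ?_ p
  · intro p q
    rw [map_add, add_mul, hExtend_add_left]
  · intro p q
    rw [map_add, add_mul]
  · intro p
    rw [map_mul, PowerSeries.map_X, mul_assoc, hExtend_X_mul_left]
  · intro p
    rw [map_mul, PowerSeries.map_X, mul_assoc]
  · intro t
    rw [map_algebraMap_C_mul, map_algebraMap_C_mul, hExtend_smul_left]

theorem hExtend_map_mul_right (c : ℕ → A →ₗ[k] A →ₗ[k] A) (p : PowerSeries k)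
    (f g : PowerSeries A) : hExtend c f (PowerSeries.map (algebraMap k A) p * g) =
      PowerSeries.map (algebraMap k A) p * hExtend c f g := by
  refine powerSeries_addHom_ext
    (Φ := fun p => hExtend c f (PowerSeries.map (algebraMap k A) p * g))
    (Ψ := fun p => PowerSeries.map (algebraMap k A) p * hExtend c f g) ?_ ?_ ?_ ?_ ?_ p
  · intro p q
    rw [map_add, add_mul, hExtend_add_right]
  · intro p q
    rw [map_add, add_mul]
  · intro p
    rw [map_mul, PowerSeries.map_X, mul_assoc, hExtend_X_mul_right]
  · intro p
    rw [map_mul, PowerSeries.map_X, mul_assoc]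
  · intro t
    rw [map_algebraMap_C_mul, map_algebraMap_C_mul, hExtend_smul_right]

/-- The `h`-linear extension of a linear map. -/
noncomputable def hMap (D : A →ₗ[k] A) (f : PowerSeries A) : PowerSeries A :=
  PowerSeries.mk fun n => D (PowerSeries.coeff n f)

theorem coeff_hMap (D : A →ₗ[k] A) (f : PowerSeries A) (n : ℕ) :
    PowerSeries.coeff n (hMap D f) = D (PowerSeries.coeff n f) :=
  PowerSeries.coeff_mk ..

theorem hMap_add (D : A →ₗ[k] A) (f g : PowerSeries A) : hMap D (f + g) = hMap D f + hMap D g := by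
  ext n
  simp [coeff_hMap]

theorem hMap_X_mul (D : A →ₗ[k] A) (f : PowerSeries A) :
    hMap D (PowerSeries.X * f) = PowerSeries.X * hMap D f := by
  ext n
  cases n <;> simp [coeff_hMap, PowerSeries.coeff_succ_X_mul]

theorem hMap_C (D : A →ₗ[k] A) (a : A) : hMap D (PowerSeries.C a) = PowerSeries.C (D a) := by
  ext n
  rw [coeff_hMap, PowerSeries.coeff_C, PowerSeries.coeff_C]
  split_ifs <;> simp

theorem X_mul_cancel' {f g : PowerSeries A} (h : PowerSeries.X * f = PowerSeries.X * g) :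
    f = g := by
  ext n
  rw [← PowerSeries.coeff_succ_X_mul, h, PowerSeries.coeff_succ_X_mul]

end HExtend

namespace GradedForm

open GSym

variable {k : Type u} [Field k] {X : Type v} [AddCommGroup X] [Module k X]
variable {gr : ℤ → Submodule k X} {s : ℤ} (B : GradedForm gr s) (hgr : DirectSum.IsInternal gr)

/-! ### The star product on power series -/

/-- All the recursions for `star n` in one identity; the factor `X` counts the contraction. -/
theorem starH_gen_mul {i : ℤ} {x : X} (hx : x ∈ gr i) (F G : PowerSeries (GSym gr)) :
    hExtend (B.star hgr) (PowerSeries.C (gen gr x) * F) G = PowerSeries.C (gen gr x) * hExtend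
        (B.star hgr) F G +
      PowerSeries.X * hExtend (B.star hgr) (hMap (par hgr i).toLinearMap F)
        (hMap (B.contract hgr i ⟨x, hx⟩) G) := by
  refine powerSeries_biadditive_ext
    (Φ := fun F G => hExtend (B.star hgr) (PowerSeries.C (gen gr x) * F) G)
    (Ψ := fun F G => PowerSeries.C (gen gr x) * hExtend (B.star hgr) F G +
      PowerSeries.X * hExtend (B.star hgr) (hMap (par hgr i).toLinearMap F)
        (hMap (B.contract hgr i ⟨x, hx⟩) G)) ?_ ?_ ?_ ?_ ?_ ?_ ?_ ?_ ?_ F G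
  · intro F F' G
    simp only [mul_add, hExtend_add_left]
  · intro F F' G
    simp only [mul_add, hExtend_add_left, hMap_add]
    abel
  · intro F G G'
    simp only [hExtend_add_right]
  · intro F F' G
    simp only [mul_add, hExtend_add_right, hMap_add]
    abel
  · intro F G
    simp only [← X_mul_left_comm, hExtend_X_mul_left]
  · intro F G
    simp only [hExtend_X_mul_left, hMap_X_mul, mul_add]
    rw [X_mul_left_comm (PowerSeries.C (gen gr x))]
  · intro F G
    simp only [hExtend_X_mul_right]
  · intro F G
    simp only [hExtend_X_mul_right, hMap_X_mul, mul_add]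
    rw [X_mul_left_comm (PowerSeries.C (gen gr x))]
  · intro f g
    simp only [hMap_C, ← map_mul, hExtend_C_C]
    ext n
    cases n with
    | zero => simp [star_zero_gen_mul B hgr hx]
    | succ n => simp [star_succ_gen_mul B hgr n hx, PowerSeries.coeff_succ_X_mul]

theorem hMap_par_starH (j : ℤ) (F G : PowerSeries (GSym gr)) :
    hMap (par hgr j).toLinearMap (hExtend (B.star hgr) F G) =
      hExtend (B.star hgr) (hMap (par hgr j).toLinearMap F) (hMap (par hgr j).toLinearMap G) := by
  ext N
  simp [coeff_hMap, coeff_hExtend, par_star]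

theorem hMap_contract_starH {i : ℤ} (x : gr i) (F G : PowerSeries (GSym gr)) :
    hMap (B.contract hgr i x) (hExtend (B.star hgr) F G) =
      hExtend (B.star hgr) (hMap (B.contract hgr i x) F) G +
        hExtend (B.star hgr) (hMap (par hgr i).toLinearMap F) (hMap (B.contract hgr i x) G) := by
  ext N
  simp [coeff_hMap, coeff_hExtend, contract_star, Finset.sum_add_distrib]

theorem starH_algebraMap (c : k) (G : PowerSeries (GSym gr)) :
    hExtend (B.star hgr) (PowerSeries.C (algebraMap k _ c)) G = c • G := by
  refine powerSeries_addHom_ext (Φ := hExtend (B.star hgr) (PowerSeries.C (algebraMap k _ c)))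
    (Ψ := fun G => c • G) (hExtend_add_right _ _) (fun _ _ => smul_add _ _ _)
    (hExtend_X_mul_right _ _) (fun _ => (mul_smul_comm _ _ _).symm) ?_ G
  intro g
  rw [hExtend_C_C]
  ext n
  cases n with
  | zero => simp [star_zero_algebraMap]
  | succ n => simp [star_succ_algebraMap]

/-- Induction on `F`. For F = x f, both sides expand into three terms: `x` multiplies, contracts
into `G`, or contracts into `L`. On the right the last two come from the Leibniz rule for the
contraction of `G ⋆ L`. -/
theorem starH_assoc (F G L : PowerSeries (GSym gr)) :
    hExtend (B.star hgr) (hExtend (B.star hgr) F G) L = hExtend (B.star hgr) F (hExtend (B.star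
        hgr) G L) := by
  refine powerSeries_addHom_ext (Φ := fun F => hExtend (B.star hgr) (hExtend (B.star hgr) F G) L)
    (Ψ := fun F => hExtend (B.star hgr) F (hExtend (B.star hgr) G L)) ?_ ?_ ?_ ?_ ?_ F
  · intro F F'
    simp only [hExtend_add_left]
  · intro F F'
    simp only [hExtend_add_left]
  · intro F
    simp only [hExtend_X_mul_left]
  · intro F
    simp only [hExtend_X_mul_left]
  · intro f
    induction f using induction_par hgr generalizing G L with
    | algebraMap c => rw [starH_algebraMap, starH_algebraMap, hExtend_smul_left]
    | add f g hf hg => simp only [map_add, hExtend_add_left, hf, hg]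
    | gen_mul i x hx f hf =>
      have hf₀ := hf (0 + 0)
      rw [← par_par, par_self] at hf₀
      rw [map_mul, starH_gen_mul B hgr hx, hExtend_add_left, hExtend_X_mul_left,
        starH_gen_mul B hgr hx, starH_gen_mul B hgr hx, hf₀, hMap_par_starH, hMap_contract_starH,
        hExtend_add_right, hMap_C, AlgHom.toLinearMap_apply, hf, hf, mul_add]
      abel

/-! ### The bracket -/

/-- The brackets `[-,-]_{m+1}` on `S(X)`: the components of the commutator of the star product. -/
noncomputable def bracket (m : ℕ) : GSym gr →ₗ[k] GSym gr →ₗ[k] GSym gr :=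
  -- Using the opposite form makes the commutator bilinear on all of S(X), with no sign depending on
  -- the degrees of the arguments.
  B.star hgr (m + 1) - (B.op hgr).star hgr (m + 1)

theorem bracket_apply (m : ℕ) (f g : GSym gr) :
    B.bracket hgr m f g = B.star hgr (m + 1) f g - (B.op hgr).star hgr (m + 1) f g := rfl

theorem bracket_eq (m : ℕ) {i j : ℤ} {f g : GSym gr} (hf : f ∈ deg gr i) (hg : g ∈ deg gr j) :
    B.bracket hgr m f g = B.star hgr (m + 1) f g - koszulSign k i j • B.star hgr (m + 1) g f := by
  rw [bracket_apply, star_op B hgr _ hf hg]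

theorem bracket_antisymm (m : ℕ) {i j : ℤ} {f g : GSym gr} (hf : f ∈ deg gr i)
    (hg : g ∈ deg gr j) : B.bracket hgr m f g = -(koszulSign k i j • B.bracket hgr m g f) := by
  rw [bracket_eq B hgr m hf hg, bracket_eq B hgr m hg hf, smul_sub, smul_smul, koszulSign_comm j i,
    koszulSign_mul_self, one_smul, neg_sub]

theorem bracket_mem_deg (m : ℕ) {i j : ℤ} {f g : GSym gr} (hf : f ∈ deg gr i)
    (hg : g ∈ deg gr j) : B.bracket hgr m f g ∈ deg gr (i + j - (m + 1) * s) := by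
  have h1 := B.star_mem_deg hgr (m + 1) hf hg
  have h2 := (B.op hgr).star_mem_deg hgr (m + 1) hf hg
  push_cast at h1 h2
  exact Submodule.sub_mem _ h1 h2

/-- The constant terms cancel because `star 0` is the product for every form; the others are divided
by `h`, whence the index `m + 1`. -/
theorem X_mul_hExtend_bracket (F G : PowerSeries (GSym gr)) :
    PowerSeries.X * hExtend (B.bracket hgr) F G =
      hExtend (B.star hgr) F G - hExtend ((B.op hgr).star hgr) F G := by
  ext N
  cases N with
  | zero =>
    rw [PowerSeries.coeff_zero_X_mul, map_sub, coeff_hExtend, coeff_hExtend]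
    simp [star_zero]
  | succ N =>
    rw [PowerSeries.coeff_succ_X_mul, map_sub, coeff_succ_hExtend, coeff_succ_hExtend,
      add_sub_add_comm]
    simp only [star_zero, bracket_apply, coeff_hExtend, Finset.sum_sub_distrib, sub_self, zero_add]

/-- The degrees of the coefficients of a homogeneous series differ from its own degree by multiples
of the even number `s`, so one sign serves for all of them. -/
theorem starH_op {i j : ℤ} {F G : PowerSeries (GSym gr)} (hF : F ∈ homogSeries (deg gr) s s i)
    (hG : G ∈ homogSeries (deg gr) s s j) :
    hExtend ((B.op hgr).star hgr) F G = koszulSign k i j • hExtend (B.star hgr) G F := by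
  ext N
  simp only [PowerSeries.coeff_smul, coeff_hExtend, Finset.smul_sum]
  refine Finset.sum_congr rfl fun p _ => ?_
  rw [← Finset.Nat.sum_antidiagonal_swap]
  refine Finset.sum_congr rfl fun q _ => ?_
  have hev : ∀ (i : ℤ) (m : ℕ), Even (i + s - s * m - i) := fun i m => by
    have : i + s - s * m - i = s * (1 - m) := by ring
    rw [this]
    exact B.even.mul_right _
  rw [Prod.fst_swap, Prod.snd_swap, star_op B hgr _ (hF _) (hG _),
    koszulSign_congr_left (hev _ _), koszulSign_congr_right (hev _ _)]

theorem X_mul_hExtend_bracket_eq {i j : ℤ} {F G : PowerSeries (GSym gr)}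
    (hF : F ∈ homogSeries (deg gr) s s i) (hG : G ∈ homogSeries (deg gr) s s j) :
    PowerSeries.X * hExtend (B.bracket hgr) F G =
      hExtend (B.star hgr) F G - koszulSign k i j • hExtend (B.star hgr) G F := by
  rw [X_mul_hExtend_bracket, starH_op B hgr hF hG]

/-- `bracket m` lowers degrees by `(m + 1) * s`: the factor `h^m` accounts for `m * s` and the
desuspension for the remaining `s`. -/
theorem hExtend_bracket_mem {i j : ℤ} {F G : PowerSeries (GSym gr)}
    (hF : F ∈ homogSeries (deg gr) s s i) (hG : G ∈ homogSeries (deg gr) s s j) :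
    hExtend (B.bracket hgr) F G ∈ homogSeries (deg gr) s s (i + j) := by
  intro N
  rw [coeff_hExtend]
  refine Submodule.sum_mem _ fun p hp => Submodule.sum_mem _ fun q hq => ?_
  rw [Finset.HasAntidiagonal.mem_antidiagonal] at hp hq
  convert B.bracket_mem_deg hgr p.1 (hF q.1) (hG q.2) using 2
  rw [← hp, ← hq]
  push_cast
  ring

theorem koszulSign_eq_or (i j : ℤ) : koszulSign k i j = 1 ∨ koszulSign k i j = -1 :=
  mul_self_eq_one_iff.mp (koszulSign_mul_self i j)

/-- The commutator bracket of the star product is a Lie bracket. -/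
theorem isFormalLieBracket :
    IsFormalLieBracket (deg gr) s s (hExtend (B.bracket hgr)) where
  add_left := hExtend_add_left _
  add_right := hExtend_add_right _
  smul_left := hExtend_map_mul_left _
  smul_right := hExtend_map_mul_right _
  degree i j f g hf hg := B.hExtend_bracket_mem hgr hf hg
  antisymm i j f g hf hg := by
    rw [negOnePow_smul_eq (k := k)]
    apply X_mul_cancel'
    rw [mul_neg, mul_smul_comm, X_mul_hExtend_bracket_eq B hgr hf hg,
      X_mul_hExtend_bracket_eq B hgr hg hf, smul_sub, smul_smul, koszulSign_comm j i,
      koszulSign_mul_self, one_smul, neg_sub]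
  jacobi i j l a b c ha hb hc := by
    simp only [negOnePow_smul_eq (k := k)]
    -- With two factors `h` cleared, a nested bracket is a signed sum of four triple products, made
    -- right-nested by associativity.
    have key : ∀ {i j l : ℤ} {a b c : PowerSeries (GSym gr)},
        a ∈ homogSeries (deg gr) s s i → b ∈ homogSeries (deg gr) s s j →
        c ∈ homogSeries (deg gr) s s l →
        PowerSeries.X * (PowerSeries.X *
          hExtend (B.bracket hgr) a (hExtend (B.bracket hgr) b c)) =
        hExtend (B.star hgr) a (hExtend (B.star hgr) b c) - koszulSign k j l • hExtend (B.star hgr)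
            a (hExtend (B.star hgr) c b) -
        (koszulSign k i j * koszulSign k i l) • (hExtend (B.star hgr) b (hExtend (B.star hgr) c a) -
          koszulSign k j l • hExtend (B.star hgr) c (hExtend (B.star hgr) b a)) := by
      intro i j l a b c ha hb hc
      rw [X_mul_hExtend_bracket_eq B hgr ha (B.hExtend_bracket_mem hgr hb hc), mul_sub,
        mul_smul_comm, ← hExtend_X_mul_left _ (hExtend _ b c),
        ← hExtend_X_mul_right,
        X_mul_hExtend_bracket_eq B hgr hb hc, hExtend_sub_left, hExtend_sub_right,
        hExtend_smul_left, hExtend_smul_right, starH_assoc, starH_assoc, koszulSign_add_right]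
    apply X_mul_cancel'
    apply X_mul_cancel'
    simp only [mul_add, mul_smul_comm, key ha hb hc, key hb hc ha, key hc ha hb, mul_zero]
    -- Each of the six orderings of the triple product occurs twice; the cancellation is checked for
    -- all eight values of the three signs.
    rw [koszulSign_comm j i, koszulSign_comm l j, koszulSign_comm l i]
    rcases koszulSign_eq_or (k := k) i j with h1 | h1 <;>
    rcases koszulSign_eq_or (k := k) i l with h2 | h2 <;>
    rcases koszulSign_eq_or (k := k) j l with h3 | h3 <;>
    rw [h1, h2, h3] <;> module

end GradedForm

/-! ### Differential operators -/

section DiffOp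

variable {k : Type u} [Field k] {A : Type v} [Ring A] [Algebra k A] {𝒜 : ℤ → Submodule k A}

theorem isDiffOp_succ_iff {r : ℕ} {d : ℤ} {D : A →ₗ[k] A} :
    IsDiffOp 𝒜 (r + 1) d D ↔ (∀ (e : ℤ) (x : A), x ∈ 𝒜 e → D x ∈ 𝒜 (d + e)) ∧
      ∀ (e : ℤ) (a : A), a ∈ 𝒜 e →
        IsDiffOp 𝒜 r (d + e) (D ∘ₗ LinearMap.mulLeft k a -
          koszulSign k d e • (LinearMap.mulLeft k a ∘ₗ D)) := by
  simp only [IsDiffOp, negOnePow_smul_eq (k := k)]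

theorem IsGradedCommAlgebra.mul_comm_eq (h : IsGradedCommAlgebra 𝒜) {i j : ℤ} {a b : A}
    (ha : a ∈ 𝒜 i) (hb : b ∈ 𝒜 j) : a * b = koszulSign k i j • (b * a) := by
  rw [h.comm i j a b ha hb, negOnePow_smul_eq (k := k)]

theorem IsDiffOp.zero (r : ℕ) (d : ℤ) : IsDiffOp 𝒜 r d 0 := by
  induction r generalizing d with
  | zero => exact ⟨0, Submodule.zero_mem _, by ext; simp⟩
  | succ r ih =>
    rw [isDiffOp_succ_iff]
    refine ⟨fun e x _ => Submodule.zero_mem _, fun e a _ => ?_⟩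
    simpa using ih (d + e)

theorem IsDiffOp.add {r : ℕ} {d : ℤ} {D E : A →ₗ[k] A} (hD : IsDiffOp 𝒜 r d D)
    (hE : IsDiffOp 𝒜 r d E) : IsDiffOp 𝒜 r d (D + E) := by
  induction r generalizing d D E with
  | zero =>
    obtain ⟨a, ha, rfl⟩ := hD
    obtain ⟨b, hb, rfl⟩ := hE
    exact ⟨a + b, Submodule.add_mem _ ha hb, by ext; simp [add_mul]⟩
  | succ r ih =>
    rw [isDiffOp_succ_iff] at *
    refine ⟨fun e x hx => Submodule.add_mem _ (hD.1 e x hx) (hE.1 e x hx), fun e a ha => ?_⟩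
    convert ih (hD.2 e a ha) (hE.2 e a ha) using 1
    rw [LinearMap.add_comp, LinearMap.comp_add]
    module

theorem IsDiffOp.smul {r : ℕ} {d : ℤ} {D : A →ₗ[k] A} (hD : IsDiffOp 𝒜 r d D) (c : k) :
    IsDiffOp 𝒜 r d (c • D) := by
  induction r generalizing d D with
  | zero =>
    obtain ⟨a, ha, rfl⟩ := hD
    exact ⟨c • a, Submodule.smul_mem _ _ ha, by ext; simp⟩
  | succ r ih =>
    rw [isDiffOp_succ_iff] at *
    refine ⟨fun e x hx => Submodule.smul_mem _ _ (hD.1 e x hx), fun e a ha => ?_⟩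
    convert ih (hD.2 e a ha) using 1
    rw [LinearMap.smul_comp, LinearMap.comp_smul]
    module

theorem IsDiffOp.congr_degree {r : ℕ} {d d' : ℤ} {D : A →ₗ[k] A} (hD : IsDiffOp 𝒜 r d D)
    (h : d = d') : IsDiffOp 𝒜 r d' D := h ▸ hD

theorem IsDiffOp.map_mem (h𝒜 : IsGradedCommAlgebra 𝒜) {r : ℕ} {d : ℤ} {D : A →ₗ[k] A}
    (hD : IsDiffOp 𝒜 r d D) (e : ℤ) (x : A) (hx : x ∈ 𝒜 e) : D x ∈ 𝒜 (d + e) := by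
  cases r with
  | zero =>
    obtain ⟨a, ha, rfl⟩ := hD
    exact h𝒜.mul_mem _ _ _ _ ha hx
  | succ r => exact hD.1 e x hx

/-- Graded commutativity enters at order 0: commutators of left multiplications vanish. -/
theorem IsDiffOp.succ (h𝒜 : IsGradedCommAlgebra 𝒜) {r : ℕ} {d : ℤ} {D : A →ₗ[k] A}
    (hD : IsDiffOp 𝒜 r d D) : IsDiffOp 𝒜 (r + 1) d D := by
  induction r generalizing d D with
  | zero =>
    rw [isDiffOp_succ_iff]
    refine ⟨hD.map_mem h𝒜, fun e a ha => ?_⟩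
    obtain ⟨b, hb, rfl⟩ := hD
    convert IsDiffOp.zero 0 (d + e) using 1
    ext x
    simp only [LinearMap.sub_apply, LinearMap.comp_apply, LinearMap.mulLeft_apply,
      LinearMap.smul_apply, LinearMap.zero_apply]
    rw [← mul_assoc, h𝒜.mul_comm_eq hb ha, smul_mul_assoc, mul_assoc, sub_self]
  | succ r ih =>
    have hD' := isDiffOp_succ_iff.mp hD
    exact isDiffOp_succ_iff.mpr ⟨hD'.1, fun e a ha => ih (hD'.2 e a ha)⟩

theorem IsDiffOp.mulLeft_comp (h𝒜 : IsGradedCommAlgebra 𝒜) {r : ℕ} {d i : ℤ} {D : A →ₗ[k] A}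
    (hD : IsDiffOp 𝒜 r d D) {b : A} (hb : b ∈ 𝒜 i) :
    IsDiffOp 𝒜 r (i + d) (LinearMap.mulLeft k b ∘ₗ D) := by
  induction r generalizing d D with
  | zero =>
    obtain ⟨a, ha, rfl⟩ := hD
    exact ⟨b * a, h𝒜.mul_mem _ _ _ _ hb ha, by ext; simp⟩
  | succ r ih =>
    have hD' := isDiffOp_succ_iff.mp hD
    refine isDiffOp_succ_iff.mpr ⟨fun e x hx => ?_, fun e a ha => ?_⟩
    · rw [add_assoc]
      exact h𝒜.mul_mem _ _ _ _ hb (hD'.1 e x hx)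
    · rw [add_assoc]
      convert ih (hD'.2 e a ha) using 1
      ext x
      simp only [LinearMap.sub_apply, LinearMap.comp_apply, LinearMap.mulLeft_apply,
        LinearMap.smul_apply, mul_sub, mul_smul_comm]
      rw [← mul_assoc a, h𝒜.mul_comm_eq ha hb, smul_mul_assoc, smul_smul, koszulSign_add_left,
        koszulSign_comm e i, mul_right_comm, koszulSign_mul_self, one_mul, mul_assoc]

/-- D L_b = [D, L_b] ± L_b D, a term of lower order plus one of the same order. -/
theorem IsDiffOp.comp_mulLeft (h𝒜 : IsGradedCommAlgebra 𝒜) {r : ℕ} {d i : ℤ} {D : A →ₗ[k] A}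
    (hD : IsDiffOp 𝒜 r d D) {b : A} (hb : b ∈ 𝒜 i) :
    IsDiffOp 𝒜 r (d + i) (D ∘ₗ LinearMap.mulLeft k b) := by
  cases r with
  | zero =>
    obtain ⟨a, ha, rfl⟩ := hD
    exact ⟨a * b, h𝒜.mul_mem _ _ _ _ ha hb, by ext; simp⟩
  | succ r =>
    have h1 := ((isDiffOp_succ_iff.mp hD).2 i b hb).succ h𝒜
    have h2 := ((hD.mulLeft_comp h𝒜 hb).smul (koszulSign k d i)).congr_degree (add_comm i d)
    convert h1.add h2 using 1
    rw [sub_add_cancel]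

/-- The composition of a differential operator with a derivation. -/
theorem IsDiffOp.comp_derivation (h𝒜 : IsGradedCommAlgebra 𝒜) {r : ℕ} {d i : ℤ}
    {D δ : A →ₗ[k] A} (hD : IsDiffOp 𝒜 r d D) (hδ : ∀ e, ∀ x ∈ 𝒜 e, δ x ∈ 𝒜 (i + e))
    (hδ' : ∀ e, ∀ a ∈ 𝒜 e, ∀ x, δ (a * x) = δ a * x + koszulSign k i e • (a * δ x)) :
    IsDiffOp 𝒜 (r + 1) (d + i) (D ∘ₗ δ) := by
  -- The Leibniz rule gives [D δ, L_a] = D L_{δ a} ± [D, L_a] δ. The first term has order `r`; the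
  -- second is covered by the induction hypothesis, and vanishes when `D` is a left multiplication.
  have main : ∀ (e : ℤ) (a : A), a ∈ 𝒜 e →
      (D ∘ₗ δ) ∘ₗ LinearMap.mulLeft k a -
        koszulSign k (d + i) e • (LinearMap.mulLeft k a ∘ₗ (D ∘ₗ δ)) =
      D ∘ₗ LinearMap.mulLeft k (δ a) + koszulSign k i e • ((D ∘ₗ LinearMap.mulLeft k a -
        koszulSign k d e • (LinearMap.mulLeft k a ∘ₗ D)) ∘ₗ δ) := by
    intro e a ha
    ext x
    simp only [LinearMap.sub_apply, LinearMap.add_apply, LinearMap.comp_apply,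
      LinearMap.mulLeft_apply, LinearMap.smul_apply, hδ' e a ha, map_add, map_smul,
      koszulSign_add_left]
    module
  induction r generalizing d D with
  | zero =>
    refine isDiffOp_succ_iff.mpr ⟨fun e x hx => ?_, fun e a ha => ?_⟩
    · rw [add_assoc]
      exact hD.map_mem h𝒜 _ _ (hδ e x hx)
    · rw [main e a ha]
      have h1 : D ∘ₗ LinearMap.mulLeft k a - koszulSign k d e • (LinearMap.mulLeft k a ∘ₗ D) = 0 :=
          by
        obtain ⟨b, hb, rfl⟩ := hD
        ext x
        simp only [LinearMap.sub_apply, LinearMap.comp_apply, LinearMap.mulLeft_apply,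
          LinearMap.smul_apply, LinearMap.zero_apply]
        rw [← mul_assoc, h𝒜.mul_comm_eq hb ha, smul_mul_assoc, mul_assoc, sub_self]
      rw [h1, LinearMap.zero_comp, smul_zero, add_zero]
      exact (hD.comp_mulLeft h𝒜 (hδ e a ha)).congr_degree (by ring)
  | succ r ih =>
    refine isDiffOp_succ_iff.mpr ⟨fun e x hx => ?_, fun e a ha => ?_⟩
    · rw [add_assoc]
      exact hD.map_mem h𝒜 _ _ (hδ e x hx)
    · rw [main e a ha]
      refine IsDiffOp.add ((hD.comp_mulLeft h𝒜 (hδ e a ha)).congr_degree (by ring))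
        (IsDiffOp.smul ?_ _)
      refine (ih ((isDiffOp_succ_iff.mp hD).2 e a ha) ?_).congr_degree (by ring)
      intro e' a' ha'
      ext x
      simp only [LinearMap.sub_apply, LinearMap.add_apply, LinearMap.comp_apply,
        LinearMap.mulLeft_apply, LinearMap.smul_apply, hδ' e' a' ha', map_add, map_smul,
        koszulSign_add_left]
      module

end DiffOp

/-! ### Orders of the star products and brackets as differential operators -/

namespace GradedForm

open GSym

variable {k : Type u} [Field k] {X : Type v} [AddCommGroup X] [Module k X]
variable {gr : ℤ → Submodule k X} (B : GradedForm gr 0) (hgr : DirectSum.IsInternal gr)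

/-- In the recursion, multiplying by a generator keeps the order, while a contraction raises it by
one together with `n`. The form has degree 0, so the degree of the operator is that of `b`. -/
theorem isDiffOp_star (n : ℕ) {j : ℤ} {b : GSym gr} (hb : b ∈ deg gr j) :
    IsDiffOp (deg gr) n j (B.star hgr n b) := by
  have h𝒜 := isGradedCommAlgebra hgr
  refine deg_induction (P := fun j b => ∀ n, IsDiffOp (deg gr) n j (B.star hgr n b))
    ?_ ?_ ?_ ?_ ?_ hb n
  · intro d n
    rw [map_zero]
    exact IsDiffOp.zero _ _
  · intro d f g hf hg n
    rw [map_add]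
    exact (hf n).add (hg n)
  · intro d c f hf n
    rw [map_smul]
    exact (hf n).smul c
  · rintro (_ | n)
    · exact ⟨1, one_mem_deg, by ext; simp [star_zero]⟩
    · convert IsDiffOp.zero (𝒜 := deg gr) (n + 1) 0 using 1
      ext g
      exact star_succ_one B hgr n g
  · intro i d x hx f hfd hf n
    cases n with
    | zero =>
      convert (hf 0).mulLeft_comp h𝒜 (gen_mem_deg hx) using 1
      ext g
      exact star_zero_gen_mul B hgr hx f g
    | succ n =>
      have h1 := (hf (n + 1)).mulLeft_comp h𝒜 (gen_mem_deg hx)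
      have h2 := (hf n).comp_derivation h𝒜 (i := i) (δ := B.contract hgr i ⟨x, hx⟩)
        (fun e g hg => by simpa using B.contract_mem_deg hgr ⟨x, hx⟩ hg)
        (fun e a ha g => by
          rw [contract_mul, par_apply hgr i ha, smul_mul_assoc])
      convert h1.add ((h2.smul (koszulSign k i d)).congr_degree (add_comm d i)) using 1
      ext g
      rw [star_succ_gen_mul B hgr n hx, par_apply hgr i hfd, map_smul]
      rfl

/-- Antisymmetry reduces the first variable to the second: (-1)^{|x||b|} [x, b] = -[b, x]. -/
theorem isBiDiffOp_bracket (m : ℕ) : IsBiDiffOp (deg gr) (m + 1) (B.bracket hgr m) := by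
  intro j b hb
  have h : IsDiffOp (deg gr) (m + 1) j (B.bracket hgr m b) := by
    convert (B.isDiffOp_star hgr (m + 1) hb).add
      (((B.op hgr).isDiffOp_star hgr (m + 1) hb).smul (-1)) using 1
    ext g
    simp [bracket_apply, sub_eq_add_neg]
  refine ⟨h, (-1 : k) • B.bracket hgr m b, fun i x hx => ?_, h.smul (-1)⟩
  rw [negOnePow_smul_eq (k := k), bracket_antisymm B hgr m hx hb, smul_neg, smul_smul,
    koszulSign_mul_self, LinearMap.smul_apply, one_smul, neg_one_smul]

theorem isFormalOperatorLieAlgebra :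
    IsFormalOperatorLieAlgebra (deg gr) (hExtend (B.bracket hgr)) where
  algebra := isGradedCommAlgebra hgr
  lie := B.isFormalLieBracket hgr
  decomposition := ⟨B.bracket hgr, hExtend_C_C _, B.isBiDiffOp_bracket hgr⟩

end GradedForm

/-! ### Shuffles -/

section Perm

/-- The permutation `π` of `Fin (m + 1)` with `π i₀ = 0` that induces `σ` between the complements
of `i₀` and `0`. -/
def insertZero {m : ℕ} (i₀ : Fin (m + 1)) (σ : Equiv.Perm (Fin m)) : Equiv.Perm (Fin (m + 1)) :=
  (finSuccEquiv' i₀).trans ((Equiv.optionCongr σ).trans (finSuccEquiv' 0).symm)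

@[simp]
theorem insertZero_self {m : ℕ} (i₀ : Fin (m + 1)) (σ : Equiv.Perm (Fin m)) :
    insertZero i₀ σ i₀ = 0 := by
  simp [insertZero]

@[simp]
theorem insertZero_succAbove {m : ℕ} (i₀ : Fin (m + 1)) (σ : Equiv.Perm (Fin m)) (j : Fin m) :
    insertZero i₀ σ (i₀.succAbove j) = (σ j).succ := by
  simp [insertZero]

theorem insertZero_mk_of_lt {m : ℕ} (i₀ : Fin (m + 1)) (σ : Equiv.Perm (Fin m)) {j : ℕ}
    (hj : j < m) (h : j < i₀) : insertZero i₀ σ ⟨j, by omega⟩ = (σ ⟨j, hj⟩).succ := by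
  rw [← insertZero_succAbove i₀ σ ⟨j, hj⟩, Fin.succAbove_of_castSucc_lt _ _ (by simpa [Fin.lt_def])]
  rfl

theorem insertZero_mk_of_ge {m : ℕ} (i₀ : Fin (m + 1)) (σ : Equiv.Perm (Fin m)) {j : ℕ}
    (hj : j < m) (h : i₀ ≤ j) : insertZero i₀ σ ⟨j + 1, by omega⟩ = (σ ⟨j, hj⟩).succ := by
  rw [← insertZero_succAbove i₀ σ ⟨j, hj⟩,
    Fin.succAbove_of_le_castSucc _ _ (by simpa [Fin.le_def])]
  rfl

theorem insertZero_injective {m : ℕ} :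
    Function.Injective fun p : Fin (m + 1) × Equiv.Perm (Fin m) => insertZero p.1 p.2 := by
  rintro ⟨i, σ⟩ ⟨j, τ⟩ h
  dsimp only at h
  have hij : i = j := by
    apply (insertZero i σ).injective
    rw [insertZero_self, h, insertZero_self]
  subst hij
  refine Prod.ext rfl (Equiv.ext fun l => ?_)
  have := congrArg (fun π : Equiv.Perm (Fin (m + 1)) => π (i.succAbove l)) h
  simpa using this

theorem insertZero_bijective {m : ℕ} :
    Function.Bijective fun p : Fin (m + 1) × Equiv.Perm (Fin m) => insertZero p.1 p.2 := by
  rw [Fintype.bijective_iff_injective_and_card]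
  refine ⟨insertZero_injective, ?_⟩
  rw [Fintype.card_prod, Fintype.card_perm, Fintype.card_perm, Fintype.card_fin, Fintype.card_fin,
    Nat.factorial_succ]

/-- Sorts permutations by the place that receives the first letter; the shuffle recursion and the
expansion of pairings both start here. -/
theorem sum_perm_succ {m : ℕ} {M : Type*} [AddCommMonoid M] (G : Equiv.Perm (Fin (m + 1)) → M) :
    ∑ π, G π = ∑ i, ∑ σ, G (insertZero i σ) := by
  rw [← Fintype.sum_prod_type']
  exact (Function.Bijective.sum_comp insertZero_bijective G).symm

/-- The permutations of `Fin m` which are increasing on the first `p` places and on the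
remaining ones. -/
def IsShuffle (p : ℕ) {m : ℕ} (σ : Equiv.Perm (Fin m)) : Prop :=
  ∀ i j : Fin m, i < j → ((j : ℕ) < p ∨ p ≤ (i : ℕ)) → σ i < σ j

open Classical in
/-- The finset of permutations that satisfy `IsShuffle p`. -/
noncomputable def shuffleSet (p m : ℕ) : Finset (Equiv.Perm (Fin m)) := {σ | IsShuffle p σ}

theorem mem_shuffleSet {p m : ℕ} {σ : Equiv.Perm (Fin m)} :
    σ ∈ shuffleSet p m ↔ IsShuffle p σ := by
  simp [shuffleSet]

/-- `IsShuffle` does not write the length as a sum, which keeps inductions on the length free of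
casts. -/
theorem shuffles_eq (p q : ℕ) : shuffles p q = shuffleSet p (p + q) := by
  ext σ
  rw [mem_shuffleSet, shuffles, Finset.mem_filter]
  constructor
  · rintro ⟨-, h1, h2⟩ i j hij (h | h)
    · exact h1 (a := ⟨i, by omega⟩) (b := ⟨j, h⟩) hij
    · have := h2 (a := ⟨i - p, by omega⟩) (b := ⟨j - p, by omega⟩)
        (by simp only [Fin.lt_def] at hij ⊢; omega)
      dsimp only at this
      rwa [show Fin.natAdd p (⟨i - p, by omega⟩ : Fin q) = i from Fin.ext (by simp; omega),
        show Fin.natAdd p (⟨j - p, by omega⟩ : Fin q) = j from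
          Fin.ext (by rw [Fin.lt_def] at hij; simp; omega)] at this
  · intro h
    refine ⟨Finset.mem_univ _, fun i j hij => ?_, fun i j hij => ?_⟩
    · exact h _ _ (Fin.lt_def.mpr hij) (Or.inl j.2)
    · exact h _ _ (Fin.lt_def.mpr (Nat.add_lt_add_left hij p)) (Or.inr (Nat.le_add_right p i))

theorem isShuffle_insertZero_zero {p m : ℕ} {σ : Equiv.Perm (Fin m)} :
    IsShuffle (p + 1) (insertZero 0 σ) ↔ IsShuffle p σ := by
  constructor
  · intro h i j hij hp
    have := h i.succ j.succ (by simpa using hij) (by simpa using hp)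
    rw [← Fin.zero_succAbove, ← Fin.zero_succAbove, insertZero_succAbove, insertZero_succAbove,
      Fin.succ_lt_succ_iff] at this
    exact this
  · intro h i j hij hp
    induction j using Fin.cases with
    | zero => simp at hij
    | succ j =>
      rw [← Fin.zero_succAbove, insertZero_succAbove]
      induction i using Fin.cases with
      | zero => rw [insertZero_self]; exact Fin.succ_pos _
      | succ i =>
        rw [← Fin.zero_succAbove, insertZero_succAbove, Fin.succ_lt_succ_iff]
        exact h i j (by simpa using hij) (by simpa using hp)

theorem isShuffle_insertZero_mid {p m : ℕ} (hp : p ≤ m) {σ : Equiv.Perm (Fin m)} :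
    IsShuffle p (insertZero ⟨p, by omega⟩ σ) ↔ IsShuffle p σ := by
  have hsA : ∀ i : Fin m, (((⟨p, by omega⟩ : Fin (m + 1)).succAbove i : Fin (m + 1)) : ℕ) =
      if (i : ℕ) < p then (i : ℕ) else i + 1 := by
    intro i
    rw [Fin.succAbove]
    simp only [Fin.lt_def, Fin.val_castSucc]
    split_ifs <;> rfl
  have hp' : p < m + 1 := by omega
  constructor
  · intro h i j hij hc
    have := h _ _ ((Fin.succAbove_lt_succAbove_iff (p := ⟨p, by omega⟩)).mpr hij) (by
      rw [hsA, hsA]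
      rw [Fin.lt_def] at hij
      split_ifs <;> omega)
    rwa [insertZero_succAbove, insertZero_succAbove, Fin.succ_lt_succ_iff] at this
  · intro h i j hij hc
    obtain rfl | ⟨j, rfl⟩ := Fin.eq_self_or_eq_succAbove ⟨p, hp'⟩ j
    · rw [Fin.lt_def] at hij
      simp only at hij hc
      omega
    · rw [insertZero_succAbove]
      obtain rfl | ⟨i, rfl⟩ := Fin.eq_self_or_eq_succAbove ⟨p, hp'⟩ i
      · rw [insertZero_self]
        exact Fin.succ_pos _
      · rw [insertZero_succAbove, Fin.succ_lt_succ_iff]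
        rw [Fin.succAbove_lt_succAbove_iff] at hij
        refine h i j hij ?_
        rw [hsA, hsA] at hc
        rw [Fin.lt_def] at hij
        split_ifs at hc <;> omega

/-- The value 0 must open its block, since a predecessor in the block would have a smaller value. -/
theorem eq_of_isShuffle_insertZero {p m : ℕ} {i₀ : Fin (m + 1)} {σ : Equiv.Perm (Fin m)}
    (h : IsShuffle p (insertZero i₀ σ)) : (i₀ : ℕ) = 0 ∨ (i₀ : ℕ) = p := by
  by_contra! hne
  have := h ⟨i₀ - 1, by omega⟩ i₀ (by rw [Fin.lt_def]; simp only; omega) (by simp only; omega)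
  rw [insertZero_self] at this
  exact absurd this (Fin.not_lt_zero _)

variable {M : Type*} [AddCommMonoid M]

theorem sum_shuffleSet_eq_sum_ite (p m : ℕ) (G : Equiv.Perm (Fin m) → M) [DecidablePred fun σ :
    Equiv.Perm (Fin m) => IsShuffle p σ] :
    ∑ σ ∈ shuffleSet p m, G σ = ∑ σ, if IsShuffle p σ then G σ else 0 := by
  rw [← Finset.sum_filter]
  congr 1
  ext σ
  simp [mem_shuffleSet]

theorem sum_shuffleSet_zero_succ (m : ℕ) (G : Equiv.Perm (Fin (m + 1)) → M) :
    ∑ π ∈ shuffleSet 0 (m + 1), G π = ∑ σ ∈ shuffleSet 0 m, G (insertZero 0 σ) := by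
  classical
  rw [sum_shuffleSet_eq_sum_ite, sum_perm_succ, sum_shuffleSet_eq_sum_ite,
    Finset.sum_eq_single 0 _ (by simp)]
  · exact Finset.sum_congr rfl fun σ _ => by
      simp only [← isShuffle_insertZero_mid (Nat.zero_le m) (σ := σ)]; rfl
  · intro i _ hi
    refine Finset.sum_eq_zero fun σ _ => if_neg fun h => ?_
    have := eq_of_isShuffle_insertZero h
    exact hi (Fin.ext (by simpa using this))

theorem sum_shuffleSet_self_succ (m : ℕ) (G : Equiv.Perm (Fin (m + 1)) → M) :
    ∑ π ∈ shuffleSet (m + 1) (m + 1), G π = ∑ σ ∈ shuffleSet m m, G (insertZero 0 σ) := by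
  classical
  rw [sum_shuffleSet_eq_sum_ite, sum_perm_succ, sum_shuffleSet_eq_sum_ite,
    Finset.sum_eq_single 0 _ (by simp)]
  · simp only [isShuffle_insertZero_zero]
  · intro i _ hi
    refine Finset.sum_eq_zero fun σ _ => if_neg fun h => ?_
    have := eq_of_isShuffle_insertZero h
    exact hi (Fin.ext (by have := i.2; simp only [Fin.val_zero]; omega))

/-- Shuffles are split by the block that the first letter enters. Here both blocks are nonempty; the
two preceding lemmas are the boundary cases. -/
theorem sum_shuffleSet_succ {p m : ℕ} (hp : p + 1 ≤ m) (G : Equiv.Perm (Fin (m + 1)) → M) :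
    ∑ π ∈ shuffleSet (p + 1) (m + 1), G π = ∑ σ ∈ shuffleSet p m, G (insertZero 0 σ) +
      ∑ σ ∈ shuffleSet (p + 1) m, G (insertZero ⟨p + 1, by omega⟩ σ) := by
  classical
  rw [sum_shuffleSet_eq_sum_ite, sum_perm_succ, sum_shuffleSet_eq_sum_ite,
    sum_shuffleSet_eq_sum_ite, Fintype.sum_eq_add 0 ⟨p + 1, by omega⟩ (by simp [Fin.ext_iff])]
  · simp only [isShuffle_insertZero_zero, isShuffle_insertZero_mid hp]
  · rintro i ⟨hi, hi'⟩
    refine Finset.sum_eq_zero fun σ _ => if_neg fun h => ?_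
    obtain h | h := eq_of_isShuffle_insertZero h
    · exact hi (Fin.ext (by simpa using h))
    · exact hi' (Fin.ext (by simpa using h))

/-- The inclusion of the first `a` of `m = a + b` places. -/
def blockL {a b m : ℕ} (h : a + b = m) (i : Fin a) : Fin m := ⟨i, by omega⟩

/-- The inclusion of the last `b` of `m = a + b` places. -/
def blockR {a b m : ℕ} (h : a + b = m) (i : Fin b) : Fin m := ⟨a + i, by omega⟩

theorem sum_blocks {a b m : ℕ} (h : a + b = m) (f : Fin m → M) :
    ∑ i, f i = ∑ i, f (blockL h i) + ∑ i, f (blockR h i) := by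
  subst h
  exact Fin.sum_univ_add f

variable {α : Type*}

theorem insertZero_zero_blockL {a b m : ℕ} (h : a + 1 + b = m + 1) (h' : a + b = m)
    (x : Fin (m + 1) → α) (σ : Equiv.Perm (Fin m)) :
    (fun i => x (insertZero 0 σ (blockL h i))) =
      Fin.cons (x 0) fun i => x (σ (blockL h' i)).succ := by
  funext i
  induction i using Fin.cases with
  | zero => exact congrArg x (insertZero_self 0 σ)
  | succ i => exact congrArg x (insertZero_mk_of_ge 0 σ (j := i) (by omega) (by simp))

theorem insertZero_zero_blockR {a b m : ℕ} (h : a + 1 + b = m + 1) (h' : a + b = m)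
    (x : Fin (m + 1) → α) (σ : Equiv.Perm (Fin m)) :
    (fun i => x (insertZero 0 σ (blockR h i))) = fun i => x (σ (blockR h' i)).succ := by
  funext i
  have h1 : blockR h i = ⟨a + i + 1, by omega⟩ := Fin.ext (by simp only [blockR]; omega)
  rw [h1, insertZero_mk_of_ge 0 σ (by omega) (by simp)]
  rfl

theorem insertZero_mid_blockL {a b m : ℕ} (h : a + (b + 1) = m + 1) (h' : a + b = m)
    (x : Fin (m + 1) → α) (σ : Equiv.Perm (Fin m)) :
    (fun i => x (insertZero ⟨a, by omega⟩ σ (blockL h i))) = fun i => x (σ (blockL h' i)).succ := by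
  funext i
  exact congrArg x (insertZero_mk_of_lt ⟨a, by omega⟩ σ (j := i) (by omega) (by simp))

theorem insertZero_mid_blockR {a b m : ℕ} (h : a + (b + 1) = m + 1) (h' : a + b = m)
    (x : Fin (m + 1) → α) (σ : Equiv.Perm (Fin m)) :
    (fun i => x (insertZero ⟨a, by omega⟩ σ (blockR h i))) =
      Fin.cons (x 0) fun i => x (σ (blockR h' i)).succ := by
  funext i
  induction i using Fin.cases with
  | zero => exact congrArg x (insertZero_self ⟨a, by omega⟩ σ)
  | succ i =>
    exact congrArg x (insertZero_mk_of_ge ⟨a, by omega⟩ σ (j := a + i) (by omega) (by simp))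

end Perm

/-! ### Koszul signs in the ground field -/

section Koszul

variable {k : Type u} [Field k]

theorem koszulSign_sum_right {ι : Type*} (t : Finset ι) (d : ℤ) (f : ι → ℤ) :
    koszulSign k d (∑ i ∈ t, f i) = ∏ i ∈ t, koszulSign k d (f i) := by
  classical
  induction t using Finset.induction_on with
  | empty => simp
  | insert i t hi ih => rw [Finset.sum_insert hi, Finset.prod_insert hi, koszulSign_add_right, ih]

variable (k) in
/-- The Koszul sign of a permutation, as an element of the ground field. -/
def koszulPerm {n : ℕ} (e : Fin n → ℤ) (σ : Equiv.Perm (Fin n)) : k :=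
  ∏ p : Fin n × Fin n,
    if p.1 < p.2 ∧ σ p.2 < σ p.1 then koszulSign k (e (σ p.1)) (e (σ p.2)) else 1

theorem koszulPerm_eq {n : ℕ} (e : Fin n → ℤ) (σ : Equiv.Perm (Fin n)) :
    (((koszul e σ : ℤˣ) : ℤ) : k) = koszulPerm k e σ := by
  rw [koszul, koszulPerm, Units.coe_prod, Int.cast_prod]
  refine Finset.prod_congr rfl fun p _ => ?_
  split_ifs
  · rfl
  · simp

variable (k) in
/-- The sign that moves the symbols of degrees `e i` past those of degrees `c j`, `i < j`. -/
def zipSign {n : ℕ} (e c : Fin n → ℤ) : k :=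
  ∏ p : Fin n × Fin n, if p.1 < p.2 then koszulSign k (e p.1) (c p.2) else 1

theorem prod_prod_succAbove {n : ℕ} (i₀ : Fin (n + 1)) (f : Fin (n + 1) × Fin (n + 1) → k) :
    ∏ p, f p = f (i₀, i₀) * (∏ j, f (i₀, i₀.succAbove j)) * (∏ j, f (i₀.succAbove j, i₀)) *
      ∏ p : Fin n × Fin n, f (i₀.succAbove p.1, i₀.succAbove p.2) := by
  rw [Fintype.prod_prod_type, Fin.prod_univ_succAbove _ i₀, Fin.prod_univ_succAbove _ i₀,
    Fintype.prod_prod_type, mul_assoc _ (∏ j, f (i₀.succAbove j, i₀)), ← Finset.prod_mul_distrib]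
  congr 1
  exact Finset.prod_congr rfl fun j _ => Fin.prod_univ_succAbove _ i₀

/-- The first letter forms inversions exactly with the letters placed before `i₀`. -/
theorem koszulPerm_insertZero {m : ℕ} (e : Fin (m + 1) → ℤ) (i₀ : Fin (m + 1))
    (σ : Equiv.Perm (Fin m)) : koszulPerm k e (insertZero i₀ σ) =
      koszulSign k (e 0) (∑ j, if i₀.succAbove j < i₀ then e (σ j).succ else 0) *
        koszulPerm k (fun i => e i.succ) σ := by
  rw [koszulPerm, prod_prod_succAbove i₀, koszulPerm, koszulSign_sum_right]
  congr 1
  · simp only [insertZero_self, insertZero_succAbove, lt_irrefl, if_false, one_mul,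
      Fin.not_lt_zero, and_false, Finset.prod_const_one, Fin.succ_pos, and_true]
    refine Finset.prod_congr rfl fun j _ => ?_
    split_ifs
    · exact koszulSign_comm _ _
    · simp
  · simp only [insertZero_succAbove, Fin.succAbove_lt_succAbove_iff, Fin.succ_lt_succ_iff]

theorem zipSign_insertZero {m : ℕ} (e c : Fin (m + 1) → ℤ) (i₀ : Fin (m + 1))
    (σ : Equiv.Perm (Fin m)) : zipSign k (fun i => e (insertZero i₀ σ i)) c =
      koszulSign k (e 0) (∑ j, if i₀ < i₀.succAbove j then c (i₀.succAbove j) else 0) *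
      koszulSign k (c i₀) (∑ j, if i₀.succAbove j < i₀ then e (σ j).succ else 0) *
        zipSign k (fun i => e (σ i).succ) (fun i => c (i₀.succAbove i)) := by
  rw [zipSign, prod_prod_succAbove i₀, zipSign, koszulSign_sum_right, koszulSign_sum_right]
  simp only [insertZero_self, insertZero_succAbove, lt_irrefl, if_false, one_mul,
      Fin.succAbove_lt_succAbove_iff]
  congr 2
  · refine Finset.prod_congr rfl fun j _ => ?_
    split_ifs <;> simp
  · refine Finset.prod_congr rfl fun j _ => ?_
    split_ifs
    · exact koszulSign_comm _ _
    · simp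

theorem koszulPerm_insertZero_zero {m : ℕ} (e : Fin (m + 1) → ℤ) (σ : Equiv.Perm (Fin m)) :
    koszulPerm k e (insertZero 0 σ) = koszulPerm k (fun i => e i.succ) σ := by
  rw [koszulPerm_insertZero]
  simp

theorem koszulPerm_insertZero_mid {a b m : ℕ} (h : a + b = m) (e : Fin (m + 1) → ℤ)
    (σ : Equiv.Perm (Fin m)) : koszulPerm k e (insertZero ⟨a, by omega⟩ σ) =
      koszulSign k (e 0) (∑ i, e (σ (blockL h i)).succ) * koszulPerm k (fun i => e i.succ) σ := by
  rw [koszulPerm_insertZero, sum_blocks h]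
  congr 2
  have h1 : ∀ i, (⟨a, by omega⟩ : Fin (m + 1)).succAbove (blockL h i) < ⟨a, by omega⟩ := by
    intro i
    rw [Fin.succAbove_of_castSucc_lt]
    · simp [Fin.lt_def, blockL]
    · simp [Fin.lt_def, blockL]
  have h2 : ∀ i, ¬ (⟨a, by omega⟩ : Fin (m + 1)).succAbove (blockR h i) < ⟨a, by omega⟩ := by
    intro i
    rw [Fin.succAbove_of_le_castSucc]
    · simp [Fin.lt_def, blockR]; omega
    · simp [Fin.le_def, blockR]
  simp [h1, h2]

end Koszul

namespace GradedForm

open GSym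

variable {k : Type u} [Field k] {X : Type v} [AddCommGroup X] [Module k X]
variable {gr : ℤ → Submodule k X} {s : ℤ} (B : GradedForm gr s) (hgr : DirectSum.IsInternal gr)

/-! ### Iterated contractions -/

/-- The contraction with an arbitrary element of `X`. -/
noncomputable def contractX : X →ₗ[k] Module.End k (GSym gr) := gradedLift hgr (B.contract hgr)

theorem contractX_apply {i : ℤ} {x : X} (hx : x ∈ gr i) :
    B.contractX hgr x = B.contract hgr i ⟨x, hx⟩ := gradedLift_apply hgr _ hx

/-- The composition `∂_{z 0} ⋯ ∂_{z (n-1)}`. -/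
noncomputable def contractWord {n : ℕ} (z : Fin n → X) : Module.End k (GSym gr) :=
  (List.ofFn fun i => B.contractX hgr (z i)).prod

theorem contractWord_zero (z : Fin 0 → X) (f : GSym gr) : B.contractWord hgr z f = f := by
  simp [contractWord]

theorem contractWord_succ {n : ℕ} (z : Fin (n + 1) → X) (f : GSym gr) : B.contractWord hgr z f =
    B.contractX hgr (z 0) (B.contractWord hgr (fun i => z i.succ) f) := by
  simp [contractWord, List.ofFn_succ]

theorem contractWord_contract {n : ℕ} {z : Fin n → X} {c : Fin n → ℤ} (hz : ∀ i, z i ∈ gr (c i))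
    {d : ℤ} {x : X} (hx : x ∈ gr d) (f : GSym gr) :
    B.contractWord hgr z (B.contractX hgr x f) =
      koszulSign k d (∑ i, c i) • B.contractX hgr x (B.contractWord hgr z f) := by
  induction n with
  | zero => simp [contractWord_zero]
  | succ n ih =>
    rw [contractWord_succ, ih (fun i => hz i.succ), map_smul, contractX_apply B hgr (hz 0),
      contractX_apply B hgr hx, contract_contract, contractWord_succ,
      contractX_apply B hgr (hz 0), smul_smul, Fin.sum_univ_succ, koszulSign_add_right,
      koszulSign_comm (c 0), mul_comm]

theorem koszulSign_sum_succAbove_eq {n : ℕ} (i : Fin (n + 1)) (c : Fin (n + 1) → ℤ) (d : ℤ) :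
    koszulSign k d (∑ l, if i < i.succAbove l then c (i.succAbove l) else 0) =
      koszulSign k d (∑ l, if i < l then c l else 0) := by
  rw [Fin.sum_univ_succAbove (fun l => if i < l then c l else 0) i]
  simp

/-- The Leibniz rule for iterated contractions. -/
theorem contractWord_gen_mul {n : ℕ} {z : Fin (n + 1) → X} {c : Fin (n + 1) → ℤ}
    (hz : ∀ i, z i ∈ gr (c i)) {d : ℤ} {y : X} (hy : y ∈ gr d) (f : GSym gr) :
    B.contractWord hgr z (gen gr y * f) =
      koszulSign k d (∑ i, c i) • (gen gr y * B.contractWord hgr z f) +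
      ∑ i, (koszulSign k d (∑ l, if i < l then c l else 0) * B.form (z i) y) •
        B.contractWord hgr (fun j => z (i.succAbove j)) f := by
  induction n with
  | zero =>
    rw [contractWord_succ, contractWord_zero, contractX_apply B hgr (hz 0),
      contract_gen_mul B hgr _ hy, contractWord_succ, contractWord_zero,
      contractX_apply B hgr (hz 0)]
    simp [contractWord_zero, koszulSign_comm d]
    abel
  | succ n ih =>
    rw [contractWord_succ, ih (fun i => hz i.succ), map_add, map_smul, map_sum,
      contractX_apply B hgr (hz 0), contract_gen_mul B hgr _ hy, Fin.sum_univ_succ c,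
      koszulSign_add_right, contractWord_succ B hgr z f, contractX_apply B hgr (hz 0),
      Fin.sum_univ_succ (fun i : Fin (n + 1 + 1) => (koszulSign k d _ * _) • _)]
    -- The outermost contraction meets `y` only after `y` has passed all the inner ones, whence the
    -- full sum of their degrees.
    have h0 : ∑ l, (if (0 : Fin (n + 1 + 1)) < l then c l else 0) = ∑ i : Fin (n + 1), c i.succ :=
        by
      rw [Fin.sum_univ_succ]
      simp
    have hs : ∀ i : Fin (n + 1), ∑ l, (if i.succ < l then c l else 0) =
        ∑ l : Fin (n + 1), if i < l then c l.succ else 0 := by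
      intro i
      rw [Fin.sum_univ_succ]
      simp
    have hw : ∀ i : Fin (n + 1), B.contractWord hgr (fun j => z (i.succ.succAbove j)) f =
        B.contract hgr (c 0) ⟨z 0, hz 0⟩
          (B.contractWord hgr (fun j => z (i.succAbove j).succ) f) := by
      intro i
      rw [contractWord_succ, Fin.succ_succAbove_zero, contractX_apply B hgr (hz 0)]
      simp only [Fin.succ_succAbove_succ]
    simp only [h0, hs, hw, map_smul, Fin.zero_succAbove, smul_add, smul_smul,
      koszulSign_comm d (c 0), mul_comm (koszulSign k (c 0) d)]
    abel

theorem star_word_of_lt {m n : ℕ} (h : m < n) (x : Fin m → X) (g : GSym gr) :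
    B.star hgr n (word gr x) g = 0 := by
  obtain ⟨n, rfl⟩ := Nat.exists_eq_add_of_lt h
  clear h
  induction m generalizing n g with
  | zero => rw [word_zero, star_succ_one]
  | succ m ih =>
    rw [word_succ]
    generalize x 0 = x₀
    induction x₀ using graded_induction hgr with
    | mem i x₀ hx =>
      have h1 := ih (fun j => x j.succ) g (n + 1)
      rw [show m + (n + 1) + 1 = m + 1 + n + 1 by omega] at h1
      rw [star_succ_gen_mul B hgr _ hx, h1, mul_zero, zero_add,
        ← par_self hgr i (B.contract hgr i ⟨x₀, hx⟩ g), ← par_star,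
        show m + 1 + n = m + n + 1 by omega, ih, map_zero]
    | add x y hx hy => rw [map_add, add_mul, map_add, LinearMap.add_apply, hx, hy, add_zero]

theorem star_right_word_of_lt {m n : ℕ} (h : m < n) (y : Fin m → X) (f : GSym gr) :
    B.star hgr n f (word gr y) = 0 := by
  obtain ⟨n, rfl⟩ := Nat.exists_eq_add_of_lt h
  clear h
  induction m generalizing n f with
  | zero => rw [word_zero, star_succ_right_one]
  | succ m ih =>
    rw [word_succ]
    generalize y 0 = y₀
    induction y₀ using graded_induction hgr with
    | mem i y₀ hy =>
      have h1 := ih (fun j => y j.succ) (par hgr i f) (n + 1)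
      rw [show m + (n + 1) + 1 = m + 1 + n + 1 by omega] at h1
      rw [star_succ_gen_right B hgr _ _ _ hy, h1, mul_zero, zero_add,
        show m + 1 + n = m + n + 1 by omega, ih]
    | add x y hx hy => rw [map_add, add_mul, map_add, hx, hy, add_zero]

theorem sum_shuffleSet_of_zero {M : Type*} [AddCommMonoid M] (p : ℕ)
    (G : Equiv.Perm (Fin 0) → M) : ∑ σ ∈ shuffleSet p 0, G σ = G 1 := by
  have : shuffleSet p 0 = {1} := by
    ext σ
    rw [mem_shuffleSet, Finset.mem_singleton]
    exact ⟨fun _ => Subsingleton.elim _ _, fun _ i => i.elim0⟩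
  rw [this, Finset.sum_singleton]

theorem koszulPerm_of_zero (e : Fin 0 → ℤ) (σ : Equiv.Perm (Fin 0)) : koszulPerm k e σ = 1 := by
  simp [koszulPerm]

/-- The contribution to the shuffle expansion where the first letter is contracted. -/
theorem star_word_contracted {a n m : ℕ} (h : a + n = m) {x : Fin (m + 1) → X}
    {c : Fin (m + 1) → ℤ} (hx : ∀ i, x i ∈ gr (c i)) (g : GSym gr)
    (ih : ∀ g, B.star hgr n (word gr fun i => x i.succ) g =
      ∑ σ ∈ shuffleSet a m, koszulPerm k (fun i => c i.succ) σ •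
      (word gr (fun i => x (σ (blockL h i)).succ) *
        B.contractWord hgr (fun i => x (σ (blockR h i)).succ) g)) :
    B.star hgr n (par hgr (c 0) (word gr fun i => x i.succ)) (B.contract hgr (c 0) ⟨x 0, hx 0⟩ g) =
      ∑ σ ∈ shuffleSet a m, koszulPerm k c (insertZero ⟨a, by omega⟩ σ) •
      (word gr (fun i => x (insertZero ⟨a, by omega⟩ σ (blockL (by omega : a + (n + 1) = m + 1)
          i))) *
        B.contractWord hgr
          (fun i => x (insertZero ⟨a, by omega⟩ σ (blockR (by omega : a + (n + 1) = m + 1) i))) g)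
              := by
  rw [par_apply hgr _ (word_mem_deg fun i => hx i.succ), map_smul, LinearMap.smul_apply, ih,
    Finset.smul_sum]
  refine Finset.sum_congr rfl fun σ _ => ?_
  rw [insertZero_mid_blockL _ h, insertZero_mid_blockR _ h, koszulPerm_insertZero_mid h,
    contractWord_succ, ← contractX_apply B hgr (hx 0),
    contractWord_contract B hgr (fun i => hx (σ (blockR h i)).succ) (hx 0), mul_smul_comm,
        smul_smul,
    smul_smul, ← Equiv.sum_comp σ, sum_blocks h, koszulSign_add_right]
  simp only [Fin.cons_zero, Fin.cons_succ]
  congr 1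
  -- `par` moves the first letter past all the others. Bringing its contraction to the front undoes
  -- the part from the contracted block; the Koszul sign for the uncontracted block remains.
  have := koszulSign_mul_self (k := k) (c 0) (∑ i, c (σ (blockR h i)).succ)
  linear_combination (koszulSign k (c 0) (∑ i, c (σ (blockL h i)).succ) *
    koszulPerm k (fun i => c i.succ) σ) * this

/-- The expansion of the left factor of `star n` over shuffles. -/
theorem star_word {a n m : ℕ} (h : a + n = m) {x : Fin m → X} {c : Fin m → ℤ}
    (hx : ∀ i, x i ∈ gr (c i)) (g : GSym gr) :
    B.star hgr n (word gr x) g = ∑ σ ∈ shuffleSet a m, koszulPerm k c σ •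
      (word gr (fun i => x (σ (blockL h i))) *
        B.contractWord hgr (fun i => x (σ (blockR h i))) g) := by
  induction m generalizing a n g with
  | zero =>
    obtain ⟨rfl, rfl⟩ : a = 0 ∧ n = 0 := by omega
    rw [sum_shuffleSet_of_zero, koszulPerm_of_zero, one_smul, word_zero, word_zero, star_zero_one,
      contractWord_zero, one_mul]
  | succ m ih =>
    have hx' : ∀ i, x (Fin.succ i) ∈ gr (c i.succ) := fun i => hx i.succ
    have uncontracted : ∀ {a' : ℕ} (h₁ : a' + 1 + n = m + 1) (h' : a' + n = m),
        gen gr (x 0) * B.star hgr n (word gr fun i => x i.succ) g =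
        ∑ σ ∈ shuffleSet a' m, koszulPerm k c (insertZero 0 σ) •
          (word gr (fun i => x (insertZero 0 σ (blockL h₁ i))) *
            B.contractWord hgr (fun i => x (insertZero 0 σ (blockR h₁ i))) g) := by
      intro a' h₁ h'
      rw [ih h' hx', Finset.mul_sum]
      refine Finset.sum_congr rfl fun σ _ => ?_
      rw [insertZero_zero_blockL h₁ h', insertZero_zero_blockR h₁ h', koszulPerm_insertZero_zero,
        word_succ, mul_smul_comm, mul_assoc]
      simp only [Fin.cons_zero, Fin.cons_succ]
    rw [word_succ]
    cases n with
    | zero =>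
      obtain rfl : a = m + 1 := by omega
      rw [star_zero_gen_mul B hgr (hx 0), sum_shuffleSet_self_succ, uncontracted h (by omega)]
    | succ n =>
      rw [star_succ_gen_mul B hgr n (hx 0)]
      -- If no place is left uncontracted, the first letter must be contracted: the other term asks
      -- for more contractions than letters.
      cases a with
      | zero =>
        have h' : 0 + n = m := by omega
        rw [star_word_of_lt B hgr (by omega), mul_zero, zero_add, sum_shuffleSet_zero_succ,
          star_word_contracted B hgr h' hx g (ih h' hx')]
        rfl
      | succ a =>
        have h' : a + 1 + n = m := by omega
        rw [sum_shuffleSet_succ (by omega), uncontracted h (by omega),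
          star_word_contracted B hgr h' hx g (ih h' hx')]

/-! ### The pairing of words -/

/-- The pairing `∑_σ ± B(z 0, y (σ 0)) ⋯ B(z (n-1), y (σ (n-1)))`, for `z i` of degree `c i` and
`y i` of degree `e i`. -/
noncomputable def wordPairing (n : ℕ) (z : Fin n → X) (c : Fin n → ℤ) (y : Fin n → X)
    (e : Fin n → ℤ) : k :=
  ∑ σ : Equiv.Perm (Fin n), koszulPerm k e σ * zipSign k (fun i => e (σ i)) c *
    ∏ i, B.form (z i) (y (σ i))

theorem koszulSign_eq_of_form_ne_zero {i j : ℤ} {x y : X} (hx : x ∈ gr i) (hy : y ∈ gr j)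
    (h : B.form x y ≠ 0) (d : ℤ) : koszulSign k i d = koszulSign k j d :=
  koszulSign_congr_left (B.even_sub ⟨x, hx⟩ j y hy h) d

/-- The expansion of the pairing along the first right letter. -/
theorem wordPairing_succ {n : ℕ} {z : Fin (n + 1) → X} {c : Fin (n + 1) → ℤ}
    (hz : ∀ i, z i ∈ gr (c i)) {y : Fin (n + 1) → X} {e : Fin (n + 1) → ℤ}
    (hy : ∀ i, y i ∈ gr (e i)) : B.wordPairing (n + 1) z c y e =
      ∑ i, koszulSign k (e 0) (∑ l, if i < l then c l else 0) * B.form (z i) (y 0) *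
        B.wordPairing n (fun j => z (i.succAbove j)) (fun j => c (i.succAbove j))
          (fun j => y j.succ) (fun j => e j.succ) := by
  rw [wordPairing, sum_perm_succ]
  refine Finset.sum_congr rfl fun i _ => ?_
  rw [wordPairing, Finset.mul_sum]
  refine Finset.sum_congr rfl fun σ _ => ?_
  rw [Fin.prod_univ_succAbove _ i, koszulPerm_insertZero, zipSign_insertZero,
    koszulSign_sum_succAbove_eq]
  simp only [insertZero_self, insertZero_succAbove]
  by_cases h : B.form (z i) (y 0) = 0
  · simp [h]
  -- `z i` and `y 0` now have equal parity, so the inversion sign of `y 0` and the sign of `z i`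
  -- passing the same letters cancel.
  · rw [koszulSign_eq_of_form_ne_zero B (hz i) (hy 0) h]
    have := koszulSign_mul_self (k := k) (e 0)
      (∑ j, if i.succAbove j < i then e (σ j).succ else 0)
    generalize koszulSign k (e 0) (∑ j, if i.succAbove j < i then e (σ j).succ else 0) = t at *
    generalize koszulSign k (e 0) _ = t'
    generalize koszulPerm k _ σ = t₁
    generalize zipSign k _ _ = t₂
    generalize ∏ j, B.form (z (i.succAbove j)) (y (σ j).succ) = t₃
    linear_combination (t' * t₁ * t₂ * t₃ * B.form (z i) (y 0)) * this

/-- A nonzero term matches letters of equal parity, so the two words have the same total parity. -/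
theorem wordPairing_ne_zero {n : ℕ} {z : Fin n → X} {c : Fin n → ℤ}
    (hz : ∀ i, z i ∈ gr (c i)) {y : Fin n → X} {e : Fin n → ℤ}
    (hy : ∀ i, y i ∈ gr (e i)) (h : B.wordPairing n z c y e ≠ 0) (d : ℤ) :
    koszulSign k d (∑ i, e i) = koszulSign k d (∑ i, c i) := by
  obtain ⟨σ, -, hσ⟩ := Finset.exists_ne_zero_of_sum_ne_zero h
  have hp := right_ne_zero_of_mul hσ
  rw [Finset.prod_ne_zero_iff] at hp
  rw [← Equiv.sum_comp σ, koszulSign_sum_right, koszulSign_sum_right]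
  refine Finset.prod_congr rfl fun i _ => ?_
  rw [koszulSign_comm d, koszulSign_comm d,
    koszulSign_eq_of_form_ne_zero B (hz i) (hy (σ i)) (hp i (Finset.mem_univ i))]

theorem wordPairing_zero (z : Fin 0 → X) (c : Fin 0 → ℤ) (y : Fin 0 → X) (e : Fin 0 → ℤ) :
    B.wordPairing 0 z c y e = 1 := by
  simp [wordPairing, koszulPerm, zipSign]

theorem contractWord_one {n : ℕ} {z : Fin (n + 1) → X} {c : Fin (n + 1) → ℤ}
    (hz : ∀ i, z i ∈ gr (c i)) : B.contractWord hgr z 1 = 0 := by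
  induction n with
  | zero => rw [contractWord_succ, contractWord_zero, contractX_apply B hgr (hz 0), contract_one]
  | succ n ih => rw [contractWord_succ, ih fun i => hz i.succ, map_zero]

theorem contractWord_of_lt {m n : ℕ} (h : m ≤ n) {z : Fin (n + 1) → X} {c : Fin (n + 1) → ℤ}
    (hz : ∀ i, z i ∈ gr (c i)) {y : Fin m → X} {e : Fin m → ℤ} (hy : ∀ i, y i ∈ gr (e i)) :
    B.contractWord hgr z (word gr y) = 0 := by
  induction m generalizing n with
  | zero => rw [word_zero, contractWord_one B hgr hz]
  | succ m ih =>
    obtain ⟨n, rfl⟩ := Nat.exists_eq_add_of_le' (Nat.one_le_of_lt h)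
    rw [word_succ, contractWord_gen_mul B hgr hz (hy 0),
      ih (by omega) hz fun i => hy i.succ, mul_zero, smul_zero, zero_add]
    refine Finset.sum_eq_zero fun i _ => ?_
    rw [ih (c := fun j => c (i.succAbove j)) (by omega) (fun j => hz _) fun i => hy i.succ,
      smul_zero]

/-- The expansion of iterated contractions of a word over shuffles. -/
theorem contractWord_word {n b m : ℕ} (h : n + b = m) {z : Fin n → X} {c : Fin n → ℤ}
    (hz : ∀ i, z i ∈ gr (c i)) {y : Fin m → X} {e : Fin m → ℤ} (hy : ∀ i, y i ∈ gr (e i)) :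
    B.contractWord hgr z (word gr y) = ∑ μ ∈ shuffleSet n m, (koszulPerm k e μ *
      B.wordPairing n z c (fun i => y (μ (blockL h i))) (fun i => e (μ (blockL h i)))) •
        word gr (fun i => y (μ (blockR h i))) := by
  induction m generalizing n b with
  | zero =>
    obtain ⟨rfl, rfl⟩ : n = 0 ∧ b = 0 := by omega
    rw [sum_shuffleSet_of_zero, koszulPerm_of_zero, wordPairing_zero, word_zero, word_zero,
      contractWord_zero, mul_one, one_smul]
  | succ m ih =>
    have hy' : ∀ i, y (Fin.succ i) ∈ gr (e i.succ) := fun i => hy i.succ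
    have uncontracted : ∀ {b' : ℕ} (h₁ : n + (b' + 1) = m + 1) (h' : n + b' = m),
        koszulSign k (e 0) (∑ i, c i) •
          (gen gr (y 0) * B.contractWord hgr z (word gr fun i => y i.succ)) =
        ∑ μ ∈ shuffleSet n m, (koszulPerm k e (insertZero ⟨n, by omega⟩ μ) *
          B.wordPairing n z c (fun i => y (insertZero ⟨n, by omega⟩ μ (blockL h₁ i)))
            (fun i => e (insertZero ⟨n, by omega⟩ μ (blockL h₁ i)))) •
          word gr (fun i => y (insertZero ⟨n, by omega⟩ μ (blockR h₁ i))) := by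
      intro b' h₁ h'
      rw [ih h' hz hy', Finset.mul_sum, Finset.smul_sum]
      refine Finset.sum_congr rfl fun μ _ => ?_
      rw [insertZero_mid_blockL h₁ h', insertZero_mid_blockL h₁ h', insertZero_mid_blockR h₁ h',
        koszulPerm_insertZero_mid h', word_succ, mul_smul_comm, smul_smul]
      simp only [Fin.cons_zero, Fin.cons_succ]
      congr 1
      -- The Leibniz sign counts the contracting letters, the Koszul sign the contracted ones; they
      -- agree where the pairing is nonzero.
      by_cases h0 : B.wordPairing n z c (fun i => y (μ (blockL h' i)).succ)
          (fun i => e (μ (blockL h' i)).succ) = 0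
      · simp [h0]
      · rw [wordPairing_ne_zero B hz (fun i => hy (μ (blockL h' i)).succ) h0, mul_assoc]
    rw [word_succ]
    cases n with
    | zero =>
      cases b with
      | zero => omega
      | succ b =>
        have := uncontracted h (by omega)
        rw [contractWord_zero] at this ⊢
        rw [sum_shuffleSet_zero_succ]
        simpa using this
    | succ n =>
      rw [contractWord_gen_mul B hgr hz (hy 0)]
      -- If `y 0` is contracted, summing over its partner is the expansion of the pairing along `y
      -- 0`, as in `wordPairing_succ`.
      have contracted : ∀ (h' : n + b = m),
          ∑ i, (koszulSign k (e 0) (∑ l, if i < l then c l else 0) * B.form (z i) (y 0)) •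
            B.contractWord hgr (fun j => z (i.succAbove j)) (word gr fun i => y i.succ) =
          ∑ μ ∈ shuffleSet n m, (koszulPerm k e (insertZero 0 μ) *
            B.wordPairing (n + 1) z c (fun i => y (insertZero 0 μ (blockL h i)))
              (fun i => e (insertZero 0 μ (blockL h i)))) •
            word gr (fun i => y (insertZero 0 μ (blockR h i))) := by
        intro h'
        have := fun i : Fin (n + 1) => ih h' (z := fun j => z (i.succAbove j))
          (c := fun j => c (i.succAbove j)) (fun j => hz _) hy'
        simp only [this, Finset.smul_sum]
        rw [Finset.sum_comm]
        refine Finset.sum_congr rfl fun μ _ => ?_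
        rw [insertZero_zero_blockL h h', insertZero_zero_blockL h h', insertZero_zero_blockR h h',
          koszulPerm_insertZero_zero, wordPairing_succ B hz, Finset.mul_sum, Finset.sum_smul]
        · refine Finset.sum_congr rfl fun i _ => ?_
          rw [smul_smul]
          congr 1
          simp only [Fin.cons_zero, Fin.cons_succ]
          ring
        · intro i
          induction i using Fin.cases with
          | zero => exact hy 0
          | succ i => exact hy _
      cases b with
      | zero =>
        obtain rfl : n = m := by omega
        rw [sum_shuffleSet_self_succ, contracted (by omega),
          contractWord_of_lt B hgr le_rfl hz hy', mul_zero, smul_zero, zero_add]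
      | succ b =>
        rw [sum_shuffleSet_succ (by omega), uncontracted h (by omega), contracted (by omega),
          add_comm]

/-- The shuffle formula for the products `star n`. -/
theorem star_word_word {a n b : ℕ} {x : Fin (a + n) → X} {c : Fin (a + n) → ℤ}
    {y : Fin (n + b) → X} {e : Fin (n + b) → ℤ} (hx : ∀ i, x i ∈ gr (c i))
    (hy : ∀ i, y i ∈ gr (e i)) :
    B.star hgr n (word gr x) (word gr y) =
      ∑ σ ∈ shuffles a n, ∑ μ ∈ shuffles n b, (koszul c σ * koszul e μ) •
        (word gr (fun i : Fin a => x (σ (Fin.castAdd n i))) *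
          algebraMap k (GSym gr) (B.wordPairing n
            (fun i => x (σ (Fin.natAdd a i))) (fun i => c (σ (Fin.natAdd a i)))
            (fun i => y (μ (Fin.castAdd b i))) (fun i => e (μ (Fin.castAdd b i)))) *
          word gr (fun i : Fin b => y (μ (Fin.natAdd n i)))) := by
  rw [star_word B hgr rfl hx, shuffles_eq, shuffles_eq]
  refine Finset.sum_congr rfl fun σ _ => ?_
  rw [contractWord_word B hgr rfl (fun i => hx (σ (blockR rfl i))) hy, Finset.mul_sum,
    Finset.smul_sum]
  refine Finset.sum_congr rfl fun μ _ => ?_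
  rw [Units.smul_def, ← Int.cast_smul_eq_zsmul k, Units.val_mul, Int.cast_mul, koszulPerm_eq,
    koszulPerm_eq, mul_assoc, ← Algebra.smul_def, mul_smul_comm, mul_smul_comm, smul_smul,
    smul_smul, ← mul_assoc]
  rfl

end GradedForm

/-! ### Detecting equality on words and scalars -/

namespace GSym

variable {k : Type u} [Field k] {X : Type v} [AddCommGroup X] [Module k X]
variable {gr : ℤ → Submodule k X}

theorem linearMap_ext_deg (hgr : DirectSum.IsInternal gr) {M : Type*} [AddCommGroup M] [Module k M]
    {F G : GSym gr →ₗ[k] M} (h : ∀ d, ∀ f ∈ deg gr d, F f = G f) : F = G := by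
  have h' : ⨆ d, deg gr d ≤ LinearMap.eqLocus F G := iSup_le h
  rw [iSup_deg hgr] at h'
  ext f
  exact h' (Submodule.mem_top (x := f))

theorem linearMap_ext_word (hgr : DirectSum.IsInternal gr) {M : Type*} [AddCommGroup M]
    [Module k M] {F G : GSym gr →ₗ[k] M}
    (h : ∀ (n : ℕ) (x : Fin n → X) (e : Fin n → ℤ), (∀ i, x i ∈ gr (e i)) →
      F (word gr x) = G (word gr x)) : F = G := by
  refine linearMap_ext_deg hgr fun d => ?_
  have : deg gr d ≤ LinearMap.eqLocus F G := by
    rw [deg, Submodule.span_le]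
    rintro _ ⟨n, x, e, hx, -, rfl⟩
    exact h n x e hx
  exact this

/-- The augmentation that kills all generators is a left inverse. -/
theorem algebraMap_injective (gr : ℤ → Submodule k X) :
    Function.Injective (algebraMap k (GSym gr)) := by
  have hε : (lift gr (0 : X →ₗ[k] k) (by simp)).toRingHom.comp (algebraMap k (GSym gr)) =
      RingHom.id k := by
    ext c
    simp
  refine Function.LeftInverse.injective (g := lift gr (0 : X →ₗ[k] k) (by simp)) fun c => ?_
  exact congrArg (fun F : k →+* k => F c) hε

end GSym

theorem isShuffle_iff_eq_one {p m : ℕ} (h : p = 0 ∨ p = m) {σ : Equiv.Perm (Fin m)} :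
    IsShuffle p σ ↔ σ = 1 := by
  constructor
  · intro hσ
    have hmono : StrictMono σ := fun i j hij => hσ i j hij (by have := j.2; omega)
    have : hmono.orderIsoOfSurjective σ σ.surjective = OrderIso.refl (Fin m) :=
      Subsingleton.elim _ _
    ext i
    exact congrArg (fun F : Fin m ≃o Fin m => (F i : ℕ)) this
  · rintro rfl i j hij -
    exact hij

theorem shuffleSet_eq_singleton {p m : ℕ} (h : p = 0 ∨ p = m) : shuffleSet p m = {1} := by
  ext σ
  rw [mem_shuffleSet, isShuffle_iff_eq_one h, Finset.mem_singleton]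

theorem koszulPerm_one {k : Type u} [Field k] {n : ℕ} (e : Fin n → ℤ) : koszulPerm k e 1 = 1 := by
  refine Finset.prod_eq_one fun p _ => if_neg ?_
  rintro ⟨h, h'⟩
  exact lt_asymm h h'

/-! ### The shuffle formula for the brackets -/

namespace GradedForm

open GSym

variable {k : Type u} [Field k] {X : Type v} [AddCommGroup X] [Module k X]
variable {gr : ℤ → Submodule k X} {s : ℤ} (B : GradedForm gr s) (hgr : DirectSum.IsInternal gr)

/-- With as many contractions as letters only one shuffle remains on each side, so identities of
star products become identities of pairings. -/
theorem star_word_word_self {n : ℕ} {x y : Fin n → X} {c e : Fin n → ℤ}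
    (hx : ∀ i, x i ∈ gr (c i)) (hy : ∀ i, y i ∈ gr (e i)) :
    B.star hgr n (word gr x) (word gr y) = algebraMap k _ (B.wordPairing n x c y e) := by
  have hR : ∀ i, blockR (zero_add n) i = i := fun i => Fin.ext (Nat.zero_add _)
  have hL : ∀ i, blockL (add_zero n) i = i := fun i => rfl
  rw [star_word B hgr (zero_add n) hx, shuffleSet_eq_singleton (Or.inl rfl),
    Finset.sum_singleton, koszulPerm_one, one_smul, word_zero, one_mul]
  simp only [Equiv.Perm.coe_one, id_eq, hR]
  rw [contractWord_word B hgr (add_zero n) hx hy, shuffleSet_eq_singleton (Or.inr rfl),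
    Finset.sum_singleton, koszulPerm_one, word_zero, one_mul, Algebra.algebraMap_eq_smul_one]
  rfl

/-- The pairing of words for the opposite form. -/
theorem wordPairing_op {n : ℕ} {x y : Fin n → X} {c e : Fin n → ℤ}
    (hx : ∀ i, x i ∈ gr (c i)) (hy : ∀ i, y i ∈ gr (e i)) :
    (B.op hgr).wordPairing n x c y e =
      koszulSign k (∑ i, c i) (∑ i, e i) * B.wordPairing n y e x c := by
  -- The symmetry is inherited from `star_op`, so the sum over permutations need not be reindexed by
  -- inverses.
  apply algebraMap_injective gr
  rw [← star_word_word_self (B.op hgr) hgr hx hy,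
    star_op B hgr n (word_mem_deg hx) (word_mem_deg hy), star_word_word_self B hgr hy hx, map_mul,
    ← Algebra.smul_def]

theorem bracket_word_word {a m b : ℕ} {x : Fin (a + (m + 1)) → X} {c : Fin (a + (m + 1)) → ℤ}
    {y : Fin (m + 1 + b) → X} {e : Fin (m + 1 + b) → ℤ} (hx : ∀ i, x i ∈ gr (c i))
    (hy : ∀ i, y i ∈ gr (e i)) :
    B.bracket hgr m (word gr x) (word gr y) =
      ∑ σ ∈ shuffles a (m + 1), ∑ μ ∈ shuffles (m + 1) b, (koszul c σ * koszul e μ) •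
        (word gr (fun i : Fin a => x (σ (Fin.castAdd (m + 1) i))) *
          algebraMap k (GSym gr) (B.wordPairing (m + 1)
            (fun i => x (σ (Fin.natAdd a i))) (fun i => c (σ (Fin.natAdd a i)))
            (fun i => y (μ (Fin.castAdd b i))) (fun i => e (μ (Fin.castAdd b i))) -
            koszulSign k (∑ i, c (σ (Fin.natAdd a i))) (∑ i, e (μ (Fin.castAdd b i))) *
            B.wordPairing (m + 1)
            (fun i => y (μ (Fin.castAdd b i))) (fun i => e (μ (Fin.castAdd b i)))
            (fun i => x (σ (Fin.natAdd a i))) (fun i => c (σ (Fin.natAdd a i)))) *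
          word gr (fun i : Fin b => y (μ (Fin.natAdd (m + 1) i)))) := by
  rw [bracket_apply, star_word_word B hgr hx hy, star_word_word (B.op hgr) hgr hx hy,
    ← Finset.sum_sub_distrib]
  refine Finset.sum_congr rfl fun σ _ => ?_
  rw [← Finset.sum_sub_distrib]
  refine Finset.sum_congr rfl fun μ _ => ?_
  rw [wordPairing_op B hgr (fun i => hx _) (fun i => hy _), map_sub, mul_sub, sub_mul, smul_sub]

theorem exists_bracket_eq_zero (f : GSym gr) :
    ∃ N, ∀ m, N ≤ m → ∀ g, B.bracket hgr m f g = 0 := by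
  obtain ⟨N, hN⟩ := B.exists_star_eq_zero hgr f
  obtain ⟨N', hN'⟩ := (B.op hgr).exists_star_eq_zero hgr f
  refine ⟨max N N', fun m hm g => ?_⟩
  rw [bracket_apply, hN _ (by omega), hN' _ (by omega), sub_zero]

/-! ### The Poisson bracket -/

/-- A single contraction is a derivation in the right factor: the recursion adds only the term of
`star 0`, a product with a contraction. -/
theorem star_one_mul {i j : ℤ} {f g : GSym gr} (hf : f ∈ deg gr i) (hg : g ∈ deg gr j)
    (l : GSym gr) : B.star hgr 1 f (g * l) =
      B.star hgr 1 f g * l + koszulSign k i j • (g * B.star hgr 1 f l) := by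
  refine deg_induction (P := fun i f => B.star hgr 1 f (g * l) =
      B.star hgr 1 f g * l + koszulSign k i j • (g * B.star hgr 1 f l)) ?_ ?_ ?_ ?_ ?_ hf
  · simp
  · intro d f f' h h'
    rw [map_add, LinearMap.add_apply, h, h', LinearMap.add_apply, LinearMap.add_apply, add_mul,
      mul_add, smul_add]
    abel
  · intro d c f h
    rw [map_smul, LinearMap.smul_apply, h, LinearMap.smul_apply, LinearMap.smul_apply,
      smul_mul_assoc, mul_smul_comm, smul_add, smul_comm c]
  · rw [star_succ_one, star_succ_one, star_succ_one, zero_mul, mul_zero, smul_zero, add_zero]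
  · intro a i x hx f hf h
    simp only [star_succ_gen_mul B hgr 0 hx, star_zero]
    have h1 : g * (gen gr x * B.star hgr 1 f l) =
        koszulSign k a j • (gen gr x * (g * B.star hgr 1 f l)) := by
      rw [← mul_assoc, mul_comm' hg (gen_mem_deg hx), smul_mul_assoc, mul_assoc, koszulSign_comm]
    have h2 : ∀ r, g * (f * r) = koszulSign k i j • (f * (g * r)) := by
      intro r
      rw [← mul_assoc, mul_comm' hg hf, smul_mul_assoc, mul_assoc, koszulSign_comm]
    rw [h, contract_mul, par_apply hgr a hf, par_apply hgr a hg, koszulSign_add_left]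
    simp only [smul_mul_assoc, mul_smul_comm, mul_add, add_mul, smul_add, h1, h2, smul_smul,
      mul_assoc]
    have e1 := koszulSign_mul_self (k := k) a j
    have e2 := koszulSign_mul_self (k := k) i j
    linear_combination (norm := module)
      (-koszulSign k i j * e1) • (gen gr x * (g * B.star hgr 1 f l)) -
      (koszulSign k a j * koszulSign k a i * e2) • (f * (g * B.contract hgr a ⟨x, hx⟩ l))

theorem bracket_zero_mul {i j : ℤ} {f g : GSym gr} (hf : f ∈ deg gr i) (hg : g ∈ deg gr j)
    (l : GSym gr) : B.bracket hgr 0 f (g * l) =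
      B.bracket hgr 0 f g * l + koszulSign k i j • (g * B.bracket hgr 0 f l) := by
  simp only [bracket_apply, zero_add, star_one_mul _ hgr hf hg, sub_mul, mul_sub, smul_sub]
  abel

theorem bracket_mul_zero {j l : ℤ} (f : GSym gr) {g h : GSym gr} (hg : g ∈ deg gr j)
    (hh : h ∈ deg gr l) : B.bracket hgr 0 (f * g) h =
      f * B.bracket hgr 0 g h + koszulSign k j l • (B.bracket hgr 0 f h * g) := by
  induction f using graded_induction (isInternal_deg hgr) with
  | add f f' hf hf' =>
    simp only [add_mul, map_add, LinearMap.add_apply, hf, hf', smul_add]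
    abel
  | mem i f hf =>
    rw [bracket_antisymm B hgr 0 (mul_mem_deg hf hg) hh, bracket_zero_mul B hgr hh hf,
      bracket_antisymm B hgr 0 hh hf, bracket_antisymm B hgr 0 hh hg, koszulSign_comm l i,
      koszulSign_comm l j, koszulSign_add_left]
    simp only [neg_mul, mul_neg, smul_neg, smul_add, smul_smul, smul_mul_assoc, mul_smul_comm]
    have e1 := koszulSign_mul_self (k := k) i l
    have e2 := koszulSign_mul_self (k := k) j l
    linear_combination (norm := module)
      (koszulSign k j l * koszulSign k j l * e1 + e2) • (f * B.bracket hgr 0 g h) +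
      (koszulSign k j l * e1) • (B.bracket hgr 0 f h * g)

theorem bracket_zero_gen_gen {i j : ℤ} {x y : X} (hx : x ∈ gr i) (hy : y ∈ gr j) :
    B.bracket hgr 0 (gen gr x) (gen gr y) =
      algebraMap k _ (B.form x y - koszulSign k i j * B.form y x) := by
  have h : ∀ C : GradedForm gr s, C.star hgr 1 (gen gr x) (gen gr y) = algebraMap k _ (C.form x y)
      := by
    intro C
    have := C.star_succ_gen_mul hgr 0 hx 1 (gen gr y * 1)
    rw [contract_gen_mul C hgr _ hy, contract_one, star_zero, star_succ_one] at this
    simpa [Algebra.algebraMap_eq_smul_one] using this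
  rw [bracket_apply, h, h, op_form B hgr hx hy, map_sub]

end GradedForm

/-! ### Change of the grading -/

section Regrade

open GSym

variable {k : Type u} [Field k] {X : Type v} [AddCommGroup X] [Module k X]

/-- The elements which are homogeneous, of degrees of the same parity, for both gradings. -/
def parityHomogeneous (gr gr' : ℤ → Submodule k X) : Set X :=
  {x | ∃ i i', x ∈ gr i ∧ x ∈ gr' i' ∧ Even (i - i')}

variable {gr gr' : ℤ → Submodule k X} (hgr : DirectSum.IsInternal gr)
  (hgr' : DirectSum.IsInternal gr') (hT : Submodule.span k (parityHomogeneous gr gr') = ⊤)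
  {Φ : GSym gr →ₐ[k] GSym gr'} (hΦ : ∀ x, Φ (gen gr x) = gen gr' x)

include hT

theorem twist_eq_twist (i : ℤ) : twist hgr i = twist hgr' i := by
  refine LinearMap.ext_on hT ?_
  rintro x ⟨j, j', hx, hx', h⟩
  rw [twist_apply hgr i hx, twist_apply hgr' i hx', koszulSign_congr_right h]

include hΦ

theorem map_par {i i' : ℤ} (hi : Even (i - i')) (f : GSym gr) :
    Φ (par hgr i f) = par hgr' i' (Φ f) := by
  have : Φ.comp (par hgr i) = (par hgr' i').comp Φ := by
    apply hom_ext
    have h : (Φ.comp (par hgr i)).toLinearMap ∘ₗ gen gr =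
        ((par hgr' i').comp Φ).toLinearMap ∘ₗ gen gr := by
      refine LinearMap.ext_on hT ?_
      rintro x ⟨j, j', hx, hx', h⟩
      simp only [LinearMap.comp_apply, AlgHom.toLinearMap_apply, AlgHom.comp_apply]
      rw [par_gen hgr i hx, map_smul, hΦ, par_gen hgr' i' hx', koszulSign_congr_right h,
        koszulSign_congr_left hi]
    exact fun x => LinearMap.congr_fun h x
  exact DFunLike.congr_fun this f

variable {s s' : ℤ} {B : GradedForm gr s} {B' : GradedForm gr' s'}

theorem map_contract (hB : B.form = B'.form) {i i' : ℤ} {x : X} (hx : x ∈ gr i) (hx' : x ∈ gr' i')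
    (hi : Even (i - i')) (f : GSym gr) :
    Φ (B.contract hgr i ⟨x, hx⟩ f) = B'.contract hgr' i' ⟨x, hx'⟩ (Φ f) := by
  have h := eq_top_of_gen_mul_mem _ hT
    (LinearMap.eqLocus (Φ.toLinearMap ∘ₗ B.contract hgr i ⟨x, hx⟩)
      (B'.contract hgr' i' ⟨x, hx'⟩ ∘ₗ Φ.toLinearMap)) ?_ ?_
  · exact h.ge (Submodule.mem_top (x := f))
  · simp [GradedForm.contract_one]
  · rintro y ⟨j, j', hy, hy', hj⟩ f hf
    simp only [LinearMap.mem_eqLocus, LinearMap.comp_apply, AlgHom.toLinearMap_apply] at hf ⊢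
    rw [map_mul Φ, hΦ, B.contract_gen_mul hgr _ hy, B'.contract_gen_mul hgr' _ hy', ← hf, ← hΦ,
      map_add, map_smul, map_smul, map_mul, hB, koszulSign_congr_left hi, koszulSign_congr_right hj]

/-- The recursion uses degrees only through signs, so an algebra map fixing generators of matching
parity respects it when the forms agree. -/
theorem map_star (hB : B.form = B'.form) (n : ℕ) (f g : GSym gr) :
    Φ (B.star hgr n f g) = B'.star hgr' n (Φ f) (Φ g) := by
  let p : Submodule k (GSym gr) :=
    { carrier := {f | ∀ n g, Φ (B.star hgr n f g) = B'.star hgr' n (Φ f) (Φ g)}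
      add_mem' := fun hf hg n g => by
        rw [map_add, LinearMap.add_apply, map_add, hf, hg, map_add, map_add, LinearMap.add_apply]
      zero_mem' := fun n g => by simp
      smul_mem' := fun c f hf n g => by
        rw [map_smul, LinearMap.smul_apply, map_smul, hf, map_smul, map_smul,
          LinearMap.smul_apply] }
  have h : p = ⊤ := by
    refine eq_top_of_gen_mul_mem _ hT p ?_ ?_
    · rintro (_ | n) g
      · rw [map_one Φ, B.star_zero_one, B'.star_zero_one]
      · rw [map_one Φ, B.star_succ_one, B'.star_succ_one, map_zero]
    · rintro x ⟨i, i', hx, hx', hi⟩ f hf n g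
      rw [map_mul Φ, hΦ, B.star_gen_mul_eq hgr n hx, B'.star_gen_mul_eq hgr' n hx']
      cases n with
      | zero => rw [GradedForm.starOp_zero, GradedForm.starOp_zero, map_mul, hΦ, hf]
      | succ n =>
        rw [GradedForm.starOp_succ, GradedForm.starOp_succ, map_add, map_mul, hΦ, hf,
          map_par hgr hgr' hT hΦ hi, hf, map_par hgr hgr' hT hΦ hi,
          map_contract hgr hgr' hT hΦ hB hx hx' hi]
  exact h.ge (Submodule.mem_top (x := f)) n g

theorem map_bracket (hB : B.form = B'.form) (m : ℕ) (f g : GSym gr) :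
    Φ (B.bracket hgr m f g) = B'.bracket hgr' m (Φ f) (Φ g) := by
  have h : (B.op hgr).form = (B'.op hgr').form := by
    change B.form.flip ∘ₗ twist hgr 1 = B'.form.flip ∘ₗ twist hgr' 1
    rw [twist_eq_twist hgr hgr' hT, hB]
  rw [B.bracket_apply, map_sub, map_star hgr hgr' hT hΦ hB, map_star hgr hgr' hT hΦ h,
    B'.bracket_apply]

end Regrade

theorem coeff_zero_hExtend {k : Type u} [Field k] {A : Type*} [Ring A] [Algebra k A]
    (c : ℕ → A →ₗ[k] A →ₗ[k] A) (F G : PowerSeries A) : PowerSeries.coeff 0 (hExtend c F G) =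
      c 0 (PowerSeries.coeff 0 F) (PowerSeries.coeff 0 G) := by
  simp [coeff_hExtend]

theorem transportBracket_hExtend {k : Type u} [Field k] {A A' : Type*} [Ring A] [Algebra k A]
    [Ring A'] [Algebra k A'] (Φ : A ≃ₐ[k] A') {c : ℕ → A →ₗ[k] A →ₗ[k] A}
    {c' : ℕ → A' →ₗ[k] A' →ₗ[k] A'} (h : ∀ m f g, Φ (c m f g) = c' m (Φ f) (Φ g)) :
    transportBracket Φ (hExtend c) = hExtend c' := by
  funext F G
  ext N
  rw [transportBracket, PowerSeries.coeff_map, coeff_hExtend, coeff_hExtend]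
  simp only [map_sum, RingHom.coe_coe, h, PowerSeries.coeff_map, AlgEquiv.apply_symm_apply]

/-! ### The grading and the form on `V ⊕ V*` -/

section Superbig

open GSym

variable {k : Type u} [Field k] {V : Type v} [AddCommGroup V] [Module k V]
  {𝒱 : ℤ → Submodule k V}

/-- The projection to the component of degree `d`. -/
noncomputable def gradedProj (h𝒱 : DirectSum.IsInternal 𝒱) (d : ℤ) : V →ₗ[k] V :=
  gradedLift h𝒱 fun j => if j = d then (𝒱 j).subtype else 0

theorem gradedProj_self (h𝒱 : DirectSum.IsInternal 𝒱) {d : ℤ} {x : V} (hx : x ∈ 𝒱 d) :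
    gradedProj h𝒱 d x = x := by
  rw [gradedProj, gradedLift_apply h𝒱 _ hx, if_pos rfl, Submodule.subtype_apply]

theorem gradedProj_ne (h𝒱 : DirectSum.IsInternal 𝒱) {d e : ℤ} (h : e ≠ d) {x : V} (hx : x ∈ 𝒱 e) :
    gradedProj h𝒱 d x = 0 := by
  rw [gradedProj, gradedLift_apply h𝒱 _ hx, if_neg h, LinearMap.zero_apply]

theorem gradedProj_mem (h𝒱 : DirectSum.IsInternal 𝒱) (d : ℤ) (x : V) :
    gradedProj h𝒱 d x ∈ 𝒱 d := by
  induction x using graded_induction h𝒱 with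
  | mem e x hx =>
    by_cases h : e = d
    · subst h
      rwa [gradedProj_self h𝒱 hx]
    · rw [gradedProj_ne h𝒱 h hx]
      exact Submodule.zero_mem _
  | add x y hx hy => rw [map_add]; exact Submodule.add_mem _ hx hy

/-- In finite dimension only finitely many components are nonzero. The finite sum also decomposes
functionals, which is needed for the components of V* to span. -/
theorem exists_sum_gradedProj (h𝒱 : DirectSum.IsInternal 𝒱) [FiniteDimensional k V] :
    ∃ t : Finset ℤ, ∀ x, ∑ d ∈ t, gradedProj h𝒱 d x = x := by
  have hfin : {d | 𝒱 d ≠ ⊥}.Finite := by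
    simpa using WellFoundedGT.finite_ne_bot_of_iSupIndep h𝒱.submodule_iSupIndep
  refine ⟨hfin.toFinset, fun x => ?_⟩
  induction x using graded_induction h𝒱 with
  | add x y hx hy => simp only [map_add, Finset.sum_add_distrib, hx, hy]
  | mem e x hx =>
    by_cases h0 : x = 0
    · simp [h0]
    · have he : e ∈ hfin.toFinset := by
        rw [Set.Finite.mem_toFinset]
        intro h
        exact h0 ((Submodule.mem_bot k).mp (h ▸ hx))
      rw [Finset.sum_eq_single_of_mem e he fun d _ hd => gradedProj_ne h𝒱 hd.symm hx,
        gradedProj_self h𝒱 hx]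

theorem comp_gradedProj_mem (h𝒱 : DirectSum.IsInternal 𝒱) (φ : Module.Dual k V) (d : ℤ) :
    φ ∘ₗ gradedProj h𝒱 d ∈ dualGr 𝒱 (-d) := by
  intro i hi x hx
  rw [LinearMap.comp_apply, gradedProj_ne h𝒱 (by simpa using hi) hx, map_zero]

theorem comp_gradedProj_self (h𝒱 : DirectSum.IsInternal 𝒱) {φ : Module.Dual k V} {d : ℤ}
    (hφ : φ ∈ dualGr 𝒱 d) : φ ∘ₗ gradedProj h𝒱 (-d) = φ := by
  ext x
  induction x using graded_induction h𝒱 with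
  | add x y hx hy => rw [map_add, hx, hy, map_add]
  | mem e x hx =>
    rw [LinearMap.comp_apply]
    by_cases h : e = -d
    · subst h
      rw [gradedProj_self h𝒱 hx]
    · rw [gradedProj_ne h𝒱 h hx, map_zero, hφ e h x hx]

theorem comp_gradedProj_ne (h𝒱 : DirectSum.IsInternal 𝒱) {φ : Module.Dual k V} {d e : ℤ}
    (h : d ≠ e) (hφ : φ ∈ dualGr 𝒱 d) : φ ∘ₗ gradedProj h𝒱 (-e) = 0 := by
  ext x
  rw [LinearMap.comp_apply, LinearMap.zero_apply]
  exact hφ _ (by simpa using h.symm) _ (gradedProj_mem h𝒱 _ x)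

/-- The grading of `V ⊕ V*` in which the degrees are raised by one on `V` and lowered by `t` on
`V*` is a direct sum decomposition. -/
theorem isInternal_prod_dual [FiniteDimensional k V] (h𝒱 : DirectSum.IsInternal 𝒱) (t : ℤ) :
    DirectSum.IsInternal fun d => (𝒱 (d - 1)).prod (dualGr 𝒱 (d + t)) := by
  refine isInternal_of_projections (fun d => (gradedProj h𝒱 (d - 1)).prodMap
    (LinearMap.lcomp k k (gradedProj h𝒱 (-(d + t))))) ?_ ?_ ?_
  · rintro d ⟨v, φ⟩ ⟨hv, hφ⟩
    exact Prod.ext (gradedProj_self h𝒱 hv) (comp_gradedProj_self h𝒱 hφ)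
  · rintro d e hne ⟨v, φ⟩ ⟨hv, hφ⟩
    exact Prod.ext (gradedProj_ne h𝒱 (by simpa using hne) hv)
      (comp_gradedProj_ne h𝒱 (by simpa using hne) hφ)
  · rw [eq_top_iff]
    rintro ⟨v, φ⟩ -
    obtain ⟨T, hT⟩ := exists_sum_gradedProj h𝒱
    have h : ((v, φ) : V × Module.Dual k V) = ∑ d ∈ T, (gradedProj h𝒱 d v, 0) +
        ∑ d ∈ T, (0, φ ∘ₗ gradedProj h𝒱 d) := by
      refine Prod.ext ?_ ?_
      · simp [Prod.fst_sum, hT]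
      · rw [Prod.snd_add, Prod.snd_sum, Prod.snd_sum, Finset.sum_const_zero, zero_add]
        ext x
        rw [LinearMap.sum_apply]
        simp only [LinearMap.comp_apply]
        rw [← map_sum, hT]
    rw [h]
    refine Submodule.add_mem _ (Submodule.sum_mem _ fun d _ => ?_)
      (Submodule.sum_mem _ fun d _ => ?_)
    · refine Submodule.mem_iSup_of_mem (d + 1) ⟨?_, Submodule.zero_mem _⟩
      rw [add_sub_cancel_right]
      exact gradedProj_mem h𝒱 d v
    · refine Submodule.mem_iSup_of_mem (-d - t) ⟨Submodule.zero_mem _, ?_⟩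
      rw [sub_add_cancel]
      exact comp_gradedProj_mem h𝒱 φ d

theorem isInternal_grX [FiniteDimensional k V] (h𝒱 : DirectSum.IsInternal 𝒱) :
    DirectSum.IsInternal (grX 𝒱) :=
  isInternal_prod_dual h𝒱 1

theorem isInternal_grY [FiniteDimensional k V] (h𝒱 : DirectSum.IsInternal 𝒱) :
    DirectSum.IsInternal (grY 𝒱) :=
  isInternal_prod_dual h𝒱 (-1)

variable (k V) in
/-- The bilinear form `((u, α), (v, β)) ↦ α(v)` on `V ⊕ V*`. -/
def evalForm : (V × Module.Dual k V) →ₗ[k] (V × Module.Dual k V) →ₗ[k] k :=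
  (LinearMap.lcomp k k (LinearMap.fst k V (Module.Dual k V))) ∘ₗ LinearMap.snd k V (Module.Dual k V)

variable (𝒱) in
/-- The evaluation form on `↑V ⊕ ↓V*`, of degree `0`. -/
def evalFormX : GradedForm (grX 𝒱) 0 where
  form := evalForm k V
  even := Even.zero
  vanish := by
    rintro i j x y hx hy h
    exact hx.2 (j - 1) (by omega) _ hy.1

variable (𝒱) in
/-- The evaluation form on `↑V ⊕ ↑V*`, of degree `-2`. -/
def evalFormY : GradedForm (grY 𝒱) 2 where
  form := evalForm k V
  even := even_two
  vanish := by
    rintro i j x y hx hy h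
    exact hx.2 (j - 1) (by omega) _ hy.1

theorem span_parityHomogeneous [FiniteDimensional k V] (h𝒱 : DirectSum.IsInternal 𝒱) :
    Submodule.span k (parityHomogeneous (grX 𝒱) (grY 𝒱)) = ⊤ := by
  rw [eq_top_iff, ← span_homogeneous (gr := grX 𝒱) (isInternal_grX h𝒱), Submodule.span_le]
  rintro ⟨v, φ⟩ ⟨d, hv, hφ⟩
  have h : ((v, φ) : V × Module.Dual k V) = (v, 0) + (0, φ) := by simp
  rw [h]
  refine Submodule.add_mem _ (Submodule.subset_span ⟨d, d, ⟨hv, Submodule.zero_mem _⟩,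
    ⟨hv, Submodule.zero_mem _⟩, by simp⟩) (Submodule.subset_span ⟨d, d + 2,
    ⟨Submodule.zero_mem _, hφ⟩, ⟨Submodule.zero_mem _, ?_⟩, by simp⟩)
  rwa [show d + 2 - 1 = d + 1 by ring]

theorem regrade_gen (x : V × Module.Dual k V) :
    regrade 𝒱 (gen (grX 𝒱) x) = gen (grY 𝒱) x :=
  lift_gen _ _ _ _

theorem regrade_bracket [FiniteDimensional k V] (h𝒱 : DirectSum.IsInternal 𝒱) (m : ℕ)
    (f g : GSym (grX 𝒱)) :
    regrade 𝒱 ((evalFormX 𝒱).bracket (isInternal_grX h𝒱) m f g) =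
      (evalFormY 𝒱).bracket (isInternal_grY h𝒱) m (regrade 𝒱 f) (regrade 𝒱 g) := by
  have hΦ : ∀ x, (AlgHomClass.toAlgHom (regrade 𝒱) : GSym (grX 𝒱) →ₐ[k] GSym (grY 𝒱))
      (gen (grX 𝒱) x) = gen (grY 𝒱) x := regrade_gen
  exact map_bracket (gr := grX 𝒱) (gr' := grY 𝒱) (isInternal_grX h𝒱) (isInternal_grY h𝒱)
    (span_parityHomogeneous h𝒱) hΦ (B := evalFormX 𝒱) (B' := evalFormY 𝒱) rfl m f g

/-- The superbig bracket is thus itself the bracket of a graded form, now of degree 2, and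
`isFormalLieBracket` applies to it. -/
theorem transportBracket_regrade [FiniteDimensional k V] (h𝒱 : DirectSum.IsInternal 𝒱) :
    transportBracket (regrade 𝒱) (hExtend ((evalFormX 𝒱).bracket (isInternal_grX h𝒱))) =
      hExtend ((evalFormY 𝒱).bracket (isInternal_grY h𝒱)) :=
  transportBracket_hExtend (regrade 𝒱) (regrade_bracket h𝒱)

/-! ### The shuffle formulas for the evaluation form -/

theorem evalPairing_eq (n : ℕ) (x : Fin n → V × Module.Dual k V) (c : Fin n → ℤ)
    (y : Fin n → V × Module.Dual k V) (e : Fin n → ℤ) :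
    evalPairing n x c y e = (evalFormX 𝒱).wordPairing n x c y e := by
  refine Finset.sum_congr rfl fun σ _ => ?_
  rw [Units.smul_def, ← Int.cast_smul_eq_zsmul k, Units.val_mul, Int.cast_mul, koszulPerm_eq,
    smul_eq_mul, Units.coe_prod, Int.cast_prod]
  congr 2
  refine Finset.prod_congr rfl fun p _ => ?_
  split_ifs
  · rfl
  · simp

theorem upsilon_eq (n : ℕ) (x : Fin n → V × Module.Dual k V) (c : Fin n → ℤ)
    (y : Fin n → V × Module.Dual k V) (e : Fin n → ℤ) :
    upsilon n x c y e = (evalFormX 𝒱).wordPairing n x c y e -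
      koszulSign k (∑ i, c i) (∑ i, e i) * (evalFormX 𝒱).wordPairing n y e x c := by
  rw [upsilon, evalPairing_eq (𝒱 := 𝒱), evalPairing_eq (𝒱 := 𝒱), negOnePow_smul_eq (k := k),
    smul_eq_mul]

theorem isShuffleExtension_star [FiniteDimensional k V] (h𝒱 : DirectSum.IsInternal 𝒱) (n : ℕ) :
    IsShuffleExtension 𝒱 n (evalPairing n) ((evalFormX 𝒱).star (isInternal_grX h𝒱) n) where
  formula a b x c y e hx hy := by
    simp only [evalPairing_eq (𝒱 := 𝒱)]
    exact (evalFormX 𝒱).star_word_word (isInternal_grX h𝒱) hx hy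
  short_left s t x y h := (evalFormX 𝒱).star_word_of_lt _ h x _
  short_right s t x y h := (evalFormX 𝒱).star_right_word_of_lt _ h y _

theorem isShuffleExtension_bracket [FiniteDimensional k V] (h𝒱 : DirectSum.IsInternal 𝒱) (m : ℕ) :
    IsShuffleExtension 𝒱 (m + 1) (upsilon (m + 1))
      ((evalFormX 𝒱).bracket (isInternal_grX h𝒱) m) where
  formula a b x c y e hx hy := by
    simp only [upsilon_eq (𝒱 := 𝒱)]
    exact (evalFormX 𝒱).bracket_word_word (isInternal_grX h𝒱) hx hy
  short_left s t x y h := by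
    rw [GradedForm.bracket_apply, GradedForm.star_word_of_lt _ _ h, GradedForm.star_word_of_lt _ _
        h,
      sub_zero]
  short_right s t x y h := by
    rw [GradedForm.bracket_apply, GradedForm.star_right_word_of_lt _ _ h,
      GradedForm.star_right_word_of_lt _ _ h, sub_zero]

/-- Homogeneous words span S(X), and every pair of them falls under one of the three clauses. -/
theorem IsShuffleExtension.unique (hX : DirectSum.IsInternal (grX 𝒱)) {n : ℕ}
    {K : (Fin n → V × Module.Dual k V) → (Fin n → ℤ) →
      (Fin n → V × Module.Dual k V) → (Fin n → ℤ) → k}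
    {op op' : GSym (grX 𝒱) →ₗ[k] GSym (grX 𝒱) →ₗ[k] GSym (grX 𝒱)}
    (h : IsShuffleExtension 𝒱 n K op) (h' : IsShuffleExtension 𝒱 n K op') : op = op' := by
  refine linearMap_ext_word hX fun s x c hx => linearMap_ext_word hX fun t y e hy => ?_
  obtain hs | hs := lt_or_ge s n
  · rw [h.short_left s t x y hs, h'.short_left s t x y hs]
  obtain ht | ht := lt_or_ge t n
  · rw [h.short_right s t x y ht, h'.short_right s t x y ht]
  obtain ⟨a, rfl⟩ := Nat.exists_eq_add_of_le' hs
  obtain ⟨b, rfl⟩ := Nat.exists_eq_add_of_le ht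
  rw [h.formula a b x c y e hx hy, h'.formula a b x c y e hx hy]

/-! ### The big bracket -/

theorem isCanonicalPoisson_bracket [FiniteDimensional k V] (h𝒱 : DirectSum.IsInternal 𝒱) :
    IsCanonicalPoisson 𝒱 ((evalFormX 𝒱).bracket (isInternal_grX h𝒱) 0) where
  on_gen i j x y hx hy := by
    rw [GradedForm.bracket_zero_gen_gen _ _ hx hy, negOnePow_smul_eq (k := k)]
    rfl
  degree i j a b ha hb := by
    simpa using (evalFormX 𝒱).bracket_mem_deg (isInternal_grX h𝒱) 0 ha hb
  leibniz_right i j a b c ha hb := by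
    rw [negOnePow_smul_eq (k := k)]
    exact (evalFormX 𝒱).bracket_zero_mul _ ha hb c
  leibniz_left j l a b c hb hc := by
    rw [negOnePow_smul_eq (k := k)]
    exact (evalFormX 𝒱).bracket_mul_zero _ a hb hc
  antisymm i j a b ha hb := by
    rw [negOnePow_smul_eq (k := k)]
    exact (evalFormX 𝒱).bracket_antisymm _ 0 ha hb
  jacobi i j l a b c ha hb hc := by
    have hC : ∀ {d : ℤ} {a : GSym (grX 𝒱)}, a ∈ deg (grX 𝒱) d →
        PowerSeries.C a ∈ homogSeries (deg (grX 𝒱)) 0 0 d := by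
      intro d a ha m
      rw [PowerSeries.coeff_C]
      split_ifs with hm
      · simpa [hm] using ha
      · exact Submodule.zero_mem _
    -- Jacobi for the first bracket is the constant coefficient of the formal Jacobi identity on
    -- constant series.
    have h := congrArg (PowerSeries.coeff 0) (((evalFormX 𝒱).isFormalLieBracket
      (isInternal_grX h𝒱)).jacobi i j l _ _ _ (hC ha) (hC hb) (hC hc))
    simpa [negOnePow_smul_eq (k := k), coeff_zero_hExtend,
      -PowerSeries.coeff_zero_eq_constantCoeff] using h

/-- The Leibniz rules reduce both arguments to generators; the unit is killed because Q(f, 1) = 2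
Q(f, 1). -/
theorem IsCanonicalPoisson.unique (hX : DirectSum.IsInternal (grX 𝒱))
    {P P' : GSym (grX 𝒱) →ₗ[k] GSym (grX 𝒱) →ₗ[k] GSym (grX 𝒱)}
    (h : IsCanonicalPoisson 𝒱 P) (h' : IsCanonicalPoisson 𝒱 P') : P = P' := by
  have one_right : ∀ {Q : GSym (grX 𝒱) →ₗ[k] GSym (grX 𝒱) →ₗ[k] GSym (grX 𝒱)},
      IsCanonicalPoisson 𝒱 Q → ∀ d, ∀ f ∈ deg (grX 𝒱) d, Q f 1 = 0 := by
    intro Q hQ d f hf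
    have := hQ.leibniz_right d 0 f 1 1 hf one_mem_deg
    simpa using this
  have one_left : ∀ {Q : GSym (grX 𝒱) →ₗ[k] GSym (grX 𝒱) →ₗ[k] GSym (grX 𝒱)},
      IsCanonicalPoisson 𝒱 Q → ∀ d, ∀ f ∈ deg (grX 𝒱) d, Q 1 f = 0 := by
    intro Q hQ d f hf
    rw [hQ.antisymm 0 d 1 f one_mem_deg hf, one_right hQ d f hf, smul_zero, neg_zero]
  have key : ∀ i, ∀ x ∈ grX 𝒱 i, P (gen (grX 𝒱) x) = P' (gen (grX 𝒱) x) := by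
    intro i x hx
    refine linearMap_ext hX ?_ fun j y hy f hf => ?_
    · rw [one_right h i _ (gen_mem_deg hx), one_right h' i _ (gen_mem_deg hx)]
    · rw [h.leibniz_right i j _ _ _ (gen_mem_deg hx) (gen_mem_deg hy),
        h'.leibniz_right i j _ _ _ (gen_mem_deg hx) (gen_mem_deg hy), h.on_gen i j x y hx hy,
        h'.on_gen i j x y hx hy, hf]
  refine linearMap_ext_deg hX fun d f hf => linearMap_ext_deg hX fun l g hg => ?_
  refine deg_induction (P := fun d f => P f g = P' f g) ?_ ?_ ?_ ?_ ?_ hf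
  · simp
  · intro d f f' hf hf'
    rw [map_add, map_add, LinearMap.add_apply, LinearMap.add_apply, hf, hf']
  · intro d c f hf
    rw [map_smul, map_smul, LinearMap.smul_apply, LinearMap.smul_apply, hf]
  · rw [one_left h l g hg, one_left h' l g hg]
  · intro i d x hx f hf hfg
    rw [h.leibniz_left d l _ f g hf hg, h'.leibniz_left d l _ f g hf hg, key i x hx, hfg]

end Superbig

theorem mainTheorem2 {k : Type u} [Field k] [CharZero k] {V : Type v} [AddCommGroup V]
    [Module k V] [FiniteDimensional k V] (𝒱 : ℤ → Submodule k V)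
    (h𝒱 : DirectSum.IsInternal 𝒱) :
    -- the operations `[-,-]_n = br (n - 1)`, for `n ≥ 1`, are well defined by the shuffle formula
    ∃ br : ℕ → GSym (grX 𝒱) →ₗ[k] GSym (grX 𝒱) →ₗ[k] GSym (grX 𝒱),
      (∀ m, IsShuffleExtension 𝒱 (m + 1) (upsilon (m + 1)) (br m)) ∧
      (∀ br' : ℕ → GSym (grX 𝒱) →ₗ[k] GSym (grX 𝒱) →ₗ[k] GSym (grX 𝒱),
        (∀ m, IsShuffleExtension 𝒱 (m + 1) (upsilon (m + 1)) (br' m)) → br' = br) ∧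
      -- `∑ [-,-]_n h^{n-1}` makes `S(X)[[h]]` a formal operator Lie algebra
      IsFormalOperatorLieAlgebra (GSym.deg (grX 𝒱)) (hExtend br) ∧
      (∀ a b, ∃ N, ∀ m, N ≤ m → br m a b = 0) ∧
      -- the superbig bracket is a Lie bracket on `B(V)[[h]]`, where `h` has degree two
      IsFormalLieBracket (GSym.deg (grY 𝒱)) 2 2 (transportBracket (regrade 𝒱) (hExtend br)) ∧
      -- the superbig bracket reduces to the big bracket modulo `h`
      (∃ P : GSym (grX 𝒱) →ₗ[k] GSym (grX 𝒱) →ₗ[k] GSym (grX 𝒱),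
        IsCanonicalPoisson 𝒱 P ∧ (∀ P', IsCanonicalPoisson 𝒱 P' → P' = P) ∧
        ∀ f g : PowerSeries (GSym (grY 𝒱)),
          PowerSeries.coeff 0 (transportBracket (regrade 𝒱) (hExtend br) f g) =
            regrade 𝒱 (P ((regrade 𝒱).symm (PowerSeries.coeff 0 f))
              ((regrade 𝒱).symm (PowerSeries.coeff 0 g)))) ∧
      -- `h [f, g]` is the graded commutator of the associative star product
      (∃ star : ℕ → GSym (grX 𝒱) →ₗ[k] GSym (grX 𝒱) →ₗ[k] GSym (grX 𝒱),
        (∀ n, IsShuffleExtension 𝒱 n (evalPairing n) (star n)) ∧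
        (∀ star' : ℕ → GSym (grX 𝒱) →ₗ[k] GSym (grX 𝒱) →ₗ[k] GSym (grX 𝒱),
          (∀ n, IsShuffleExtension 𝒱 n (evalPairing n) (star' n)) → star' = star) ∧
        (∀ a b, star 0 a b = a * b) ∧
        (∀ f g l, hExtend star (hExtend star f g) l = hExtend star f (hExtend star g l)) ∧
        ∀ (i j : ℤ) (f g : PowerSeries (GSym (grX 𝒱))),
          f ∈ homogSeries (GSym.deg (grX 𝒱)) 0 0 i → g ∈ homogSeries (GSym.deg (grX 𝒱)) 0 0 j →
          PowerSeries.X * hExtend br f g =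
            hExtend star f g - (i * j).negOnePow • hExtend star g f) := by
  have hX := isInternal_grX h𝒱
  refine ⟨(evalFormX 𝒱).bracket hX, isShuffleExtension_bracket h𝒱,
    fun br' h => funext fun m => (h m).unique hX (isShuffleExtension_bracket h𝒱 m),
    (evalFormX 𝒱).isFormalOperatorLieAlgebra hX, fun a b => ?_, ?_,
    ⟨(evalFormX 𝒱).bracket hX 0, isCanonicalPoisson_bracket h𝒱,
      fun P' h => h.unique hX (isCanonicalPoisson_bracket h𝒱), fun f g => ?_⟩,
    (evalFormX 𝒱).star hX, isShuffleExtension_star h𝒱,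
    fun star' h => funext fun n => (h n).unique hX (isShuffleExtension_star h𝒱 n),
    (evalFormX 𝒱).star_zero hX, (evalFormX 𝒱).starH_assoc hX, fun i j f g hf hg => ?_⟩
  · obtain ⟨N, hN⟩ := (evalFormX 𝒱).exists_bracket_eq_zero hX a
    exact ⟨N, fun m hm => hN m hm b⟩
  -- `evalFormY` has degree 2, which supplies both the degree of `h` and the double desuspension.
  · rw [transportBracket_regrade h𝒱]
    exact (evalFormY 𝒱).isFormalLieBracket (isInternal_grY h𝒱)
  · rw [transportBracket, PowerSeries.coeff_map, coeff_zero_hExtend, PowerSeries.coeff_map,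
      PowerSeries.coeff_map]
    rfl
  · rw [negOnePow_smul_eq (k := k)]
    exact (evalFormX 𝒱).X_mul_hExtend_bracket_eq hX hf hg
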